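/- **Setting.** Let $n\ge 1$, let $G=Sp_{2n}(\mathbb C)$ be the simply connected group of type $C_n$ with index set $I=\{1,\dots,n\}$, Cartan matrix $a_{i,j}=\alpha_j(h_i)$ ($a_{i,i}=2$, $a_{n-1,n}=-2$, $a_{i,j}=-1$ for the other $|i-j|=1$, and $0$ otherwise) and fundamental weights $\Lambda_i$. On the vector representation with basis $v_1,\dots,v_n,v_{\bar n},\dots,v_{\bar 1}$ put $f_iv_i=v_{i+1}$, $f_iv_{\overline{i+1}}=v_{\bar i}$ ($i<n$), $f_nv_n=v_{\bar n}$, all other $f_iv=0$, and $e_i={}^tf_i$. Put $x_i(t)=\exp(te_i)$, $y_i(t)=\exp(tf_i)$, $\alpha_i^\vee(t)=t^{h_i}$, $\bar s_i=x_i(-1)y_i(1)x_i(-1)$ and $\bar u=\bar s_{i_1}\cdots\bar s_{i_r}$ for a reduced word $i_1\cdots i_r$ of $u\in W$. For $g\in G$ let $\Delta_{u\Lambda_k,v\Lambda_k}(g)=\Delta_{\Lambda_k}(\bar u^{-1}g\bar v)$, where $\Delta_{\Lambda_k}$ is the regular function with $\Delta_{\Lambda_k}(u^-tu^+)=\Lambda_k(t)$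 for $u^\pm\in U^\pm$, $t\in T$ (the leading $k\times k$ minor in the vector representation). Let $w_0$ be the longest element of $W$, $\mathbf i_0=(1\,2\cdots n)^n$, and for $c=(c_i^{(p)})_{1\le i,p\le n}\in(\mathbb C^\times)^{n^2}$ $$\Theta^-_{\mathbf i_0}(c)=\prod_{p=1}^{n}\Bigl(\prod_{i=1}^{n}y_i(c_i^{(p)})\,\alpha_i^\vee\bigl((c_i^{(p)})^{-1}\bigr)\Bigr),$$ with factors in increasing order of $p$ and then of $i$. **Columns.** Let $\mathcal B$ be the set of all words $[u_1,\dots,u_m,\bar l_k,\dots,\bar l_1]$ with $m+k=n$, $1\le u_1<\dots<u_m\le n$, $1\le l_1<\dots<l_k\le n$. Let $B(\Lambda_n)\subset\mathcal B$ consist of the words for which $u_a=l_b=i$ implies $a+b\le i$, with its crystal structure as a subcrystal of $B(\Lambda_1)^{\otimes n}$ (columns read from top to bottom, with Kashiwara's tensor product rule) and highest weight vector $u_{\Lambda_n}=[1,2,\dots,n]$. **Rectification.** For a word $v=[u_1,\dots,u_m,\bar l_k,\dots,\bar l_1]$ say that $(u_a,\bar l_b)=(i,\bar i)$ is in $(+1)$-configuration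 if $a+b=i+1$. If such pairs exist, take the smallest such $i$ and a pair $(u_a,\bar l_b)$ with this $i$; let $i,i+1,\dots,j$ and $\bar k,\dots,\overline{i+1},\bar i$ be the maximal consecutive segments of $v$ starting at $u_a$ and ending at $\bar l_b$, respectively; replace the first by $k+1,\dots,k+j-i+1$ and the second by $\overline{k+j-i+1},\dots,\overline{j+1}$. If there are two such pairs for this $i$, the one with the larger $a$ is treated first, and then the other one. Repeating this, every $v\in\mathcal B$ is transformed into a unique element $\mathrm{Rect}(v)\in B(\Lambda_n)$. Put $n(b)=\#\{v\in\mathcal B\mid \mathrm{Rect}(v)=b\}$. **Monomials.** Let $\mathcal Y(p)$ be the crystal of Laurent monomials $Y=\prod Y_{m,i}^{l_{m,i}}$ ($m\in\mathbb Z$, $i\in I$) with $p_{i,j}=1$ for $i<j$ and $p_{i,j}=0$ for $i>j$, $A_{m,i}=Y_{m,i}Y_{m+1,i}\prod_{j\ne i}Y_{m+p_{j,i},j}^{a_{j,i}}$, $\mathrm{wt}(Y)=\sum l_{m,i}\Lambda_i$, $\varphi_i(Y)=\max_m\sum_{k\le m}l_{k,i}$, $\varepsilon_i(Y)=\varphi_i(Y)-\mathrm{wt}(Y)(h_i)$;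 $\tilde f_iY=A_{m,i}^{-1}Y$ with $m$ minimal such that $\varphi_i(Y)=\sum_{k\le m}l_{k,i}$ if $\varphi_i(Y)>0$, and $\tilde f_iY=0$ otherwise; $\tilde e_iY=A_{m,i}Y$ with $m$ maximal such that $\varphi_i(Y)=\sum_{k\le m}l_{k,i}$ if $\varepsilon_i(Y)>0$, and $\tilde e_iY=0$ otherwise. Let $m_n^{(0)}:B(\Lambda_n)\hookrightarrow\mathcal Y(p)$ be the unique embedding of crystals with $u_{\Lambda_n}\mapsto Y_{0,n}$. Write $c_i^{(m)}$ for $Y_{m,i}$. **Theorem.** $\mathrm{Rect}$ and $m_n^{(0)}$ are well defined, and for every $c\in(\mathbb C^\times)^{n^2}$ $$\Delta_{w_0s_n\Lambda_n,\Lambda_n}\bigl(\Theta^-_{\mathbf i_0}(c)\bigr)=\sum_{b\in B(\Lambda_n)\setminus\{u_{\Lambda_n}\}}n(b)\cdot m_n^{(0)}(b),$$ where the monomials on the right are evaluated at $c$. -/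

import Mathlib

namespace TypeC

/-! ### Root datum of type `C_n`

Simple roots, coroots and fundamental weights are indexed by `I = Fin n`; the element `i : Fin n`
stands for the index `i.val + 1` of `{1, …, n}`. -/

/-- The Cartan matrix `a_{i,j} = α_j(h_i)` of type `C_n` (`α_n` is the long root). -/
def cartan (n : ℕ) (i j : Fin n) : ℤ :=
  if i = j then 2
  else if i.val + 1 = j.val ∧ j.val + 1 = n then -2
  else if i.val + 1 = j.val ∨ j.val + 1 = i.val then -1
  else 0

/-- The last index `n` of `{1, …, n}`. -/
def lastIdx (n : ℕ) (hn : 0 < n) : Fin n := ⟨n - 1, by omega⟩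

/-- The simple reflection `s_i` on the weight lattice. A weight `lam` is given by its coordinates
`lam j = ⟨h_j, lam⟩` with respect to the fundamental weights;
`s_i lam = lam - ⟨h_i, lam⟩ α_i`. -/
def simpleReflection (n : ℕ) (i : Fin n) (lam : Fin n → ℤ) : Fin n → ℤ :=
  fun j => lam j - lam i * cartan n j i

/-- The Weyl group element `s_{i_1} ⋯ s_{i_r}` of a word `i_1 ⋯ i_r`, as an operator on the weight
lattice (on which the Weyl group acts faithfully). -/
def weylOf (n : ℕ) (w : List (Fin n)) : (Fin n → ℤ) → (Fin n → ℤ) :=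
  fun lam => w.foldr (simpleReflection n) lam

/-- A word is reduced if no shorter word represents the same Weyl group element. -/
def IsReducedWord (n : ℕ) (w : List (Fin n)) : Prop :=
  ∀ w' : List (Fin n), weylOf n w' = weylOf n w → w.length ≤ w'.length

/-- The reduced word `(1 2 ⋯ n)^n` of the longest Weyl group element `w_0`. -/
def longestWord (n : ℕ) : List (Fin n) :=
  (List.finRange n).flatMap fun _ => List.finRange n

/-! ### The group of type `C_n` in the vector representation

The simply connected group is `Sp_{2n}(ℂ)`, realised faithfully on the vector representation
`V(Λ_1)` with basis `v_1, …, v_n, v_{\bar 1}, …, v_{\bar n}`. -/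

/-- Index set of the basis of `V(Λ_1)`: `inl i` is `v_{i+1}` and `inr i` is `v_{\overline{i+1}}`. -/
abbrev BasisIdx (n : ℕ) := Fin n ⊕ Fin n

/-- The Chevalley generator `f_i` on `V(Λ_1)`: for `i < n` it maps `v_i ↦ v_{i+1}` and
`v_{\overline{i+1}} ↦ v_{\bar i}`, and `f_n` maps `v_n ↦ v_{\bar n}`; all other basis vectors go
to zero. Columns are sources and rows are targets. -/
def fMat (n : ℕ) (i : Fin n) : Matrix (BasisIdx n) (BasisIdx n) ℂ :=
  Matrix.of fun r s =>
    match r, s with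
    | .inl a, .inl b => if b = i ∧ a.val = i.val + 1 then 1 else 0
    | .inr a, .inr b => if a = i ∧ b.val = i.val + 1 then 1 else 0
    | .inr a, .inl b => if a = i ∧ b = i ∧ i.val + 1 = n then 1 else 0
    | .inl _, .inr _ => 0

/-- The Chevalley generator `e_i` on `V(Λ_1)`: for `i < n` it maps `v_{i+1} ↦ v_i` and
`v_{\bar i} ↦ v_{\overline{i+1}}`, and `e_n` maps `v_{\bar n} ↦ v_n`; all other basis vectors go
to zero. -/
def eMat (n : ℕ) (i : Fin n) : Matrix (BasisIdx n) (BasisIdx n) ℂ := (fMat n i).transpose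

theorem fMat_mul_self (n : ℕ) (i : Fin n) : fMat n i * fMat n i = 0 := by
  ext r s
  simp only [Matrix.mul_apply, Fintype.sum_sum_type, Matrix.zero_apply]
  have h : ∀ t, fMat n i r t * fMat n i t s = 0 := by
    intro t
    rcases r with a | a <;> rcases s with b | b <;> rcases t with d | d <;>
      simp only [fMat, Matrix.of_apply, mul_ite, mul_one, mul_zero] <;>
      grind
  simp [h]

/-- `x_i(t) = exp(t e_i)`, which is `1 + t e_i` since `e_i ^ 2 = 0` on `V(Λ_1)`. -/
def xMat (n : ℕ) (i : Fin n) (t : ℂ) : Matrix (BasisIdx n) (BasisIdx n) ℂ := 1 + t • eMat n i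

/-- `y_i(t) = exp(t f_i)`, which is `1 + t f_i` since `f_i ^ 2 = 0` on `V(Λ_1)`. -/
def yMat (n : ℕ) (i : Fin n) (t : ℂ) : Matrix (BasisIdx n) (BasisIdx n) ℂ := 1 + t • fMat n i

/-- `α_i^∨(t) = t^{h_i}`: a weight vector `v` of `V(Λ_1)` is scaled by `t^{⟨h_i, wt v⟩}`, where
`wt v_j = Λ_j - Λ_{j-1} = - wt v_{\bar j}`. -/
noncomputable def corootMat (n : ℕ) (i : Fin n) (t : ℂ) : Matrix (BasisIdx n) (BasisIdx n) ℂ :=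
  Matrix.diagonal fun s =>
    match s with
    | .inl a => if a = i then t else if a.val = i.val + 1 then t⁻¹ else 1
    | .inr a => if a = i then t⁻¹ else if a.val = i.val + 1 then t else 1

/-- The representative `x_i(-1) y_i(1) x_i(-1)` of the simple reflection `s_i`. -/
def sBar (n : ℕ) (i : Fin n) : Matrix (BasisIdx n) (BasisIdx n) ℂ :=
  xMat n i (-1) * yMat n i 1 * xMat n i (-1)

/-- The representative `\bar s_{i_1} ⋯ \bar s_{i_r}` of the Weyl group element with reduced word
`i_1 ⋯ i_r`. -/
def weylLift (n : ℕ) (w : List (Fin n)) : Matrix (BasisIdx n) (BasisIdx n) ℂ :=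
  (w.map (sBar n)).prod

/-- `y_i(t) α_i^∨(t⁻¹)`. -/
noncomputable def boldY (n : ℕ) (i : Fin n) (t : ℂ) : Matrix (BasisIdx n) (BasisIdx n) ℂ :=
  yMat n i t * corootMat n i t⁻¹

/-- `Θ^-_{i_0}(c)` for the word `i_0 = (1 2 ⋯ n)^n`. The parameter `c_i^{(p)}` is `c i p`
(with the index shift of `Fin n` for `i`), and the parameters are taken in the order
`c_1^{(1)}, …, c_n^{(1)}, c_1^{(2)}, …, c_n^{(2)}, …, c_1^{(n)}, …, c_n^{(n)}`. Only the values
`c i p` with `1 ≤ p ≤ n` are used. -/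
noncomputable def thetaMinus (n : ℕ) (c : Fin n → ℤ → ℂ) :
    Matrix (BasisIdx n) (BasisIdx n) ℂ :=
  ((List.finRange n).flatMap fun p =>
    (List.finRange n).map fun i => boldY n i (c i ((p.val : ℤ) + 1))).prod

/-- The principal minor `Δ_{Λ_k}` on the group: the leading `k × k` minor in the vector
representation, i.e. the matrix coefficient of `v_1 ∧ ⋯ ∧ v_k`. It is a polynomial function
satisfying `Δ_{Λ_k}(u⁻ t u⁺) = Λ_k(t)`, see `principalMinor_gauss`. -/
def principalMinor (n : ℕ) (k : Fin n) (g : Matrix (BasisIdx n) (BasisIdx n) ℂ) : ℂ :=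
  (g.submatrix (fun a : {a : Fin n // a ≤ k} => Sum.inl a.val)
    (fun a : {a : Fin n // a ≤ k} => Sum.inl a.val)).det

/-- The generalized minor `Δ_{uΛ_k, vΛ_k}(g) = Δ_{Λ_k}(\bar u⁻¹ g \bar v)`, for Weyl group elements
`u`, `v` given by reduced words. -/
noncomputable def generalizedMinor (n : ℕ) (k : Fin n) (u v : List (Fin n))
    (g : Matrix (BasisIdx n) (BasisIdx n) ℂ) : ℂ :=
  principalMinor n k ((weylLift n u)⁻¹ * g * weylLift n v)

/-- The unipotent group `U⁻`, generated by the `y_i(t)`. -/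
def lowerUnipotent (n : ℕ) : Submonoid (Matrix (BasisIdx n) (BasisIdx n) ℂ) :=
  Submonoid.closure {g | ∃ i t, g = yMat n i t}

/-- The unipotent group `U⁺`, generated by the `x_i(t)`. -/
def upperUnipotent (n : ℕ) : Submonoid (Matrix (BasisIdx n) (BasisIdx n) ℂ) :=
  Submonoid.closure {g | ∃ i t, g = xMat n i t}

theorem lowerUnipotent_shape {n : ℕ} {g : Matrix (BasisIdx n) (BasisIdx n) ℂ}
    (hg : g ∈ lowerUnipotent n) :
    (∀ a b, g (.inl a) (.inr b) = 0) ∧ (∀ a b, a < b → g (.inl a) (.inl b) = 0) ∧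
      ∀ a, g (.inl a) (.inl a) = 1 := by
  induction hg using Submonoid.closure_induction with
  | mem g h =>
    obtain ⟨i, t, rfl⟩ := h
    refine ⟨fun a b => ?_, fun a b hab => ?_, fun a => ?_⟩
    · simp [yMat, fMat]
    · have h1 : ¬ (b = i ∧ a.val = i.val + 1) := by
        rintro ⟨rfl, h⟩
        have := Fin.lt_def.1 hab
        omega
      simp [yMat, fMat, hab.ne, h1]
    · have h1 : ¬ (a = i ∧ a.val = i.val + 1) := by
        rintro ⟨rfl, h⟩
        omega
      simp [yMat, fMat, h1]
  | one => exact ⟨by simp, fun a b hab => by simp [hab.ne], by simp⟩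
  | mul x y _ _ hx hy =>
    obtain ⟨x1, x2, x3⟩ := hx
    obtain ⟨y1, y2, y3⟩ := hy
    refine ⟨fun a b => ?_, fun a b hab => ?_, fun a => ?_⟩
    · simp [Matrix.mul_apply, x1, y1]
    · simp only [Matrix.mul_apply, Fintype.sum_sum_type, x1, zero_mul, Finset.sum_const_zero,
        add_zero]
      refine Finset.sum_eq_zero fun d _ => ?_
      rcases lt_or_ge a d with h | h
      · simp [x2 a d h]
      · simp [y2 d b (lt_of_le_of_lt h hab)]
    · simp only [Matrix.mul_apply, Fintype.sum_sum_type, x1, zero_mul, Finset.sum_const_zero,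
        add_zero]
      rw [Finset.sum_eq_single a]
      · simp [x3, y3]
      · intro d _ hd
        rcases lt_or_gt_of_ne hd with h | h
        · simp [y2 d a h]
        · simp [x2 a d h]
      · simp

theorem transpose_mem_lowerUnipotent {n : ℕ} {g : Matrix (BasisIdx n) (BasisIdx n) ℂ}
    (hg : g ∈ upperUnipotent n) : g.transpose ∈ lowerUnipotent n := by
  induction hg using Submonoid.closure_induction with
  | mem g h =>
    obtain ⟨i, t, rfl⟩ := h
    exact Submonoid.subset_closure ⟨i, t, by simp [xMat, yMat, eMat]⟩
  | one =>
    rw [Matrix.transpose_one]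
    exact (lowerUnipotent n).one_mem
  | mul x y _ _ hx hy => simpa using (lowerUnipotent n).mul_mem hy hx

theorem prod_corootMat {n : ℕ} (k : Fin n) (z : Fin n → ℂ) (hz : ∀ i, z i ≠ 0)
    (l : List (Fin n)) (hl : l.Nodup) :
    ∃ d : BasisIdx n → ℂ, (l.map fun i => corootMat n i (z i)).prod = Matrix.diagonal d ∧
      ∏ a : {a : Fin n // a ≤ k}, d (.inl a.val) = if k ∈ l then z k else 1 := by
  induction l with
  | nil => exact ⟨fun _ => 1, by simp, by simp⟩
  | cons i l ih =>
    obtain ⟨hi, hl⟩ := List.nodup_cons.1 hl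
    obtain ⟨d, h1, h2⟩ := ih hl
    refine ⟨_, by
      rw [List.map_cons, List.prod_cons, h1, corootMat, Matrix.diagonal_mul_diagonal], ?_⟩
    rw [Finset.prod_mul_distrib, h2]
    have key : ∏ a : {a : Fin n // a ≤ k},
        (if a.val = i then z i else if a.val.val = i.val + 1 then (z i)⁻¹ else 1) =
          if k = i then z i else 1 := by
      have hsplit : ∀ a : Fin n,
          (if a = i then z i else if a.val = i.val + 1 then (z i)⁻¹ else 1) =
            (if a = i then z i else 1) * (if a.val = i.val + 1 then (z i)⁻¹ else 1) := by
        intro a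
        by_cases h : a = i
        · have h' : ¬ a.val = i.val + 1 := by
            rw [h]
            omega
          simp [h]
        · simp [h]
      simp only [hsplit]
      rw [Finset.prod_mul_distrib]
      have e1 : ∏ a : {a : Fin n // a ≤ k}, (if a.val = i then z i else 1) =
          if i ≤ k then z i else 1 := by
        by_cases h : i ≤ k
        · rw [Finset.prod_eq_single (⟨i, h⟩ : {a : Fin n // a ≤ k})]
          · simp [h]
          · rintro ⟨b, hb⟩ _ hne
            have : b ≠ i := fun e => hne (Subtype.ext e)
            simp [this]
          · simp
        · rw [if_neg h]
          refine Finset.prod_eq_one fun a _ => ?_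
          have : a.val ≠ i := fun e => h (e ▸ a.2)
          simp [this]
      have e2 : ∏ a : {a : Fin n // a ≤ k}, (if a.val.val = i.val + 1 then (z i)⁻¹ else 1) =
          if i < k then (z i)⁻¹ else 1 := by
        by_cases h : i < k
        · have h' := Fin.lt_def.1 h
          rw [Finset.prod_eq_single
            (⟨⟨i.val + 1, by omega⟩, Fin.le_def.2 (by simpa using h')⟩ : {a : Fin n // a ≤ k})]
          · simp [h]
          · rintro ⟨b, hb⟩ _ hne
            have : b.val ≠ i.val + 1 := fun e => hne (Subtype.ext (Fin.ext e))
            simp [this]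
          · simp
        · rw [if_neg h]
          refine Finset.prod_eq_one fun a _ => ?_
          have : a.val.val ≠ i.val + 1 := fun e => h (Fin.lt_def.2 (by
            have := Fin.le_def.1 a.2
            omega))
          simp [this]
      rw [e1, e2]
      rcases lt_trichotomy i k with h | h | h
      · simp [h, h.le, h.ne', hz i]
      · simp [h]
      · simp [h.not_ge, h.not_gt, h.ne]
    rw [key]
    by_cases h : k = i
    · subst h
      simp [hi]
    · simp [h]

/-- The defining property of the principal minor: `Δ_{Λ_k}(u⁻ t u⁺) = Λ_k(t)` for `u^± ∈ U^±` and
`t = ∏_i α_i^∨(z_i)` in the maximal torus, where `Λ_k(t) = z_k`. -/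
theorem principalMinor_gauss (n : ℕ) (k : Fin n) (z : Fin n → ℂ) (hz : ∀ i, z i ≠ 0)
    {x y : Matrix (BasisIdx n) (BasisIdx n) ℂ}
    (hx : x ∈ lowerUnipotent n) (hy : y ∈ upperUnipotent n) :
    principalMinor n k (x * ((List.finRange n).map fun i => corootMat n i (z i)).prod * y) =
      z k := by
  obtain ⟨d, h1, h2⟩ := prod_corootMat k z hz (List.finRange n) (List.nodup_finRange n)
  obtain ⟨x1, x2, x3⟩ := lowerUnipotent_shape hx
  obtain ⟨-, y2, y3⟩ := lowerUnipotent_shape (transpose_mem_lowerUnipotent hy)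
  simp only [Matrix.transpose_apply] at y2 y3
  rw [h1]
  have hsub : (x * Matrix.diagonal d * y).submatrix
      (fun a : {a : Fin n // a ≤ k} => Sum.inl a.val)
      (fun a : {a : Fin n // a ≤ k} => Sum.inl a.val) =
      (x.submatrix (fun a : {a : Fin n // a ≤ k} => Sum.inl a.val)
        (fun a : {a : Fin n // a ≤ k} => Sum.inl a.val)) *
      Matrix.diagonal (fun a : {a : Fin n // a ≤ k} => d (.inl a.val)) *
      (y.submatrix (fun a : {a : Fin n // a ≤ k} => Sum.inl a.val)
        (fun a : {a : Fin n // a ≤ k} => Sum.inl a.val)) := by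
    ext a b
    rw [Matrix.submatrix_apply, Matrix.mul_apply, Matrix.mul_apply]
    simp only [Matrix.submatrix_apply, Matrix.mul_diagonal,
      Fintype.sum_sum_type, x1, zero_mul, Finset.sum_const_zero, add_zero]
    rw [Finset.sum_congr_set {c : Fin n | c ≤ k}
      (fun c => x (.inl a.val) (.inl c) * d (.inl c) * y (.inl c) (.inl b.val))
      (fun c : {c : Fin n // c ≤ k} =>
        x (.inl a.val) (.inl c.val) * d (.inl c.val) * y (.inl c.val) (.inl b.val))
      (fun _ _ => rfl)]
    · rfl
    · intro c hc
      have : a.val < c := lt_of_le_of_lt a.2 (not_le.1 hc)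
      simp [x2 _ _ this]
  rw [principalMinor, hsub, Matrix.det_mul, Matrix.det_mul, Matrix.det_diagonal, h2]
  have l1 : (x.submatrix (fun a : {a : Fin n // a ≤ k} => Sum.inl a.val)
        (fun a : {a : Fin n // a ≤ k} => Sum.inl a.val)).det = 1 := by
    rw [Matrix.det_of_isLowerTriangular]
    · simp [x3]
    · intro a b hab
      exact x2 _ _ hab
  have l2 : (y.submatrix (fun a : {a : Fin n // a ≤ k} => Sum.inl a.val)
        (fun a : {a : Fin n // a ≤ k} => Sum.inl a.val)).det = 1 := by
    rw [Matrix.det_of_isUpperTriangular]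
    · simp [y3]
    · intro a b hab
      exact y2 _ _ hab
  rw [l1, l2]
  simp

/-! ### Crystals -/

/-- The data of a crystal with index set `I` on a set `B`: weights (in coordinates with respect to
the fundamental weights), the functions `ε_i`, `φ_i` and the Kashiwara operators `ẽ_i`, `f̃_i`,
where `none` plays the role of `0`. -/
structure CrystalData (I B : Type*) where
  wt : B → I → ℤ
  eps : I → B → ℤ
  phi : I → B → ℤ
  e : I → B → Option B
  f : I → B → Option B

/-- Embeddings of crystals: injective maps that preserve weights, `ε_i` and `φ_i` and commute with
all `ẽ_i` and `f̃_i`. -/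
structure IsCrystalEmbedding {I B B' : Type*} (C : CrystalData I B) (C' : CrystalData I B')
    (m : B → B') : Prop where
  injective : Function.Injective m
  wt_eq : ∀ b, C'.wt (m b) = C.wt b
  eps_eq : ∀ i b, C'.eps i (m b) = C.eps i b
  phi_eq : ∀ i b, C'.phi i (m b) = C.phi i b
  e_eq : ∀ i b, C'.e i (m b) = (C.e i b).map m
  f_eq : ∀ i b, C'.f i (m b) = (C.f i b).map m

/-! ### Monomial realization -/

/-- Laurent monomials `∏ Y_{m,i}^{l_{m,i}}`, given by their exponents `l_{m,i}`; multiplication of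
monomials is addition of exponents. The variable `Y_{m,i}` is also written `c_i^{(m)}`. -/
abbrev LaurentMonomial (n : ℕ) := (ℤ × Fin n) →₀ ℤ

/-- The variable `Y_{m,i}`. -/
noncomputable def monoVar (n : ℕ) (m : ℤ) (i : Fin n) : LaurentMonomial n := Finsupp.single (m, i) 1

/-- The sign `p_{i,j}` attached to the cyclic sequence `⋯ (1 2 ⋯ n)(1 2 ⋯ n) ⋯`. -/
def signP (n : ℕ) (i j : Fin n) : ℤ := if i < j then 1 else 0

/-- The monomial `A_{m,i} = Y_{m,i} Y_{m+1,i} ∏_{j ≠ i} Y_{m+p_{j,i}, j}^{a_{j,i}}`. -/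
noncomputable def monoA (n : ℕ) (m : ℤ) (i : Fin n) : LaurentMonomial n :=
  monoVar n m i + monoVar n (m + 1) i +
    ∑ j ∈ Finset.univ.erase i, cartan n j i • monoVar n (m + signP n j i) j

/-- The partial sum `∑_{k ≤ m} l_{k,i}`. -/
def partialSum {n : ℕ} (Y : LaurentMonomial n) (i : Fin n) (m : ℤ) : ℤ :=
  ∑ q ∈ Y.support.filter (fun q => q.2 = i ∧ q.1 ≤ m), Y q

/-- `⟨h_i, wt(Y)⟩ = ∑_m l_{m,i}`. -/
def monoWt {n : ℕ} (Y : LaurentMonomial n) (i : Fin n) : ℤ :=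
  ∑ q ∈ Y.support.filter (fun q => q.2 = i), Y q

/-- `φ_i(Y) = max_m ∑_{k ≤ m} l_{k,i}`. -/
noncomputable def monoPhi {n : ℕ} (i : Fin n) (Y : LaurentMonomial n) : ℤ :=
  sSup (Set.range (partialSum Y i))

/-- `ε_i(Y) = φ_i(Y) - ⟨h_i, wt(Y)⟩`. -/
noncomputable def monoEps {n : ℕ} (i : Fin n) (Y : LaurentMonomial n) : ℤ :=
  monoPhi i Y - monoWt Y i

/-- `n_f^{(i)}(Y) = min {m | φ_i(Y) = ∑_{k ≤ m} l_{k,i}}`, used only if `φ_i(Y) > 0`. -/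
noncomputable def monoNf {n : ℕ} (i : Fin n) (Y : LaurentMonomial n) : ℤ :=
  sInf {m | monoPhi i Y = partialSum Y i m}

/-- `n_e^{(i)}(Y) = max {m | φ_i(Y) = ∑_{k ≤ m} l_{k,i}}`, used only if `ε_i(Y) > 0`. -/
noncomputable def monoNe {n : ℕ} (i : Fin n) (Y : LaurentMonomial n) : ℤ :=
  sSup {m | monoPhi i Y = partialSum Y i m}

/-- The crystal of monomials `𝒴(p)` for the cyclic sequence `⋯ (1 2 ⋯ n)(1 2 ⋯ n) ⋯`. -/
noncomputable def monomialCrystal (n : ℕ) : CrystalData (Fin n) (LaurentMonomial n) where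
  wt := monoWt
  eps := monoEps
  phi := monoPhi
  e i Y := if 0 < monoEps i Y then some (Y + monoA n (monoNe i Y) i) else none
  f i Y := if 0 < monoPhi i Y then some (Y - monoA n (monoNf i Y) i) else none

/-- The value of a Laurent monomial at `Y_{m,i} = c_i^{(m)}`. -/
noncomputable def evalMono {n : ℕ} (c : Fin n → ℤ → ℂ) (Y : LaurentMonomial n) : ℂ :=
  Y.prod fun q l => c q.2 q.1 ^ l

/-! ### Columns and the crystal `B(Λ_n)` -/

/-- The letters `1, 2, …` and `\bar 1, \bar 2, …`. -/
inductive Letter where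
  | pos (j : ℕ)
  | neg (j : ℕ)

/-- The coefficient `⟨h_r, wt(v_j)⟩`, where `wt(v_j) = Λ_j - Λ_{j-1} = - wt(v_{\bar j})`. -/
def letterWt (r : ℕ) : Letter → ℤ
  | .pos j => (if j = r then 1 else 0) - (if j = r + 1 then 1 else 0)
  | .neg j => (if j = r + 1 then 1 else 0) - (if j = r then 1 else 0)

/-- `f̃_r` on the crystal `B(Λ_1)` of the vector representation. -/
def letterF (n r : ℕ) : Letter → Option Letter
  | .pos j => if j = r then (if r < n then some (.pos (r + 1)) else some (.neg n)) else none
  | .neg j => if j = r + 1 ∧ r < n then some (.neg r) else none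

/-- `ẽ_r` on the crystal `B(Λ_1)` of the vector representation. -/
def letterE (n r : ℕ) : Letter → Option Letter
  | .pos j => if j = r + 1 ∧ r < n then some (.pos r) else none
  | .neg j => if j = r then (if r < n then some (.neg (r + 1)) else some (.pos n)) else none

/-- `φ_r` on `B(Λ_1)`. -/
def letterPhi (n r : ℕ) (x : Letter) : ℕ := if (letterF n r x).isSome then 1 else 0

/-- `ε_r` on `B(Λ_1)`. -/
def letterEps (n r : ℕ) (x : Letter) : ℕ := if (letterE n r x).isSome then 1 else 0

/-- The weight of `x_1 ⊗ ⋯ ⊗ x_k`. -/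
def wordWt (r : ℕ) (w : List Letter) : ℤ := (w.map (letterWt r)).sum

/-- `ε_r` on the tensor product `B(Λ_1)^{⊗ k}`: `ε(x ⊗ w) = ε(x) + max(0, ε(w) - φ(x))`
(the subtraction is truncated). -/
def wordEps (n r : ℕ) : List Letter → ℕ
  | [] => 0
  | x :: w => letterEps n r x + (wordEps n r w - letterPhi n r x)

/-- `φ_r` on the tensor product `B(Λ_1)^{⊗ k}`: `φ(x ⊗ w) = φ(w) + max(0, φ(x) - ε(w))`
(the subtraction is truncated). -/
def wordPhi (n r : ℕ) : List Letter → ℕ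
  | [] => 0
  | x :: w => wordPhi n r w + (letterPhi n r x - wordEps n r w)

/-- `f̃_r` on `B(Λ_1)^{⊗ k}` by the tensor product rule:
`f̃(x ⊗ w) = f̃ x ⊗ w` if `φ(x) > ε(w)`, and `x ⊗ f̃ w` otherwise. -/
def wordF (n r : ℕ) : List Letter → Option (List Letter)
  | [] => none
  | x :: w =>
    if wordEps n r w < letterPhi n r x then (letterF n r x).map (fun y => y :: w)
    else (wordF n r w).map (fun w' => x :: w')

/-- `ẽ_r` on `B(Λ_1)^{⊗ k}` by the tensor product rule:
`ẽ(x ⊗ w) = ẽ x ⊗ w` if `φ(x) ≥ ε(w)`, and `x ⊗ ẽ w` otherwise. -/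
def wordE (n r : ℕ) : List Letter → Option (List Letter)
  | [] => none
  | x :: w =>
    if wordEps n r w ≤ letterPhi n r x then (letterE n r x).map (fun y => y :: w)
    else (wordE n r w).map (fun w' => x :: w')

/-- A word `[u_1, …, u_m, \bar l_k, …, \bar l_1]`, given by the lists `u = (u_1, …, u_m)` and
`l = (l_1, …, l_k)`; note that `l` lists the barred letters from the last one backwards. -/
@[ext]
structure Column where
  u : List ℕ
  l : List ℕ
deriving DecidableEq

/-- The underlying word `[u_1, …, u_m, \bar l_k, …, \bar l_1]`. -/
def Column.word (v : Column) : List Letter :=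
  v.u.map Letter.pos ++ (v.l.map Letter.neg).reverse

/-- The inverse of `Column.word`. -/
def Column.ofWord (w : List Letter) : Column where
  u := w.filterMap fun x => match x with
    | .pos j => some j
    | .neg _ => none
  l := (w.filterMap fun x => match x with
    | .pos _ => none
    | .neg j => some j).reverse

/-- The set `𝓑` of all columns `[j_1, …, j_n]` of length `n` with
`1 ≤ j_1 < ⋯ < j_n ≤ \bar 1`, in the order `1 < ⋯ < n < \bar n < ⋯ < \bar 1`. -/
def IsColumn (n : ℕ) (v : Column) : Prop :=
  v.u.Pairwise (· < ·) ∧ v.l.Pairwise (· < ·) ∧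
  (∀ x ∈ v.u, 1 ≤ x ∧ x ≤ n) ∧ (∀ x ∈ v.l, 1 ≤ x ∧ x ≤ n) ∧
  v.u.length + v.l.length = n

/-- The columns in `B(Λ_n)`: those for which `u_a = l_b = i` implies `a + b ≤ i`.
(List positions are counted from `0`.) -/
def IsAdmissible (n : ℕ) (v : Column) : Prop :=
  IsColumn n v ∧
  ∀ a b i : ℕ, v.u[a]? = some i → v.l[b]? = some i → (a + 1) + (b + 1) ≤ i

/-- The underlying set of the crystal `B(Λ_n)`. -/
abbrev AdmissibleColumn (n : ℕ) := {v : Column // IsAdmissible n v}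

theorem finite_isColumn (n : ℕ) : {v : Column | IsColumn n v}.Finite := by
  refine Set.Finite.subset (Set.Finite.image
    (fun p : Finset ℕ × Finset ℕ => (⟨p.1.sort (· ≤ ·), p.2.sort (· ≤ ·)⟩ : Column))
    (Finset.finite_toSet ((Finset.Icc 1 n).powerset ×ˢ (Finset.Icc 1 n).powerset))) ?_
  rintro v ⟨h1, h2, h3, h4, -⟩
  refine ⟨(v.u.toFinset, v.l.toFinset), ?_, ?_⟩
  · simp only [Finset.coe_product, Finset.coe_powerset, Set.mem_prod, Set.mem_preimage,
      Set.mem_powerset_iff, Finset.coe_subset]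
    constructor
    · intro x hx
      simpa using h3 x (by simpa using hx)
    · intro x hx
      simpa using h4 x (by simpa using hx)
  · have key : ∀ s : List ℕ, s.Pairwise (· < ·) → s.toFinset.sort (· ≤ ·) = s := fun s hs =>
      (List.toFinset_sort (· ≤ ·) (hs.imp (fun h => ne_of_lt h))).2 (hs.imp (fun h => le_of_lt h))
    simp only [key _ h1, key _ h2]

instance (n : ℕ) : Finite (AdmissibleColumn n) :=
  ((finite_isColumn n).subset (fun _ h => h.1) : {v : Column | IsAdmissible n v}.Finite).to_subtype

noncomputable instance (n : ℕ) : Fintype (AdmissibleColumn n) := Fintype.ofFinite _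

/-- A word as an element of `B(Λ_n)`, if it is one. -/
noncomputable def toAdmissible (n : ℕ) (w : List Letter) : Option (AdmissibleColumn n) :=
  open Classical in
  if h : IsAdmissible n (Column.ofWord w) then some ⟨Column.ofWord w, h⟩ else none

/-- The crystal `B(Λ_n)`, as a subcrystal of `B(Λ_1)^{⊗ n}` by reading a column from top to
bottom. -/
noncomputable def columnCrystal (n : ℕ) : CrystalData (Fin n) (AdmissibleColumn n) where
  wt b i := wordWt (i.val + 1) b.val.word
  eps i b := wordEps n (i.val + 1) b.val.word
  phi i b := wordPhi n (i.val + 1) b.val.word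
  e i b := (wordE n (i.val + 1) b.val.word).bind (toAdmissible n)
  f i b := (wordF n (i.val + 1) b.val.word).bind (toAdmissible n)

/-- The highest weight vector `u_{Λ_n} = [1, 2, …, n]` of `B(Λ_n)`. -/
def highestColumn (n : ℕ) : AdmissibleColumn n :=
  ⟨⟨List.range' 1 n, []⟩, by
    refine ⟨⟨List.pairwise_lt_range', by simp, ?_, by simp, by simp⟩, by simp⟩
    intro x hx
    simp only [List.mem_range'_1] at hx
    omega⟩

/-! ### Rectification -/

/-- The length of the maximal consecutive run `x, x + 1, x + 2, …` at the head of a list. -/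
def runLength : List ℕ → ℕ
  | [] => 0
  | [_] => 1
  | x :: y :: t => if y = x + 1 then runLength (y :: t) + 1 else 1

/-- The pair `(u_a, \bar l_b)` equals `(i, \bar i)` and is in `(+1)`-configuration:
`a + b = i + 1`. (List positions are counted from `0`.) -/
def IsPlusOnePair (v : Column) (a b i : ℕ) : Prop :=
  v.u[a]? = some i ∧ v.l[b]? = some i ∧ (a + 1) + (b + 1) = i + 1

/-- Let `i = u_a = l_b`, and let `i, i + 1, …, j` and `\bar k, …, \overline{i+1}, \bar i` be the
maximal segments of `v` starting at `u_a`, respectively at `\bar l_b`. Replace the first segment by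
`k + 1, …, k + j - i + 1` and the second one by
`\overline{k + j - i + 1}, …, \overline{j + 2}, \overline{j + 1}`.
Here `p = j - i + 1` and `q = k - i + 1` are the lengths of the segments. -/
def Column.move (v : Column) (a b i : ℕ) : Column :=
  let p := runLength (v.u.drop a)
  let q := runLength (v.l.drop b)
  { u := v.u.take a ++ List.range' (i + q) p ++ v.u.drop (a + p)
    l := v.l.take b ++ List.range' (i + p) q ++ v.l.drop (b + q) }

/-- One elementary step of the transformations `τ_i`: take the smallest `i` such that some pair
`(i, \bar i)` of `v` is in `(+1)`-configuration, and move the segments of such a pair. If there are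
two such pairs for this `i`, then the pair whose unbarred letter stands further to the right is
moved first (and the other one in the next step), so that `τ_i` is the composition of two
elementary steps. -/
def TauStep (v w : Column) : Prop :=
  ∃ a b i : ℕ, IsPlusOnePair v a b i ∧
    (∀ a' b' i', IsPlusOnePair v a' b' i' → i < i' ∨ (i = i' ∧ a' ≤ a)) ∧
    w = v.move a b i

/-- `Rect(v) = b`: the element `b` of `B(Λ_n)` is obtained from `v` by applying the
transformations `τ_i`. -/
def IsRect {n : ℕ} (v : Column) (b : AdmissibleColumn n) : Prop :=
  Relation.ReflTransGen TauStep v b.val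

/-- The multiplicity `n(b) = #{v ∈ 𝓑 | Rect(v) = b}`. -/
noncomputable def rectMultiplicity {n : ℕ} (b : AdmissibleColumn n) : ℕ :=
  {v : Column | IsColumn n v ∧ IsRect v b}.ncard

end TypeC
/-!
The letters of a column are recorded in two diagrams inside an `m × k` rectangle, one for the
unbarred and one for the barred letters. A step of the rectification adds the same rectangle to
both, so it does not change which cells lie in exactly one of them, and the number of cells outside
both decreases. The process therefore stops at an admissible column, and this column is determined
by the cells that lie in exactly one of the two diagrams of the initial column.

Give a column the product of the monomials of its letters. A cell added to the first diagram and the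
same cell added to the second one change this monomial by mutually inverse factors; hence the
monomial is invariant under rectification. On `B(Λ_n)` it is the crystal embedding, and so the
right-hand side is the sum of the monomials of all columns other than `[1, …, n]`.

On the group side, a lift of `w_0 s_n` acts by a signed permutation, so the generalized minor is up
to sign the minor of the first `n` columns of `Θ^-` with the rows `\bar 1, …, \overline{n-1}, n`.
Let `A` and `C` be the upper and the lower half of these columns. The factors with `i < n` preserve
the pairing `Aᵀ D C` given by the symplectic form, and those with `i = n` change it by a matrix of
rank one, so that `Aᵀ D C = Tᵀ diag(1 / c_n^{(r)}) T` with `T` unitriangular. This evaluates the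
minor as `∑ c_n^{(r)} E_r ^ 2`, where `E_r` is a sum over the `r`-element subsets of `{1, …, n}`.
Expanding the squares gives one term for each column with `r` barred letters, namely its monomial.
-/

namespace TypeC

/-! ### Rectification as a growth process of two diagrams -/

theorem runLength_cons_spec (x : ℕ) (t : List ℕ) :
    1 ≤ runLength (x :: t) ∧ runLength (x :: t) ≤ (x :: t).length ∧
      (x :: t).take (runLength (x :: t)) = List.range' x (runLength (x :: t)) := by
  induction t generalizing x with
  | nil => simp [runLength]
  | cons y t ih =>
    obtain ⟨hpos, hle, htake⟩ := ih y
    by_cases h : y = x + 1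
    · subst h
      have hrun : runLength (x :: (x + 1) :: t) = runLength ((x + 1) :: t) + 1 := by
        simp [runLength]
      rw [hrun]
      refine ⟨by omega, by simpa using hle, ?_⟩
      rw [List.take_succ_cons, htake, List.range'_succ]
    · simp [runLength, h]

/-- The list `s` with its entries at the positions `a, …, a + p - 1` replaced by
`x, x + 1, …, x + p - 1`: the effect of `Column.move` on one half of a column. -/
def replaceRun (s : List ℕ) (a p x : ℕ) : List ℕ :=
  s.take a ++ List.range' x p ++ s.drop (a + p)

theorem Column.move_eq (v : Column) (a b i : ℕ) :
    v.move a b i =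
      ⟨replaceRun v.u a (runLength (v.u.drop a)) (i + runLength (v.l.drop b)),
        replaceRun v.l b (runLength (v.l.drop b)) (i + runLength (v.u.drop a))⟩ := rfl

theorem runLength_drop_spec {s : List ℕ} {a i : ℕ} (h : s[a]? = some i) :
    1 ≤ runLength (s.drop a) ∧ a + runLength (s.drop a) ≤ s.length ∧
      replaceRun s a (runLength (s.drop a)) i = s := by
  obtain ⟨ha, rfl⟩ := List.getElem?_eq_some_iff.1 h
  have hdrop : s.drop a = s[a] :: s.drop (a + 1) := List.drop_eq_getElem_cons ha
  obtain ⟨hpos, hle, htake⟩ := runLength_cons_spec s[a] (s.drop (a + 1))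
  rw [← hdrop] at hpos hle htake
  rw [List.length_drop] at hle
  refine ⟨hpos, by omega, ?_⟩
  rw [replaceRun, ← htake, ← List.drop_drop, List.append_assoc, List.take_append_drop,
    List.take_append_drop]

theorem length_replaceRun {s : List ℕ} {a p : ℕ} (x : ℕ) (h : a + p ≤ s.length) :
    (replaceRun s a p x).length = s.length := by
  simp only [replaceRun, List.length_append, List.length_take, List.length_range',
    List.length_drop]
  omega

theorem getD_replaceRun_add {s : List ℕ} {a p i : ℕ} (q : ℕ) (h : a + p ≤ s.length)
    (hs : replaceRun s a p i = s) (t : ℕ) :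
    (replaceRun s a p (i + q)).getD t 0 =
      s.getD t 0 + if a ≤ t ∧ t < a + p then q else 0 := by
  conv_rhs => rw [← hs]
  have hl : min a s.length = a := by omega
  simp only [replaceRun, List.getD_eq_getElem?_getD, List.getElem?_append, List.length_append,
    List.length_take, List.length_range', hl]
  rcases lt_or_ge t a with hta | hta
  · have : t < a + p := by omega
    simp [hta, this]
  · rcases lt_or_ge t (a + p) with htp | htp
    · have : t - a < p := by omega
      simp only [List.getElem?_range' this, hta, htp, hta.not_gt, if_true, if_false, and_self,
        Option.getD_some]
      omega
    · simp [htp.not_gt]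

theorem getD_of_replaceRun_eq {s : List ℕ} {a p i : ℕ} (h : a + p ≤ s.length)
    (hs : replaceRun s a p i = s) {t : ℕ} (ht : t < p) : s.getD (a + t) 0 = i + t := by
  have hl : min a s.length = a := by omega
  rw [← hs]
  simp [replaceRun, List.getD_eq_getElem?_getD, List.getElem?_append, hl, ht]

theorem getD_of_getElem? {s : List ℕ} {a i : ℕ} (h : s[a]? = some i) :
    a < s.length ∧ s.getD a 0 = i := by
  obtain ⟨ha, rfl⟩ := List.getElem?_eq_some_iff.1 h
  simp [ha]

theorem getElem?_of_getD {s : List ℕ} {a i : ℕ} (ha : a < s.length) (h : s.getD a 0 = i) :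
    s[a]? = some i := by
  simp [← h, ha]

theorem mem_iff_getD {s : List ℕ} {x : ℕ} : x ∈ s ↔ ∃ a < s.length, s.getD a 0 = x := by
  simp only [List.mem_iff_getElem, List.getD_eq_getElem?_getD]
  exact exists_congr fun a =>
    ⟨fun ⟨ha, h⟩ => ⟨ha, by simpa [ha] using h⟩, fun ⟨ha, h⟩ => ⟨ha, by simpa [ha] using h⟩⟩

theorem getD_lt_getD_of_pairwise {s : List ℕ} (h : s.Pairwise (· < ·)) {a b : ℕ} (hab : a < b)
    (hb : b < s.length) : s.getD a 0 < s.getD b 0 := by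
  have := List.pairwise_iff_getElem.1 h a b (by omega) hb hab
  simpa [hb, show a < s.length by omega] using this

theorem pairwise_of_getD_lt_succ {s : List ℕ}
    (h : ∀ a, a + 1 < s.length → s.getD a 0 < s.getD (a + 1) 0) : s.Pairwise (· < ·) := by
  rw [← List.isChain_iff_pairwise, List.isChain_iff_getElem]
  intro a ha
  simpa [ha, show a < s.length by omega] using h a ha

theorem getD_add_le_getD_of_pairwise {s : List ℕ} (h : s.Pairwise (· < ·)) {a : ℕ} (d : ℕ)
    (hb : a + d < s.length) : s.getD a 0 + d ≤ s.getD (a + d) 0 := by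
  induction d with
  | zero => simp
  | succ d ih =>
    have := ih (by omega)
    have := getD_lt_getD_of_pairwise h (a := a + d) (b := a + (d + 1)) (by omega) hb
    omega

theorem getD_bounds_of_pairwise {s : List ℕ} {n : ℕ} (h : s.Pairwise (· < ·))
    (hs : ∀ x ∈ s, 1 ≤ x ∧ x ≤ n) {a : ℕ} (ha : a < s.length) :
    a + 1 ≤ s.getD a 0 ∧ s.getD a 0 + s.length ≤ a + n + 1 := by
  have hfirst := getD_add_le_getD_of_pairwise h (a := 0) a (by omega)
  have hlast := getD_add_le_getD_of_pairwise h (a := a) (s.length - 1 - a) (by omega)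
  have := hs (s.getD 0 0) (mem_iff_getD.2 ⟨0, by omega, rfl⟩)
  have := hs (s.getD (a + (s.length - 1 - a)) 0) (mem_iff_getD.2 ⟨_, by omega, rfl⟩)
  rw [zero_add] at hfirst
  omega

/-- The column with the roles of unbarred and barred letters exchanged. All notions related to
rectification are symmetric under this exchange. -/
def Column.swap (v : Column) : Column := ⟨v.l, v.u⟩

theorem IsColumn.swap {n : ℕ} {v : Column} (h : IsColumn n v) : IsColumn n v.swap :=
  ⟨h.2.1, h.1, h.2.2.2.1, h.2.2.1, (add_comm _ _).trans h.2.2.2.2⟩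

theorem IsPlusOnePair.swap {v : Column} {a b i : ℕ} (h : IsPlusOnePair v a b i) :
    IsPlusOnePair v.swap b a i :=
  ⟨h.2.1, h.1, (add_comm _ _).trans h.2.2⟩

/-- The cell `(a, b)` lies in the row diagram of `v`, whose row `a` has length `u_a - a` with
positions counted from `1`. -/
def InRow (v : Column) (a b : ℕ) : Prop := a + b + 2 ≤ v.u.getD a 0

/-- The cell `(a, b)` lies in the column diagram of `v`, whose column `b` has length `l_b - b` with
positions counted from `1`. -/
def InCol (v : Column) (a b : ℕ) : Prop := a + b + 2 ≤ v.l.getD b 0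

theorem inRow_swap {v : Column} {a b : ℕ} : InRow v.swap b a ↔ InCol v a b := by
  rw [InRow, InCol, Column.swap, add_comm b a]

theorem inCol_swap {v : Column} {a b : ℕ} : InCol v.swap b a ↔ InRow v a b := by
  rw [InRow, InCol, Column.swap, add_comm b a]

/-- The rectangle of cells that `Column.move v a b` adds to the two diagrams of `v`. -/
def InMoved (v : Column) (a b x y : ℕ) : Prop :=
  (a ≤ x ∧ x < a + runLength (v.u.drop a)) ∧ b ≤ y ∧ y < b + runLength (v.l.drop b)

theorem inMoved_swap {v : Column} {a b x y : ℕ} :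
    InMoved v.swap b a y x ↔ InMoved v a b x y := and_comm

/-- `v` has `m` unbarred and `k` barred letters, with the bounds that are automatic for strictly
increasing letters in `{1, …, m + k}`. Intermediate stages of the rectification need not be strictly
increasing. -/
structure Bounded (m k : ℕ) (v : Column) : Prop where
  length_u : v.u.length = m
  length_l : v.l.length = k
  bounds_u : ∀ a < m, a + 1 ≤ v.u.getD a 0 ∧ v.u.getD a 0 ≤ a + k + 1
  bounds_l : ∀ b < k, b + 1 ≤ v.l.getD b 0 ∧ v.l.getD b 0 ≤ b + m + 1

theorem Bounded.swap {m k : ℕ} {v : Column} (hv : Bounded m k v) : Bounded k m v.swap :=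
  ⟨hv.length_l, hv.length_u, hv.bounds_l, hv.bounds_u⟩

theorem IsColumn.bounded {n : ℕ} {v : Column} (h : IsColumn n v) :
    Bounded v.u.length v.l.length v := by
  obtain ⟨hu, hl, hun, hln, hlen⟩ := h
  refine ⟨rfl, rfl, fun a ha => ?_, fun b hb => ?_⟩
  · have := getD_bounds_of_pairwise hu hun ha
    omega
  · have := getD_bounds_of_pairwise hl hln hb
    omega

namespace IsPlusOnePair

variable {v : Column} {a b i : ℕ} (h : IsPlusOnePair v a b i)
include h

theorem getD_u_of_mem_run {x : ℕ} (hx : a ≤ x ∧ x < a + runLength (v.u.drop a)) :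
    v.u.getD x 0 = x + b + 1 := by
  obtain ⟨-, hlen, hrun⟩ := runLength_drop_spec h.1
  have hi := h.2.2
  have := getD_of_replaceRun_eq hlen hrun (t := x - a) (by omega)
  rw [show a + (x - a) = x by omega] at this
  omega

theorem getD_u_move (x : ℕ) :
    (v.move a b i).u.getD x 0 = v.u.getD x 0 +
      if a ≤ x ∧ x < a + runLength (v.u.drop a) then runLength (v.l.drop b) else 0 := by
  obtain ⟨-, hlen, hrun⟩ := runLength_drop_spec h.1
  exact getD_replaceRun_add _ hlen hrun x

theorem length_u_move : (v.move a b i).u.length = v.u.length :=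
  length_replaceRun _ (runLength_drop_spec h.1).2.1

theorem inMoved_self : InMoved v a b a b := by
  have hu := (runLength_drop_spec h.1).1
  have hl := (runLength_drop_spec h.2.1).1
  exact ⟨by omega, by omega⟩

theorem not_inRow_of_inMoved {x y : ℕ} (hxy : InMoved v a b x y) : ¬ InRow v x y := by
  have hy := hxy.2
  rw [InRow, h.getD_u_of_mem_run hxy.1]
  omega

theorem not_inCol_of_inMoved {x y : ℕ} (hxy : InMoved v a b x y) : ¬ InCol v x y := by
  rw [← inRow_swap]
  exact h.swap.not_inRow_of_inMoved (inMoved_swap.2 hxy)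

theorem inRow_move_iff (x y : ℕ) :
    InRow (v.move a b i) x y ↔ InRow v x y ∨ InMoved v a b x y := by
  simp only [InRow, InMoved, h.getD_u_move]
  split_ifs with hx
  · rw [h.getD_u_of_mem_run hx]
    omega
  · omega

theorem inCol_move_iff (x y : ℕ) :
    InCol (v.move a b i) x y ↔ InCol v x y ∨ InMoved v a b x y := by
  rw [← inRow_swap, ← inRow_swap, ← inMoved_swap]
  exact h.swap.inRow_move_iff y x

theorem bounds_u_move {m k : ℕ} (hv : Bounded m k v) {x : ℕ} (hx : x < m) :
    x + 1 ≤ (v.move a b i).u.getD x 0 ∧ (v.move a b i).u.getD x 0 ≤ x + k + 1 := by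
  have hl := (runLength_drop_spec h.2.1).2.1
  rw [hv.length_l] at hl
  have := hv.bounds_u x hx
  rw [h.getD_u_move]
  split_ifs with hrun
  · rw [h.getD_u_of_mem_run hrun]
    omega
  · omega

theorem bounded_move {m k : ℕ} (hv : Bounded m k v) : Bounded m k (v.move a b i) where
  length_u := h.length_u_move.trans hv.length_u
  length_l := h.swap.length_u_move.trans hv.length_l
  bounds_u _ := h.bounds_u_move hv
  bounds_l _ := h.swap.bounds_u_move hv.swap

end IsPlusOnePair

/-- The invariant of the rectification process that starts at `w`: the cells which lie in exactly
one of the two diagrams do not change. -/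
structure MoveInvariant (m k : ℕ) (w v : Column) : Prop extends Bounded m k v where
  row_iff : ∀ a < m, ∀ b < k, (InCol v a b → InRow v a b) ↔ (InCol w a b → InRow w a b)
  col_iff : ∀ a < m, ∀ b < k, (InRow v a b → InCol v a b) ↔ (InRow w a b → InCol w a b)

theorem MoveInvariant.swap {m k : ℕ} {w v : Column} (hv : MoveInvariant m k w v) :
    MoveInvariant k m w.swap v.swap where
  toBounded := hv.toBounded.swap
  row_iff b hb a ha := by simpa only [inRow_swap, inCol_swap] using hv.col_iff a ha b hb
  col_iff b hb a ha := by simpa only [inRow_swap, inCol_swap] using hv.row_iff a ha b hb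

theorem IsColumn.moveInvariant_self {n : ℕ} {v : Column} (h : IsColumn n v) :
    MoveInvariant v.u.length v.l.length v v :=
  ⟨h.bounded, fun _ _ _ _ => Iff.rfl, fun _ _ _ _ => Iff.rfl⟩

theorem MoveInvariant.move {m k : ℕ} {w v : Column} (hv : MoveInvariant m k w v) {a b i : ℕ}
    (h : IsPlusOnePair v a b i) : MoveInvariant m k w (v.move a b i) where
  toBounded := h.bounded_move hv.toBounded
  row_iff x hx y hy := by
    rw [h.inRow_move_iff, h.inCol_move_iff, ← hv.row_iff x hx y hy]
    have := h.not_inCol_of_inMoved (x := x) (y := y)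
    tauto
  col_iff x hx y hy := by
    rw [h.inRow_move_iff, h.inCol_move_iff, ← hv.col_iff x hx y hy]
    have := h.not_inRow_of_inMoved (x := x) (y := y)
    tauto

open Classical in
/-- The cells of the `m × k` rectangle outside both diagrams; their number decreases with every
move. -/
noncomputable def freeCells (m k : ℕ) (v : Column) : Finset (ℕ × ℕ) :=
  (Finset.range m ×ˢ Finset.range k).filter fun c => ¬ InRow v c.1 c.2 ∧ ¬ InCol v c.1 c.2

theorem mem_freeCells {m k : ℕ} {v : Column} {a b : ℕ} :
    (a, b) ∈ freeCells m k v ↔ (a < m ∧ b < k) ∧ ¬ InRow v a b ∧ ¬ InCol v a b := by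
  simp only [freeCells, Finset.mem_filter, Finset.mem_product, Finset.mem_range]

theorem mem_freeCells_swap {m k : ℕ} {v : Column} {a b : ℕ} :
    (b, a) ∈ freeCells k m v.swap ↔ (a, b) ∈ freeCells m k v := by
  rw [mem_freeCells, mem_freeCells, inRow_swap, inCol_swap]
  tauto

theorem IsPlusOnePair.card_freeCells_move_lt {m k : ℕ} {v : Column} (hv : Bounded m k v)
    {a b i : ℕ} (h : IsPlusOnePair v a b i) :
    (freeCells m k (v.move a b i)).card < (freeCells m k v).card := by
  have hself := h.inMoved_self
  have ha := hv.length_u ▸ (getD_of_getElem? h.1).1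
  have hb := hv.length_l ▸ (getD_of_getElem? h.2.1).1
  refine Finset.card_lt_card ((Finset.ssubset_iff_of_subset ?_).2 ⟨(a, b), ?_, ?_⟩)
  · rintro ⟨x, y⟩
    rw [mem_freeCells, mem_freeCells, h.inRow_move_iff, h.inCol_move_iff]
    tauto
  · exact mem_freeCells.2 ⟨⟨ha, hb⟩, h.not_inRow_of_inMoved hself, h.not_inCol_of_inMoved hself⟩
  · rw [mem_freeCells, h.inRow_move_iff]
    tauto

theorem IsColumn.inRow_of_inCol_of_le {n : ℕ} {w : Column} (hw : IsColumn n w) {a a' b b' : ℕ}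
    (ha : a ≤ a') (ha' : a' < w.u.length) (hb : b ≤ b') (hb' : b' < w.l.length)
    (h : InCol w a b' → InRow w a b') : InCol w a' b → InRow w a' b := by
  have hu := getD_add_le_getD_of_pairwise hw.1 (a := a) (a' - a) (by omega)
  have hl := getD_add_le_getD_of_pairwise hw.2.1 (a := b) (b' - b) (by omega)
  rw [Nat.add_sub_cancel' ha] at hu
  rw [Nat.add_sub_cancel' hb] at hl
  simp only [InRow, InCol] at h ⊢
  omega

namespace MoveInvariant

variable {n : ℕ} {w v : Column} (hw : IsColumn n w)
  (hv : MoveInvariant w.u.length w.l.length w v)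
include hw hv

theorem inRow_of_inCol_of_le {a a' b b' : ℕ} (ha : a ≤ a') (ha' : a' < w.u.length)
    (hb : b ≤ b') (hb' : b' < w.l.length) (h : InCol v a b' → InRow v a b') :
    InCol v a' b → InRow v a' b := by
  rw [hv.row_iff a' ha' b (hb.trans_lt hb')]
  rw [hv.row_iff a (ha.trans_lt ha') b' hb'] at h
  exact hw.inRow_of_inCol_of_le ha ha' hb hb' h

theorem getD_u_of_minimal_freeCell {a b : ℕ}
    (hfree : (a, b) ∈ freeCells w.u.length w.l.length v)
    (hmin : ∀ b' < b, (a, b') ∉ freeCells w.u.length w.l.length v) :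
    v.u.getD a 0 = a + b + 1 := by
  obtain ⟨⟨ha, hb⟩, hrow, hcol⟩ := mem_freeCells.1 hfree
  rcases Nat.eq_zero_or_pos b with rfl | hpos
  · have := hv.bounds_u a ha
    simp only [InRow] at hrow
    omega
  · have himp := hv.inRow_of_inCol_of_le hw le_rfl ha (Nat.sub_le b 1) hb fun h => (hcol h).elim
    have hleft : InRow v a (b - 1) := by
      by_contra hrow'
      exact hmin (b - 1) (by omega)
        (mem_freeCells.2 ⟨⟨ha, by omega⟩, hrow', fun h => hrow' (himp h)⟩)
    simp only [InRow] at hrow hleft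
    omega

theorem getD_l_of_minimal_freeCell {a b : ℕ}
    (hfree : (a, b) ∈ freeCells w.u.length w.l.length v)
    (hmin : ∀ a' < a, (a', b) ∉ freeCells w.u.length w.l.length v) :
    v.l.getD b 0 = a + b + 1 := by
  rw [add_comm a b]
  exact getD_u_of_minimal_freeCell hw.swap hv.swap (mem_freeCells_swap.2 hfree)
    fun a' ha' h => hmin a' ha' (mem_freeCells_swap.1 h)

/-- A free cell closest to the corner of the rectangle is a pair in `(+1)`-configuration. -/
theorem exists_isPlusOnePair (hne : (freeCells w.u.length w.l.length v).Nonempty) :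
    ∃ a b i, IsPlusOnePair v a b i := by
  obtain ⟨⟨a, b⟩, hfree, hmin⟩ := Finset.exists_min_image _ (fun c : ℕ × ℕ => c.1 + c.2) hne
  obtain ⟨ha, hb⟩ := (mem_freeCells.1 hfree).1
  refine ⟨a, b, a + b + 1, getElem?_of_getD (hv.length_u.symm ▸ ha) ?_,
    getElem?_of_getD (hv.length_l.symm ▸ hb) ?_, by omega⟩
  · refine hv.getD_u_of_minimal_freeCell hw hfree fun b' hb' h => ?_
    have := hmin _ h
    simp only at this
    omega
  · refine hv.getD_l_of_minimal_freeCell hw hfree fun a' ha' h => ?_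
    have := hmin _ h
    simp only at this
    omega

theorem pairwise_u_of_freeCells_eq_empty (hempty : freeCells w.u.length w.l.length v = ∅) :
    v.u.Pairwise (· < ·) := by
  refine pairwise_of_getD_lt_succ fun a ha => ?_
  rw [hv.length_u] at ha
  have hlen := hw.2.2.2.2
  have hsucc := hv.bounds_u (a + 1) ha
  have hself := hv.bounds_u a (by omega)
  rcases Nat.lt_or_ge (v.u.getD a 0) (a + 2) with h | h
  · omega
  · obtain ⟨d, hd⟩ := Nat.exists_eq_add_of_le h
    have hrow : InRow v a d := by
      simp only [InRow]
      omega
    have himp := hv.inRow_of_inCol_of_le hw a.le_succ ha le_rfl (b := d) (by omega) fun _ => hrow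
    have hbelow : InRow v (a + 1) d := by
      by_contra hrow'
      have : (a + 1, d) ∈ freeCells w.u.length w.l.length v :=
        mem_freeCells.2 ⟨⟨ha, by omega⟩, hrow', fun h => hrow' (himp h)⟩
      simp [hempty] at this
    simp only [InRow] at hbelow
    omega

theorem mem_u_bounds {x : ℕ} (hx : x ∈ v.u) : 1 ≤ x ∧ x ≤ n := by
  obtain ⟨a, ha, rfl⟩ := mem_iff_getD.1 hx
  have hlen := hw.2.2.2.2
  rw [hv.length_u] at ha
  have := hv.bounds_u a ha
  omega

theorem isAdmissible (hempty : freeCells w.u.length w.l.length v = ∅) : IsAdmissible n v := by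
  have hswap : freeCells w.l.length w.u.length v.swap = ∅ :=
    Finset.eq_empty_of_forall_notMem fun ⟨b, a⟩ h => by
      simpa [hempty] using mem_freeCells_swap.1 h
  refine ⟨⟨hv.pairwise_u_of_freeCells_eq_empty hw hempty,
    pairwise_u_of_freeCells_eq_empty hw.swap hv.swap hswap, fun _ => hv.mem_u_bounds hw,
    fun _ => mem_u_bounds hw.swap hv.swap, by rw [hv.length_u, hv.length_l, hw.2.2.2.2]⟩, ?_⟩
  intro a b i hu hl
  obtain ⟨ha, hui⟩ := getD_of_getElem? hu
  obtain ⟨hb, hli⟩ := getD_of_getElem? hl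
  rw [hv.length_u] at ha
  rw [hv.length_l] at hb
  by_contra hi
  have : (a, b) ∈ freeCells w.u.length w.l.length v := by
    simp only [mem_freeCells, InRow, InCol]
    omega
  simp [hempty] at this

end MoveInvariant

theorem TauStep.unique {v w w' : Column} (h : TauStep v w) (h' : TauStep v w') : w = w' := by
  obtain ⟨a, b, i, hpair, hfirst, rfl⟩ := h
  obtain ⟨a', b', i', hpair', hfirst', rfl⟩ := h'
  have hle := hfirst a' b' i' hpair'
  have hge := hfirst' a b i hpair
  have hi := hpair.2.2
  have hi' := hpair'.2.2
  obtain rfl : i = i' := by omega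
  obtain rfl : a = a' := by omega
  obtain rfl : b = b' := by omega
  rfl

theorem exists_tauStep {v : Column} (h : ∃ a b i, IsPlusOnePair v a b i) :
    ∃ a b i, IsPlusOnePair v a b i ∧ TauStep v (v.move a b i) := by
  classical
  have hex : ∃ i a b, IsPlusOnePair v a b i := by
    obtain ⟨a, b, i, h⟩ := h
    exact ⟨i, a, b, h⟩
  set i := Nat.find hex
  obtain ⟨a, b, hab⟩ := Nat.find_spec hex
  have hle : ∀ a, (∃ b, IsPlusOnePair v a b i) → a ≤ i := by
    rintro a ⟨b, -, -, h⟩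
    omega
  set a₀ := Nat.findGreatest (fun a => ∃ b, IsPlusOnePair v a b i) i
  obtain ⟨b₀, hb₀⟩ : ∃ b, IsPlusOnePair v a₀ b i :=
    Nat.findGreatest_spec (P := fun a => ∃ b, IsPlusOnePair v a b i) (hle a ⟨b, hab⟩) ⟨b, hab⟩
  refine ⟨a₀, b₀, i, hb₀, a₀, b₀, i, hb₀, fun a' b' i' hp => ?_, rfl⟩
  rcases lt_or_eq_of_le (Nat.find_min' hex ⟨a', b', hp⟩) with hlt | heq
  · exact Or.inl hlt
  · rw [← heq] at hp
    exact Or.inr ⟨heq, Nat.le_findGreatest (hle a' ⟨b', hp⟩) ⟨b', hp⟩⟩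

theorem IsAdmissible.not_tauStep {n : ℕ} {v w : Column} (hv : IsAdmissible n v) :
    ¬ TauStep v w := by
  rintro ⟨a, b, i, ⟨hu, hl, hi⟩, -⟩
  have := hv.2 a b i hu hl
  omega

theorem MoveInvariant.exists_isRect {n : ℕ} {w v : Column} (hw : IsColumn n w)
    (hv : MoveInvariant w.u.length w.l.length w v) : ∃ b : AdmissibleColumn n, IsRect v b := by
  induction hN : (freeCells w.u.length w.l.length v).card using Nat.strong_induction_on
    generalizing v with
  | _ N ih =>
    rcases Finset.eq_empty_or_nonempty (freeCells w.u.length w.l.length v) with hempty | hne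
    · exact ⟨⟨v, hv.isAdmissible hw hempty⟩, Relation.ReflTransGen.refl⟩
    · obtain ⟨a, b, i, hpair, hstep⟩ := exists_tauStep (hv.exists_isPlusOnePair hw hne)
      have hlt := hpair.card_freeCells_move_lt hv.toBounded
      obtain ⟨b, hb⟩ := ih _ (hN ▸ hlt) (hv.move hpair) rfl
      exact ⟨b, Relation.ReflTransGen.head hstep hb⟩

theorem IsRect.unique {n : ℕ} {v : Column} {b b' : AdmissibleColumn n} (h : IsRect v b)
    (h' : IsRect v b') : b = b' := by
  unfold IsRect at h
  induction h using Relation.ReflTransGen.head_induction_on with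
  | refl =>
    rcases Relation.ReflTransGen.cases_head h' with heq | ⟨_, hstep, -⟩
    · exact Subtype.ext heq
    · exact (b.2.not_tauStep hstep).elim
  | head hstep _ ih =>
    rcases Relation.ReflTransGen.cases_head h' with rfl | ⟨_, hstep', hrest⟩
    · exact (b'.2.not_tauStep hstep).elim
    · rw [← hstep.unique hstep'] at hrest
      exact ih hrest

theorem IsColumn.existsUnique_isRect {n : ℕ} {v : Column} (hv : IsColumn n v) :
    ∃! b : AdmissibleColumn n, IsRect v b := by
  obtain ⟨b, hb⟩ := hv.moveInvariant_self.exists_isRect hv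
  exact ⟨b, hb, fun b' hb' => hb'.unique hb⟩

theorem IsColumn.moveInvariant {n : ℕ} {v w : Column} (hv : IsColumn n v)
    (h : Relation.ReflTransGen TauStep v w) : MoveInvariant v.u.length v.l.length v w := by
  induction h with
  | refl => exact hv.moveInvariant_self
  | tail _ hstep ih =>
    obtain ⟨_, _, _, hpair, -, rfl⟩ := hstep
    exact ih.move hpair

/-! ### The monomial of a column -/

/-- The variable `Y_{m,x}`, indexed by `1 ≤ x ≤ n`; for all other `x` it is the monomial `1`. -/
noncomputable def varY (n : ℕ) (m : ℤ) (x : ℕ) : LaurentMonomial n :=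
  if h : 1 ≤ x ∧ x ≤ n then monoVar n m ⟨x - 1, by omega⟩ else 0

/-- The monomial `Y_{n-a,x} Y_{n-a+1,x-1}⁻¹` of the unbarred letter `x` at position `a` of a column,
with positions counted from `1`. -/
noncomputable def boxPos (n : ℕ) (a : ℤ) (x : ℕ) : LaurentMonomial n :=
  varY n (n - a) x - varY n (n + 1 - a) (x - 1)

/-- The monomial `Y_{n-x+b,x-1} Y_{n-x+b,x}⁻¹` of the barred letter `\bar x` at position `b` of a
column, with positions counted from `1` and from the end. -/
noncomputable def boxNeg (n : ℕ) (b : ℤ) (x : ℕ) : LaurentMonomial n :=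
  varY n (n - x + b) (x - 1) - varY n (n - x + b) x

/-- The sum of `f a x` over the entries `x` of a list with positions `a` counted from `a₀`. -/
def posSum {M : Type*} [AddCommMonoid M] (f : ℤ → ℕ → M) (a₀ : ℤ) : List ℕ → M
  | [] => 0
  | x :: s => f a₀ x + posSum f (a₀ + 1) s

theorem posSum_append {M : Type*} [AddCommMonoid M] (f : ℤ → ℕ → M) (a₀ : ℤ) (s t : List ℕ) :
    posSum f a₀ (s ++ t) = posSum f a₀ s + posSum f (a₀ + s.length) t := by
  induction s generalizing a₀ with
  | nil => simp [posSum]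
  | cons x s ih =>
    simp only [List.cons_append, posSum, ih, List.length_cons]
    rw [← add_assoc, Nat.cast_succ, add_assoc a₀, add_comm (1 : ℤ)]

theorem posSum_range' {M : Type*} [AddCommMonoid M] (f : ℤ → ℕ → M) (a₀ : ℤ) (x p : ℕ) :
    posSum f a₀ (List.range' x p) = ∑ t ∈ Finset.range p, f (a₀ + t) (x + t) := by
  induction p generalizing a₀ x with
  | zero => simp [posSum]
  | succ p ih =>
    rw [List.range'_succ, posSum, ih, Finset.sum_range_succ', add_comm]
    congr 1
    · refine Finset.sum_congr rfl fun t _ => ?_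
      congr 1
      · push_cast
        ring
      · ring
    · simp

theorem posSum_replaceRun_add {M : Type*} [AddCommGroup M] (f : ℤ → ℕ → M) (a₀ : ℤ) {s : List ℕ}
    {a p i : ℕ} (q : ℕ) (h : a + p ≤ s.length) (hs : replaceRun s a p i = s) :
    posSum f a₀ (replaceRun s a p (i + q)) = posSum f a₀ s +
      ∑ t ∈ Finset.range p, (f (a₀ + a + t) (i + t + q) - f (a₀ + a + t) (i + t)) := by
  conv_rhs => rw [← hs]
  have hl : min a s.length = a := by omega
  simp only [replaceRun, posSum_append, posSum_range', List.length_append, List.length_take,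
    List.length_range', hl, Finset.sum_sub_distrib]
  have : ∀ t, i + q + t = i + t + q := fun t => by ring
  simp only [this]
  abel

/-- The monomial `Y_{m,x} Y_{m+1,x} Y_{m+1,x-1}⁻¹ Y_{m,x+1}⁻¹`. It is `A_{m,x}` for `x < n`, see
`monoA_eq_varA`, and the quotient of the monomials of two consecutive letters. -/
noncomputable def varA (n : ℕ) (m : ℤ) (x : ℕ) : LaurentMonomial n :=
  varY n m x + varY n (m + 1) x - varY n (m + 1) (x - 1) - varY n m (x + 1)

theorem boxPos_succ (n : ℕ) (a : ℤ) (x : ℕ) :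
    boxPos n a (x + 1) = boxPos n a x - varA n (n - a) x := by
  simp only [boxPos, varA, Nat.add_sub_cancel]
  rw [show (n : ℤ) - a + 1 = n + 1 - a by ring]
  abel

theorem boxNeg_succ (n : ℕ) (b : ℤ) (x : ℕ) :
    boxNeg n b (x + 1) = boxNeg n b x + varA n (n - x + b - 1) x := by
  simp only [boxNeg, varA, Nat.add_sub_cancel, Nat.cast_add, Nat.cast_one]
  rw [show (n : ℤ) - x + b - 1 + 1 = n - x + b by ring,
    show (n : ℤ) - (x + 1) + b = n - x + b - 1 by ring]
  abel

theorem boxPos_add_sub (n : ℕ) (a : ℤ) (x q : ℕ) :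
    boxPos n a (x + q) - boxPos n a x = - ∑ s ∈ Finset.range q, varA n (n - a) (x + s) := by
  induction q with
  | zero => simp
  | succ q ih =>
    rw [← add_assoc, boxPos_succ, Finset.sum_range_succ, neg_add, ← ih]
    abel

theorem boxNeg_add_sub (n : ℕ) (b : ℤ) (x q : ℕ) :
    boxNeg n b (x + q) - boxNeg n b x =
      ∑ s ∈ Finset.range q, varA n (n - (x + s) + b - 1) (x + s) := by
  induction q with
  | zero => simp
  | succ q ih =>
    rw [← add_assoc, boxNeg_succ, Finset.sum_range_succ, ← ih]
    push_cast
    abel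

/-- The monomial of a column, the product of the monomials of its letters. On `B(Λ_n)` this is the
embedding `m_n^{(0)}`, see `isCrystalEmbedding_colMono`. -/
noncomputable def colMono (n : ℕ) (v : Column) : LaurentMonomial n :=
  posSum (boxPos n) 1 v.u + posSum (boxNeg n) 1 v.l

/-- Raising the `p` unbarred letters of the rectangle by `q` and the `q` barred letters by `p`
multiplies the monomial by inverse factors `A_{m,x}^{∓1}`, matched cell by cell. -/
theorem colMono_move (n : ℕ) {v : Column} {a b i : ℕ} (h : IsPlusOnePair v a b i) :
    colMono n (v.move a b i) = colMono n v := by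
  obtain ⟨hu, hl, hi⟩ := h
  obtain ⟨-, hpu, hru⟩ := runLength_drop_spec hu
  obtain ⟨-, hpl, hrl⟩ := runLength_drop_spec hl
  rw [Column.move_eq, colMono, colMono, posSum_replaceRun_add _ _ _ hpu hru,
    posSum_replaceRun_add _ _ _ hpl hrl]
  simp only [boxPos_add_sub, boxNeg_add_sub, Finset.sum_neg_distrib]
  rw [Finset.sum_comm (s := Finset.range (runLength (v.l.drop b)))]
  have hcell : ∀ t s : ℕ, varA n (n - ((i + s : ℕ) + t) + (1 + b + s) - 1) (i + s + t) =
      varA n (n - (1 + a + t)) (i + t + s) := by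
    intro t s
    rw [show (i : ℕ) + s + t = i + t + s by ring]
    congr 1
    zify at hi
    push_cast
    linarith
  simp only [hcell]
  abel

theorem IsRect.colMono_eq {n : ℕ} {v : Column} {b : AdmissibleColumn n} (h : IsRect v b) :
    colMono n b.val = colMono n v := by
  unfold IsRect at h
  induction h using Relation.ReflTransGen.head_induction_on with
  | refl => rfl
  | head hstep _ ih =>
    obtain ⟨_, _, _, hpair, -, rfl⟩ := hstep
    rw [ih, colMono_move n hpair]

theorem IsColumn.u_eq_of_l_eq_nil {n : ℕ} {v : Column} (hv : IsColumn n v) (h : v.l = []) :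
    v.u = List.range' 1 n := by
  obtain ⟨hu, -, hun, -, hlen⟩ := hv
  rw [h, List.length_nil, add_zero] at hlen
  refine List.ext_getElem (by simp [hlen]) fun a ha _ => ?_
  have := getD_bounds_of_pairwise hu hun ha
  rw [List.getD_eq_getElem _ _ ha] at this
  rw [List.getElem_range']
  omega

theorem eq_highestColumn_iff {n : ℕ} (b : AdmissibleColumn n) :
    b = highestColumn n ↔ b.val.l = [] :=
  ⟨fun h => h ▸ rfl, fun h => Subtype.ext (Column.ext (b.2.1.u_eq_of_l_eq_nil h) h)⟩

theorem IsRect.eq_highestColumn_iff {n : ℕ} {v : Column} (hv : IsColumn n v)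
    {b : AdmissibleColumn n} (h : IsRect v b) : b = highestColumn n ↔ v.l = [] := by
  rw [TypeC.eq_highestColumn_iff, ← List.length_eq_zero_iff, (hv.moveInvariant h).length_l,
    List.length_eq_zero_iff]

/-- The set `𝓑` of columns of length `n` as a finset. -/
noncomputable def columns (n : ℕ) : Finset Column := (finite_isColumn n).toFinset

theorem mem_columns {n : ℕ} {v : Column} : v ∈ columns n ↔ IsColumn n v := by
  simp only [columns, Set.Finite.mem_toFinset, Set.mem_ofPred_eq]

open Classical in
theorem rectMultiplicity_eq_card {n : ℕ} (b : AdmissibleColumn n) :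
    rectMultiplicity b = {v ∈ columns n | IsRect v b}.card := by
  rw [rectMultiplicity, ← Set.ncard_coe_finset]
  simp only [Finset.coe_filter, mem_columns]

open Classical in
theorem IsColumn.card_filter_isRect {n : ℕ} {v : Column} (hv : IsColumn n v) :
    {b : AdmissibleColumn n | IsRect v b}.toFinset.card = 1 := by
  obtain ⟨b, hb, huniq⟩ := hv.existsUnique_isRect
  exact Finset.card_eq_one.2 ⟨b, by ext b'; simpa using ⟨huniq b', fun h => h ▸ hb⟩⟩

theorem sum_rectMultiplicity_mul (n : ℕ) {R : Type*} [NonAssocSemiring R]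
    (F : LaurentMonomial n → R) :
    ∑ b ∈ Finset.univ.erase (highestColumn n), (rectMultiplicity b : R) * F (colMono n b.val) =
      ∑ v ∈ columns n with v.l ≠ [], F (colMono n v) := by
  classical
  calc ∑ b ∈ Finset.univ.erase (highestColumn n), (rectMultiplicity b : R) * F (colMono n b.val)
      = ∑ b ∈ Finset.univ.erase (highestColumn n), ∑ v ∈ columns n with IsRect v b,
          F (colMono n v) := by
        refine Finset.sum_congr rfl fun b _ => ?_
        rw [rectMultiplicity_eq_card, ← nsmul_eq_mul, ← Finset.sum_const]
        exact Finset.sum_congr rfl fun v hv => by rw [(Finset.mem_filter.1 hv).2.colMono_eq]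
    _ = ∑ v ∈ columns n with v.l ≠ [], ∑ _b ∈ {b : AdmissibleColumn n | IsRect v b}.toFinset,
          F (colMono n v) := by
        refine Finset.sum_comm' fun b v => ?_
        simp only [Finset.mem_erase, Finset.mem_univ, and_true, Finset.mem_filter, mem_columns,
          Set.mem_toFinset, Set.mem_ofPred_eq]
        constructor
        · exact fun ⟨hb, hv, h⟩ => ⟨h, hv, fun hl => hb ((h.eq_highestColumn_iff hv).2 hl)⟩
        · exact fun ⟨h, hv, hl⟩ => ⟨fun hb => hl ((h.eq_highestColumn_iff hv).1 hb), hv, h⟩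
    _ = ∑ v ∈ columns n with v.l ≠ [], F (colMono n v) := by
        refine Finset.sum_congr rfl fun v hv => ?_
        rw [Finset.sum_const, (mem_columns.1 (Finset.mem_filter.1 hv).1).card_filter_isRect,
          one_nsmul]

/-! ### Tensor products of words -/

section Word

variable {n r : ℕ}

theorem wordE_eq_none {w : List Letter} (h : wordEps n r w = 0) : wordE n r w = none := by
  cases w with
  | nil => rfl
  | cons x w =>
    simp only [wordEps, Nat.add_eq_zero_iff, letterEps, ite_eq_right_iff, one_ne_zero,
      imp_false, Bool.not_eq_true, Option.isSome_eq_false_iff, Option.isNone_iff_eq_none] at h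
    rw [wordE, if_pos (Nat.sub_eq_zero_iff_le.1 h.2), h.1, Option.map_none]

theorem wordF_eq_none {w : List Letter} (h : wordPhi n r w = 0) : wordF n r w = none := by
  induction w with
  | nil => rfl
  | cons x w ih =>
    rw [wordPhi, Nat.add_eq_zero_iff] at h
    rw [wordF, if_neg (Nat.not_lt.2 (Nat.sub_eq_zero_iff_le.1 h.2)), ih h.1, Option.map_none]

variable (n r)

theorem wordWt_append (w w' : List Letter) : wordWt r (w ++ w') = wordWt r w + wordWt r w' := by
  simp [wordWt]

theorem wordEps_append (w w' : List Letter) :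
    wordEps n r (w ++ w') = wordEps n r w + (wordEps n r w' - wordPhi n r w) := by
  induction w with
  | nil => simp [wordEps, wordPhi]
  | cons x w ih =>
    simp only [List.cons_append, wordEps, wordPhi, ih]
    omega

theorem wordPhi_append (w w' : List Letter) :
    wordPhi n r (w ++ w') = wordPhi n r w' + (wordPhi n r w - wordEps n r w') := by
  induction w with
  | nil => simp [wordPhi]
  | cons x w ih =>
    simp only [List.cons_append, wordPhi, ih, wordEps_append]
    omega

theorem wordF_append (w w' : List Letter) :
    wordF n r (w ++ w') = if wordEps n r w' < wordPhi n r w then (wordF n r w).map (· ++ w')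
      else (wordF n r w').map (w ++ ·) := by
  induction w with
  | nil => simp [wordPhi]
  | cons x w ih =>
    simp only [List.cons_append, wordF, wordPhi, ih, wordEps_append, apply_ite (Option.map _),
      Option.map_map, Function.comp_def]
    split_ifs <;> first | omega | rfl

theorem wordE_append (w w' : List Letter) :
    wordE n r (w ++ w') = if wordEps n r w' ≤ wordPhi n r w then (wordE n r w).map (· ++ w')
      else (wordE n r w').map (w ++ ·) := by
  induction w with
  | nil =>
    rcases Nat.eq_zero_or_pos (wordEps n r w') with h | h
    · simp [wordE, wordPhi, h, wordE_eq_none h]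
    · simp [wordPhi, h.ne']
  | cons x w ih =>
    simp only [List.cons_append, wordE, wordPhi, ih, wordEps_append, apply_ite (Option.map _),
      Option.map_map, Function.comp_def]
    split_ifs <;> first | omega | rfl

end Word

/-- `N` acts as a unit for the tensor product with respect to the color `r`. -/
structure Neutral (n r : ℕ) (N : List Letter) : Prop where
  eps : wordEps n r N = 0
  phi : wordPhi n r N = 0
  wt : wordWt r N = 0

theorem Neutral.append {n r : ℕ} {N N' : List Letter} (h : Neutral n r N)
    (h' : Neutral n r N') : Neutral n r (N ++ N') where
  eps := by rw [wordEps_append, h.eps, h'.eps, Nat.zero_sub]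
  phi := by rw [wordPhi_append, h.phi, h'.phi, Nat.zero_sub]
  wt := by rw [wordWt_append, h.wt, h'.wt, add_zero]

theorem Neutral.of_forall {n r : ℕ} {N : List Letter} (h : ∀ x ∈ N, Neutral n r [x]) :
    Neutral n r N := by
  induction N with
  | nil => exact ⟨rfl, rfl, rfl⟩
  | cons x N ih =>
    exact (h x List.mem_cons_self).append (ih fun y hy => h y (List.mem_cons_of_mem x hy))

/-- The tensor product `A ⊗ X ⊗ B ⊗ X' ⊗ C`. -/
def pairWord (A X B X' C : List Letter) : List Letter := A ++ (X ++ (B ++ (X' ++ C)))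

section PairWord

variable {n r : ℕ} {A B C : List Letter} (hA : Neutral n r A) (hB : Neutral n r B)
  (hC : Neutral n r C) (X X' : List Letter)

include hA hB hC

theorem wordEps_pairWord : wordEps n r (pairWord A X B X' C) =
    wordEps n r X + (wordEps n r X' - wordPhi n r X) := by
  simp only [pairWord, wordEps_append, hA.eps, hA.phi, hB.eps, hB.phi, hC.eps]
  omega

theorem wordPhi_pairWord : wordPhi n r (pairWord A X B X' C) =
    wordPhi n r X' + (wordPhi n r X - wordEps n r X') := by
  simp only [pairWord, wordPhi_append, wordEps_append, hA.phi, hB.eps, hB.phi, hC.eps, hC.phi]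
  omega

theorem wordWt_pairWord :
    wordWt r (pairWord A X B X' C) = wordWt r X + wordWt r X' := by
  simp only [pairWord, wordWt_append, hA.wt, hB.wt, hC.wt, zero_add, add_zero]

theorem wordF_pairWord : wordF n r (pairWord A X B X' C) =
    if wordEps n r X' < wordPhi n r X then (wordF n r X).map (pairWord A · B X' C)
      else (wordF n r X').map (pairWord A X B · C) := by
  simp only [pairWord, wordF_append, wordEps_append, hA.phi, hB.eps, hB.phi, hC.eps,
    wordF_eq_none hC.phi]
  split_ifs <;> first | omega | simp_all [Function.comp_def, wordF_eq_none]

theorem wordE_pairWord : wordE n r (pairWord A X B X' C) =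
    if wordEps n r X' ≤ wordPhi n r X then (wordE n r X).map (pairWord A · B X' C)
      else (wordE n r X').map (pairWord A X B · C) := by
  simp only [pairWord, wordE_append, wordEps_append, hA.phi, hB.eps, hB.phi, hC.eps,
    wordE_eq_none hA.eps, wordE_eq_none hB.eps]
  split_ifs <;> first | omega | simp_all [Function.comp_def, wordE_eq_none]

end PairWord

/-- The three shapes of the letters `r`, `r + 1` of an increasing sequence with respect to the
color `r`: without effect, `f̃_r` acts, or `ẽ_r` acts. -/
inductive Kind where
  | zero
  | plus
  | minus
deriving DecidableEq

namespace Kind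

/-- The weight of a kind. -/
def wt : Kind → ℤ
  | zero => 0
  | plus => 1
  | minus => -1

/-- The value of `φ` on a kind. -/
def phi : Kind → ℕ
  | plus => 1
  | _ => 0

/-- The value of `ε` on a kind. -/
def eps : Kind → ℕ
  | minus => 1
  | _ => 0

/-- The kind with opposite weight. -/
def dual : Kind → Kind
  | zero => zero
  | plus => minus
  | minus => plus

/-- The value of `φ` on a tensor product of two words of given kinds. -/
def pairPhi (k k' : Kind) : ℕ := k'.phi + (k.phi - k'.eps)

/-- The value of `ε` on a tensor product of two words of given kinds. -/
def pairEps (k k' : Kind) : ℕ := k.eps + (k'.eps - k.phi)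

end Kind

/-- The word `X` belongs to the kind `k` with respect to the color `r`. -/
structure HasKind (n r : ℕ) (X : List Letter) (k : Kind) : Prop where
  eps : wordEps n r X = k.eps
  phi : wordPhi n r X = k.phi
  wt : wordWt r X = k.wt

/-! ### Local structure of monomials with respect to one color -/

/-- The partial sum `∑_{k ≤ m} l_{k,i}` as a homomorphism. -/
noncomputable def partialHom {n : ℕ} (i : Fin n) (m : ℤ) : LaurentMonomial n →+ ℤ :=
  Finsupp.liftAddHom fun q => if q.2 = i ∧ q.1 ≤ m then AddMonoidHom.id ℤ else 0

/-- The weight as a homomorphism. -/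
noncomputable def wtHom {n : ℕ} (i : Fin n) : LaurentMonomial n →+ ℤ :=
  Finsupp.liftAddHom fun q => if q.2 = i then AddMonoidHom.id ℤ else 0

theorem partialHom_apply {n : ℕ} (i : Fin n) (m : ℤ) (Y : LaurentMonomial n) :
    partialHom i m Y = partialSum Y i m := by
  rw [partialHom, Finsupp.liftAddHom_apply, partialSum, Finset.sum_filter, Finsupp.sum]
  refine Finset.sum_congr rfl fun q _ => ?_
  split_ifs <;> simp

theorem wtHom_apply {n : ℕ} (i : Fin n) (Y : LaurentMonomial n) : wtHom i Y = monoWt Y i := by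
  rw [wtHom, Finsupp.liftAddHom_apply, monoWt, Finset.sum_filter, Finsupp.sum]
  refine Finset.sum_congr rfl fun q _ => ?_
  split_ifs <;> simp

theorem partialHom_varY {n : ℕ} (i : Fin n) (m m' : ℤ) (x : ℕ) :
    partialHom i m (varY n m' x) = if x = i.val + 1 ∧ m' ≤ m then 1 else 0 := by
  unfold varY
  split_ifs with hrange heq heq
  · have : (⟨x - 1, by omega⟩ : Fin n) = i := Fin.ext (by simp [heq.1])
    simp [partialHom, monoVar, heq.2, this]
  · have : ¬ ((⟨x - 1, by omega⟩ : Fin n) = i ∧ m' ≤ m) := by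
      rintro ⟨rfl, h⟩
      exact heq ⟨by simp only; omega, h⟩
    simp [partialHom, monoVar, this]
  · exact absurd ⟨by omega, by omega⟩ hrange
  · simp

theorem wtHom_varY {n : ℕ} (i : Fin n) (m' : ℤ) (x : ℕ) :
    wtHom i (varY n m' x) = if x = i.val + 1 then 1 else 0 := by
  unfold varY
  split_ifs with hrange heq heq
  · have : (⟨x - 1, by omega⟩ : Fin n) = i := Fin.ext (by simp [heq])
    simp [wtHom, monoVar, this]
  · have : ¬ (⟨x - 1, by omega⟩ : Fin n) = i := by
      rintro rfl
      exact heq (by simp only; omega)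
    simp [wtHom, monoVar, this]
  · exact absurd ⟨by omega, by omega⟩ hrange
  · simp

/-- The partial sums `∑_{k ≤ m} l_{k,i}` contributed by letters of a given kind: for `plus` the
variable `Y_{x,i}`, for `minus` its counterpart `Y_{x+1,i}⁻¹`. -/
def Kind.step : Kind → ℤ → ℤ → ℤ
  | .zero, _, _ => 0
  | .plus, x, m => if x ≤ m then 1 else 0
  | .minus, x, m => if x + 1 ≤ m then -1 else 0

/-- In the color `i`, the monomial `Y` looks like the tensor product of a factor of kind `k` placed
at `x` and a factor of kind `k'` placed at `y`. -/
structure HasProfile {n : ℕ} (Y : LaurentMonomial n) (i : Fin n) (k k' : Kind) (x y : ℤ) :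
    Prop where
  partialSum_eq : ∀ m, partialSum Y i m = k.step x m + k'.step y m
  monoWt_eq : monoWt Y i = k.wt + k'.wt
  le : y ≤ x
  lt : k = .plus → k' = .minus → y < x

namespace HasProfile

variable {n : ℕ} {Y : LaurentMonomial n} {i : Fin n} {k k' : Kind} {x y : ℤ}
  (h : HasProfile Y i k k' x y)

include h

theorem monoPhi_eq : monoPhi i Y = Kind.pairPhi k k' := by
  obtain ⟨hsum, -, hle, hlt⟩ := h
  refine IsGreatest.csSup_eq
    ⟨⟨if k = .plus then x else if k' = .plus then y else y - 1, ?_⟩, ?_⟩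
  · rw [hsum]
    cases k <;> cases k' <;> simp [Kind.step, Kind.pairPhi, Kind.phi, Kind.eps, hle] <;>
      simp at hlt <;> omega
  · rintro _ ⟨m, rfl⟩
    rw [hsum]
    cases k <;> cases k' <;> simp [Kind.step, Kind.pairPhi, Kind.phi, Kind.eps] <;>
      simp at hlt <;> grind

theorem monoEps_eq : monoEps i Y = Kind.pairEps k k' := by
  rw [monoEps, h.monoPhi_eq, h.monoWt_eq]
  cases k <;> cases k' <;> rfl

theorem monoNf_eq (hne : Kind.pairPhi k k' ≠ 0) : monoNf i Y = if k = .plus then x else y := by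
  rw [monoNf, h.monoPhi_eq]
  obtain ⟨hsum, -, hle, hlt⟩ := h
  refine IsLeast.csInf_eq ⟨?_, fun m hm => ?_⟩
  · rw [Set.mem_ofPred_eq, hsum]
    cases k <;> cases k' <;>
      simp [Kind.step, Kind.pairPhi, Kind.phi, Kind.eps, hle] at hne hlt ⊢
  · rw [Set.mem_ofPred_eq, hsum] at hm
    cases k <;> cases k' <;>
      simp [Kind.step, Kind.pairPhi, Kind.phi, Kind.eps] at hne hm hlt ⊢ <;> grind

theorem monoNe_eq (hne : Kind.pairEps k k' ≠ 0) : monoNe i Y = if k' = .minus then y else x := by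
  rw [monoNe, h.monoPhi_eq]
  obtain ⟨hsum, -, hle, hlt⟩ := h
  refine IsGreatest.csSup_eq ⟨?_, fun m hm => ?_⟩
  · rw [Set.mem_ofPred_eq, hsum]
    cases k <;> cases k' <;>
      simp [Kind.step, Kind.pairPhi, Kind.pairEps, Kind.phi, Kind.eps, hle] at hne hlt ⊢
  · rw [Set.mem_ofPred_eq, hsum] at hm
    cases k <;> cases k' <;>
      simp [Kind.step, Kind.pairPhi, Kind.pairEps, Kind.phi, Kind.eps] at hne hm hlt ⊢ <;> grind

end HasProfile

/-! ### The monomials `A_{m,i}` -/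

theorem varY_succ {n : ℕ} (m : ℤ) (j : Fin n) : varY n m (j.val + 1) = monoVar n m j := by
  have : 1 ≤ j.val + 1 ∧ j.val + 1 ≤ n := by omega
  simp [varY]

theorem sum_ite_succ_eq_varY {n : ℕ} (m : ℤ) (i : Fin n) {x : ℕ} (hx : x ≠ i.val + 1) :
    ∑ j ∈ Finset.univ.erase i, (if j.val + 1 = x then monoVar n m j else 0) = varY n m x := by
  by_cases hrange : 1 ≤ x ∧ x ≤ n
  · have hval : x - 1 + 1 = x := by omega
    rw [Finset.sum_eq_single (⟨x - 1, by omega⟩ : Fin n), if_pos hval, varY, dif_pos hrange]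
    · exact fun j _ hj => if_neg fun h => hj (Fin.ext (by simp only [← h, Nat.add_sub_cancel]))
    · exact fun h => absurd (Finset.mem_erase.2
        ⟨fun h => hx (by rw [← h, hval]), Finset.mem_univ _⟩) h
  · rw [varY, dif_neg hrange]
    exact Finset.sum_eq_zero fun j _ => if_neg (by omega)

theorem cartan_smul_monoVar {n : ℕ} (m : ℤ) {i j : Fin n} (hne : j ≠ i) :
    cartan n j i • monoVar n (m + signP n j i) j =
      -((if i.val + 1 = n then (2 : ℤ) else 1) •
          if j.val + 1 = i.val then monoVar n (m + 1) j else 0) -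
        if j.val + 1 = i.val + 2 then monoVar n m j else 0 := by
  have hval : j.val ≠ i.val := fun h => hne (Fin.ext h)
  simp only [cartan, signP, Fin.lt_def, if_neg hne]
  split_ifs <;> first | omega | simp

theorem monoA_eq {n : ℕ} (m : ℤ) (i : Fin n) :
    monoA n m i = varY n m (i.val + 1) + varY n (m + 1) (i.val + 1) -
      (if i.val + 1 = n then (2 : ℤ) else 1) • varY n (m + 1) i.val - varY n m (i.val + 2) := by
  rw [monoA, Finset.sum_congr rfl fun j hj => cartan_smul_monoVar m (Finset.ne_of_mem_erase hj),
    Finset.sum_sub_distrib, Finset.sum_neg_distrib, ← Finset.smul_sum,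
    sum_ite_succ_eq_varY _ _ (by omega), sum_ite_succ_eq_varY _ _ (by omega),
    varY_succ, varY_succ]
  abel

/-! ### Admissibility in terms of counting functions -/

/-- The number of letters `≤ j`, by which the condition defining `B(Λ_n)` is expressed in
`isAdmissible_iff`. -/
def cnt (s : List ℕ) (j : ℕ) : ℕ := s.countP (· ≤ j)

theorem cnt_append (s t : List ℕ) (j : ℕ) : cnt (s ++ t) j = cnt s j + cnt t j :=
  List.countP_append

theorem cnt_of_le {s : List ℕ} {j : ℕ} (h : ∀ x ∈ s, x ≤ j) : cnt s j = s.length :=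
  List.countP_eq_length.2 (by simpa using h)

theorem cnt_of_lt {s : List ℕ} {j : ℕ} (h : ∀ x ∈ s, j < x) : cnt s j = 0 :=
  List.countP_eq_zero.2 (by simpa using h)

theorem cnt_cons (x : ℕ) (s : List ℕ) (j : ℕ) :
    cnt (x :: s) j = (if x ≤ j then 1 else 0) + cnt s j := by
  simp only [cnt, List.countP_cons, decide_eq_true_eq]
  omega

theorem cnt_nil (j : ℕ) : cnt [] j = 0 := rfl

theorem cnt_of_getElem? {s : List ℕ} (hs : s.Pairwise (· < ·)) {a i : ℕ} (h : s[a]? = some i) :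
    cnt s i = a + 1 := by
  induction s generalizing a with
  | nil => simp at h
  | cons x t ih =>
    rw [List.pairwise_cons] at hs
    rw [cnt_cons]
    cases a with
    | zero =>
      simp only [List.getElem?_cons_zero, Option.some.injEq] at h
      subst h
      rw [cnt_of_lt hs.1]
      simp
    | succ a =>
      rw [List.getElem?_cons_succ] at h
      rw [ih hs.2 h, if_pos (hs.1 i (List.mem_of_getElem? h)).le]
      omega

theorem cnt_succ {s : List ℕ} (hs : s.Pairwise (· < ·)) (j : ℕ) :
    cnt s (j + 1) = cnt s j + if j + 1 ∈ s then 1 else 0 := by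
  induction s with
  | nil => simp [cnt]
  | cons x t ih =>
    rw [List.pairwise_cons] at hs
    rw [cnt_cons, cnt_cons, ih hs.2]
    by_cases hx : x = j + 1
    · subst hx
      have : j + 1 ∉ t := fun h => (hs.1 _ h).false
      simp [this]
      omega
    · have hle : x ≤ j + 1 ↔ x ≤ j := by omega
      have hmem : j + 1 ∈ x :: t ↔ j + 1 ∈ t := by simp [Ne.symm hx]
      simp only [hle, hmem]
      omega

theorem isAdmissible_iff {n : ℕ} {v : Column} :
    IsAdmissible n v ↔ IsColumn n v ∧ ∀ j, cnt v.u j + cnt v.l j ≤ j := by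
  refine ⟨fun h => ⟨h.1, fun j => ?_⟩, fun h => ⟨h.1, fun a b i ha hb => ?_⟩⟩
  · obtain ⟨⟨hu, hl, hu_range, hl_range, -⟩, hpos⟩ := h
    induction j with
    | zero =>
      rw [cnt_of_lt, cnt_of_lt]
      · exact fun x hx => (hl_range x hx).1
      · exact fun x hx => (hu_range x hx).1
    | succ j ih =>
      by_cases hju : j + 1 ∈ v.u
      · by_cases hjl : j + 1 ∈ v.l
        · obtain ⟨a, ha⟩ := List.mem_iff_getElem?.1 hju
          obtain ⟨b, hb⟩ := List.mem_iff_getElem?.1 hjl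
          rw [cnt_of_getElem? hu ha, cnt_of_getElem? hl hb]
          exact hpos a b _ ha hb
        · rw [cnt_succ hu, cnt_succ hl, if_pos hju, if_neg hjl]
          omega
      · rw [cnt_succ hu, cnt_succ hl, if_neg hju]
        split_ifs <;> omega
  · rw [← cnt_of_getElem? h.1.1 ha, ← cnt_of_getElem? h.1.2.1 hb]
    exact h.2 i

theorem IsAdmissible.swap {n : ℕ} {v : Column} (hv : IsAdmissible n v) :
    IsAdmissible n v.swap := by
  rw [isAdmissible_iff] at hv ⊢
  exact ⟨hv.1.swap, fun j => (add_comm _ _).trans_le (hv.2 j)⟩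

theorem isAdmissible_swap {n : ℕ} {v : Column} : IsAdmissible n v.swap ↔ IsAdmissible n v :=
  ⟨fun h => h.swap, fun h => h.swap⟩

/-! ### Splitting a column at the letters `r`, `r + 1` -/

/-- The possible sets of letters `r`, `r + 1` in an increasing sequence, with their kinds. A
sequence of barred letters has the dual kind. -/
inductive MidKind (r : ℕ) : List ℕ → Kind → Prop
  | nil : MidKind r [] .zero
  | both : MidKind r [r, r + 1] .zero
  | left : MidKind r [r] .plus
  | right : MidKind r [r + 1] .minus

/-- A splitting of an increasing sequence at the letters `r`, `r + 1`. -/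
structure Split (r : ℕ) (s s₁ mid s₂ : List ℕ) (k : Kind) : Prop where
  eq : s = s₁ ++ mid ++ s₂
  lt : ∀ x ∈ s₁, x < r
  gt : ∀ x ∈ s₂, r + 1 < x
  midKind : MidKind r mid k

theorem exists_split (r : ℕ) {s : List ℕ} (hs : s.Pairwise (· < ·)) :
    ∃ s₁ mid s₂ k, Split r s s₁ mid s₂ k := by
  induction s with
  | nil => exact ⟨[], [], [], _, rfl, by simp, by simp, .nil⟩
  | cons x t ih =>
    rw [List.pairwise_cons] at hs
    obtain hx | rfl | rfl | hx : x < r ∨ x = r ∨ x = r + 1 ∨ r + 1 < x := by omega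
    · obtain ⟨s₁, mid, s₂, k, rfl, hlt, hgt, hmid⟩ := ih hs.2
      exact ⟨x :: s₁, mid, s₂, k, rfl, List.forall_mem_cons.2 ⟨hx, hlt⟩, hgt, hmid⟩
    · by_cases ht : x + 1 ∈ t
      · obtain ⟨y, t, rfl⟩ := List.exists_cons_of_ne_nil (List.ne_nil_of_mem ht)
        have hy : y = x + 1 := by
          have := hs.1 y List.mem_cons_self
          rcases List.mem_cons.1 ht with h | h
          · exact h.symm
          · have := (List.pairwise_cons.1 hs.2).1 _ h
            omega
        subst hy
        exact ⟨[], _, t, _, rfl, by simp, (List.pairwise_cons.1 hs.2).1, .both⟩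
      · refine ⟨[], [x], t, _, rfl, by simp, fun y hy => ?_, .left⟩
        exact lt_of_le_of_ne (hs.1 y hy) fun h => ht (h ▸ hy)
    · exact ⟨[], [r + 1], t, _, rfl, by simp, hs.1, .right⟩
    · exact ⟨[], [], x :: t, _, rfl, by simp,
        List.forall_mem_cons.2 ⟨hx, fun y hy => hx.trans (hs.1 y hy)⟩, .nil⟩

theorem Split.cnt {r : ℕ} {s s₁ mid s₂ : List ℕ} {k : Kind} (h : Split r s s₁ mid s₂ k) {j : ℕ}
    (hj : r ≤ j + 1) (hj' : j ≤ r + 1) : TypeC.cnt s j = s₁.length + TypeC.cnt mid j := by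
  rw [h.eq, cnt_append, cnt_append, cnt_of_le, cnt_of_lt (s := s₂), add_zero]
  · exact fun x hx => hj'.trans_lt (h.gt x hx)
  · exact fun x hx => Nat.lt_succ_iff.1 ((h.lt x hx).trans_le hj)

theorem posSum_eq_zero {M : Type*} [AddCommMonoid M] {f : ℤ → ℕ → M} {s : List ℕ}
    (h : ∀ a, ∀ x ∈ s, f a x = 0) (a₀ : ℤ) : posSum f a₀ s = 0 := by
  induction s generalizing a₀ with
  | nil => rfl
  | cons x s ih =>
    rw [posSum, h _ x (by simp), ih fun a y hy => h a y (by simp [hy]), add_zero]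

theorem map_posSum {M N : Type*} [AddCommMonoid M] [AddCommMonoid N] (g : M →+ N)
    (f : ℤ → ℕ → M) (a₀ : ℤ) (s : List ℕ) :
    g (posSum f a₀ s) = posSum (fun a x => g (f a x)) a₀ s := by
  induction s generalizing a₀ with
  | nil => simp [posSum]
  | cons x s ih => simp [posSum, ih]

theorem Split.map_posSum {r : ℕ} {s s₁ mid s₂ : List ℕ} {k : Kind} (h : Split r s s₁ mid s₂ k)
    {M N : Type*} [AddCommMonoid M] [AddCommMonoid N] (g : M →+ N) {f : ℤ → ℕ → M}
    (hf : ∀ a x, x ≠ r → x ≠ r + 1 → g (f a x) = 0) (a₀ : ℤ) :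
    g (posSum f a₀ s) = g (posSum f (a₀ + s₁.length) mid) := by
  simp only [TypeC.map_posSum]
  rw [h.eq, posSum_append, posSum_append, posSum_eq_zero (s := s₁), posSum_eq_zero (s := s₂),
    zero_add, add_zero]
  · intro a x hx
    have := h.gt x hx
    exact hf a x (by omega) (by omega)
  · intro a x hx
    have := h.lt x hx
    exact hf a x (by omega) (by omega)

/-! ### The monomial of a column in one color -/

theorem partialHom_boxPos {n : ℕ} (i : Fin n) (m a : ℤ) (x : ℕ) :
    partialHom i m (boxPos n a x) = (if x = i.val + 1 ∧ n - a ≤ m then 1 else 0) -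
      (if x = i.val + 2 ∧ n + 1 - a ≤ m then 1 else 0) := by
  rw [boxPos, map_sub, partialHom_varY, partialHom_varY]
  congr 1
  exact if_congr (by omega) rfl rfl

theorem partialHom_boxNeg {n : ℕ} (i : Fin n) (m b : ℤ) (x : ℕ) :
    partialHom i m (boxNeg n b x) = (if x = i.val + 2 ∧ n - x + b ≤ m then 1 else 0) -
      (if x = i.val + 1 ∧ n - x + b ≤ m then 1 else 0) := by
  rw [boxNeg, map_sub, partialHom_varY, partialHom_varY]
  congr 1
  exact if_congr (by omega) rfl rfl

theorem wtHom_boxPos {n : ℕ} (i : Fin n) (a : ℤ) (x : ℕ) :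
    wtHom i (boxPos n a x) = (if x = i.val + 1 then 1 else 0) -
      (if x = i.val + 2 then 1 else 0) := by
  rw [boxPos, map_sub, wtHom_varY, wtHom_varY]
  congr 1
  exact if_congr (by omega) rfl rfl

theorem wtHom_boxNeg {n : ℕ} (i : Fin n) (b : ℤ) (x : ℕ) :
    wtHom i (boxNeg n b x) = (if x = i.val + 2 then 1 else 0) -
      (if x = i.val + 1 then 1 else 0) := by
  rw [boxNeg, map_sub, wtHom_varY, wtHom_varY]
  congr 1
  exact if_congr (by omega) rfl rfl

section Mid

variable {n : ℕ} {i : Fin n} {mid : List ℕ} {k : Kind} (h : MidKind (i.val + 1) mid k)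

include h

theorem MidKind.partialHom_boxPos (m a : ℤ) :
    partialHom i m (posSum (boxPos n) a mid) = k.step (n - a) m := by
  cases h <;> simp only [posSum, Kind.step, map_add, map_zero, TypeC.partialHom_boxPos,
    true_and] <;> split_ifs <;> omega

theorem MidKind.partialHom_boxNeg (m b : ℤ) :
    partialHom i m (posSum (boxNeg n) b mid) = k.dual.step (n - i.val + b - 2) m := by
  cases h <;> simp only [posSum, Kind.step, Kind.dual, map_add, map_zero, TypeC.partialHom_boxNeg,
    true_and] <;> split_ifs <;> omega

theorem MidKind.wtHom_boxPos (a : ℤ) : wtHom i (posSum (boxPos n) a mid) = k.wt := by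
  cases h <;> simp [posSum, Kind.wt, TypeC.wtHom_boxPos]

theorem MidKind.wtHom_boxNeg (b : ℤ) : wtHom i (posSum (boxNeg n) b mid) = k.dual.wt := by
  cases h <;> simp [posSum, Kind.dual, Kind.wt, TypeC.wtHom_boxNeg]

end Mid

section Column

variable {n : ℕ} {v : Column} {i : Fin n} {u₁ mu u₂ l₁ ml l₂ : List ℕ} {k k' : Kind}
  (hu : Split (i.val + 1) v.u u₁ mu u₂ k) (hl : Split (i.val + 1) v.l l₁ ml l₂ k')

include hu hl

theorem partialSum_colMono (m : ℤ) : partialSum (colMono n v) i m =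
    k.step (n - u₁.length - 1) m + k'.dual.step (n - i.val + l₁.length - 1) m := by
  rw [← partialHom_apply, colMono, map_add, hu.map_posSum, hl.map_posSum,
    hu.midKind.partialHom_boxPos, hl.midKind.partialHom_boxNeg]
  · congr 2 <;> ring
  · intro a x hr hr'
    rw [partialHom_boxNeg, if_neg (by omega), if_neg (by omega), sub_zero]
  · intro a x hr hr'
    rw [partialHom_boxPos, if_neg (by omega), if_neg (by omega), sub_zero]

theorem monoWt_colMono : monoWt (colMono n v) i = k.wt + k'.dual.wt := by
  rw [← wtHom_apply, colMono, map_add, hu.map_posSum, hl.map_posSum,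
    hu.midKind.wtHom_boxPos, hl.midKind.wtHom_boxNeg]
  · intro a x hr hr'
    rw [wtHom_boxNeg, if_neg (by omega), if_neg (by omega), sub_zero]
  · intro a x hr hr'
    rw [wtHom_boxPos, if_neg (by omega), if_neg (by omega), sub_zero]

theorem IsAdmissible.hasProfile (hv : IsAdmissible n v) : HasProfile (colMono n v) i k k'.dual
    (n - u₁.length - 1) (n - i.val + l₁.length - 1) where
  partialSum_eq := partialSum_colMono hu hl
  monoWt_eq := monoWt_colMono hu hl
  le := by
    have hcnt := (isAdmissible_iff.1 hv).2 i.val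
    rw [hu.cnt (by omega) (by omega), hl.cnt (by omega) (by omega)] at hcnt
    omega
  lt := by
    intro hk hk'
    have hcnt := (isAdmissible_iff.1 hv).2 (i.val + 1)
    rw [hu.cnt (by omega) (by omega), hl.cnt (by omega) (by omega)] at hcnt
    have hmu := hu.midKind
    have hml := hl.midKind
    subst hk
    cases hmu
    cases hml <;> simp only [Kind.dual, reduceCtorEq] at hk'
    simp only [cnt_cons, cnt_nil, le_refl, if_true] at hcnt
    omega

end Column

/-! ### The word of a column in one color -/

theorem Neutral.pos {n r x : ℕ} (hr : x ≠ r) (hr' : x ≠ r + 1) : Neutral n r [Letter.pos x] where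
  eps := by simp [wordEps, letterEps, letterE, hr']
  phi := by simp [wordPhi, letterPhi, letterF, hr]
  wt := by simp [wordWt, letterWt, hr, hr']

theorem Neutral.neg {n r x : ℕ} (hr : x ≠ r) (hr' : x ≠ r + 1) : Neutral n r [Letter.neg x] where
  eps := by simp [wordEps, letterEps, letterE, hr]
  phi := by simp [wordPhi, letterPhi, letterF, hr']
  wt := by simp [wordWt, letterWt, hr, hr']

theorem Neutral.map_pos {n r : ℕ} {s : List ℕ} (h : ∀ x ∈ s, x ≠ r ∧ x ≠ r + 1) :
    Neutral n r (s.map Letter.pos) :=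
  .of_forall <| List.forall_mem_map.2 fun x hx => .pos (h x hx).1 (h x hx).2

theorem Neutral.map_neg {n r : ℕ} {s : List ℕ} (h : ∀ x ∈ s, x ≠ r ∧ x ≠ r + 1) :
    Neutral n r (s.map Letter.neg).reverse :=
  .of_forall fun x hx => by
    obtain ⟨y, hy, rfl⟩ := List.mem_map.1 (List.mem_reverse.1 hx)
    exact .neg (h y hy).1 (h y hy).2

section Kind

variable {n r : ℕ} {mid : List ℕ} {k : Kind} (h : MidKind r mid k) (hmid : ∀ x ∈ mid, x ≤ n)

include h hmid

theorem MidKind.hasKind_pos : HasKind n r (mid.map Letter.pos) k := by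
  cases h <;> simp only [List.forall_mem_cons, List.not_mem_nil, Nat.add_one_le_iff] at hmid <;>
    constructor <;>
    simp [wordEps, wordPhi, wordWt, letterEps, letterPhi, letterWt, letterE, letterF, hmid,
      Kind.eps, Kind.phi, Kind.wt, apply_ite Option.isSome]

theorem MidKind.hasKind_neg : HasKind n r (mid.map Letter.neg).reverse k.dual := by
  cases h <;> simp only [List.forall_mem_cons, List.not_mem_nil, Nat.add_one_le_iff] at hmid <;>
    constructor <;>
    simp [wordEps, wordPhi, wordWt, letterEps, letterPhi, letterWt, letterE, letterF, hmid,
      Kind.eps, Kind.phi, Kind.wt, Kind.dual, apply_ite Option.isSome]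

end Kind

/-- The word of a column that is split at the letters `r`, `r + 1`: the letters that are relevant
for the color `r` form `X` and `X'`, the other ones the neutral factors. -/
def splitWord (u₁ u₂ l₁ l₂ : List ℕ) (X X' : List Letter) : List Letter :=
  pairWord (u₁.map Letter.pos) X (u₂.map Letter.pos ++ (l₂.map Letter.neg).reverse) X'
    (l₁.map Letter.neg).reverse

section Word

variable {n r : ℕ} {v : Column} {u₁ mu u₂ l₁ ml l₂ : List ℕ} {k k' : Kind}

theorem Column.word_eq_splitWord (hu : Split r v.u u₁ mu u₂ k) (hl : Split r v.l l₁ ml l₂ k') :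
    v.word = splitWord u₁ u₂ l₁ l₂ (mu.map Letter.pos) (ml.map Letter.neg).reverse := by
  simp [Column.word, splitWord, pairWord, hu.eq, hl.eq]

theorem Split.ne_of_mem {s s₁ mid s₂ : List ℕ} (h : Split r s s₁ mid s₂ k) {x : ℕ}
    (hx : x ∈ s₁ ∨ x ∈ s₂) : x ≠ r ∧ x ≠ r + 1 := by
  rcases hx with hx | hx
  · have := h.lt x hx
    omega
  · have := h.gt x hx
    omega

theorem Split.neutral (hu : Split r v.u u₁ mu u₂ k) (hl : Split r v.l l₁ ml l₂ k') :
    Neutral n r (u₁.map Letter.pos) ∧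
      Neutral n r (u₂.map Letter.pos ++ (l₂.map Letter.neg).reverse) ∧
        Neutral n r (l₁.map Letter.neg).reverse :=
  ⟨.map_pos fun _ hx => hu.ne_of_mem (.inl hx),
    (Neutral.map_pos fun _ hx => hu.ne_of_mem (.inr hx)).append
      (.map_neg fun _ hx => hl.ne_of_mem (.inr hx)),
    .map_neg fun _ hx => hl.ne_of_mem (.inl hx)⟩

variable (hu : Split r v.u u₁ mu u₂ k) (hl : Split r v.l l₁ ml l₂ k')
  (hmu : ∀ x ∈ mu, x ≤ n) (hml : ∀ x ∈ ml, x ≤ n)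

include hu hl hmu hml

theorem wordEps_word : wordEps n r v.word = Kind.pairEps k k'.dual := by
  obtain ⟨hA, hB, hC⟩ := hu.neutral (n := n) hl
  rw [Column.word_eq_splitWord hu hl, splitWord, wordEps_pairWord hA hB hC,
    (hu.midKind.hasKind_pos hmu).eps, (hu.midKind.hasKind_pos hmu).phi,
    (hl.midKind.hasKind_neg hml).eps, Kind.pairEps]

theorem wordPhi_word : wordPhi n r v.word = Kind.pairPhi k k'.dual := by
  obtain ⟨hA, hB, hC⟩ := hu.neutral (n := n) hl
  rw [Column.word_eq_splitWord hu hl, splitWord, wordPhi_pairWord hA hB hC,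
    (hu.midKind.hasKind_pos hmu).phi, (hl.midKind.hasKind_neg hml).phi,
    (hl.midKind.hasKind_neg hml).eps, Kind.pairPhi]

theorem wordWt_word : wordWt r v.word = k.wt + k'.dual.wt := by
  obtain ⟨hA, hB, hC⟩ := hu.neutral (n := n) hl
  rw [Column.word_eq_splitWord hu hl, splitWord, wordWt_pairWord hA hB hC,
    (hu.midKind.hasKind_pos hmu).wt, (hl.midKind.hasKind_neg hml).wt]

theorem wordF_word : wordF n r v.word = if k'.dual.eps < k.phi then
      (wordF n r (mu.map .pos)).map (splitWord u₁ u₂ l₁ l₂ · (ml.map .neg).reverse)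
    else (wordF n r (ml.map .neg).reverse).map (splitWord u₁ u₂ l₁ l₂ (mu.map .pos) ·) := by
  obtain ⟨hA, hB, hC⟩ := hu.neutral (n := n) hl
  rw [Column.word_eq_splitWord hu hl, splitWord, wordF_pairWord hA hB hC,
    (hu.midKind.hasKind_pos hmu).phi, (hl.midKind.hasKind_neg hml).eps]
  rfl

theorem wordE_word : wordE n r v.word = if k'.dual.eps ≤ k.phi then
      (wordE n r (mu.map .pos)).map (splitWord u₁ u₂ l₁ l₂ · (ml.map .neg).reverse)
    else (wordE n r (ml.map .neg).reverse).map (splitWord u₁ u₂ l₁ l₂ (mu.map .pos) ·) := by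
  obtain ⟨hA, hB, hC⟩ := hu.neutral (n := n) hl
  rw [Column.word_eq_splitWord hu hl, splitWord, wordE_pairWord hA hB hC,
    (hu.midKind.hasKind_pos hmu).phi, (hl.midKind.hasKind_neg hml).eps]
  rfl

end Word

/-! ### Replacing a letter of a column -/

theorem pairwise_replace {r : ℕ} {s₁ s₂ : List ℕ} {c c' : ℕ} (hlt : ∀ x ∈ s₁, x < r)
    (hgt : ∀ x ∈ s₂, r + 1 < x) (hc' : c' = r ∨ c' = r + 1)
    (hs : (s₁ ++ [c] ++ s₂).Pairwise (· < ·)) : (s₁ ++ [c'] ++ s₂).Pairwise (· < ·) := by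
  simp only [List.append_assoc, List.pairwise_append, List.cons_append, List.nil_append,
    List.pairwise_cons] at hs ⊢
  refine ⟨hs.1, ⟨fun x hx => ?_, hs.2.1.2⟩, fun x hx y hy => ?_⟩
  · have := hgt x hx
    omega
  · have := hlt x hx
    rcases List.mem_cons.1 hy with rfl | hy
    · omega
    · have := hgt y hy
      omega

theorem cnt_replace {r : ℕ} {s₁ s₂ : List ℕ} {c c' : ℕ} (hc : c = r ∨ c = r + 1)
    (hc' : c' = r ∨ c' = r + 1) {j : ℕ} (hj : j ≠ r) :
    cnt (s₁ ++ [c'] ++ s₂) j = cnt (s₁ ++ [c] ++ s₂) j := by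
  simp only [cnt_append, cnt_cons, cnt_nil]
  have : c ≤ j ↔ c' ≤ j := by omega
  simp only [this]

theorem bounds_replace {n r : ℕ} {s₁ s₂ : List ℕ} {c c' : ℕ} (hr : 1 ≤ r) (hrn : r < n)
    (hc' : c' = r ∨ c' = r + 1)
    (hs : ∀ x ∈ s₁ ++ [c] ++ s₂, 1 ≤ x ∧ x ≤ n) : ∀ x ∈ s₁ ++ [c'] ++ s₂, 1 ≤ x ∧ x ≤ n := by
  intro x hx
  simp only [List.mem_append, List.mem_singleton] at hx hs
  rcases hx with (h | h) | h
  · exact hs x (by tauto)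
  · omega
  · exact hs x (by tauto)

theorem IsAdmissible.replace_u {n r : ℕ} {u₁ u₂ l : List ℕ} {c c' : ℕ} (hlt : ∀ x ∈ u₁, x < r)
    (hgt : ∀ x ∈ u₂, r + 1 < x) (hc : c = r ∨ c = r + 1) (hc' : c' = r ∨ c' = r + 1)
    (hr : 1 ≤ r) (hrn : r < n) (h : IsAdmissible n ⟨u₁ ++ [c] ++ u₂, l⟩)
    (hcnt : cnt (u₁ ++ [c'] ++ u₂) r + cnt l r ≤ r) :
    IsAdmissible n ⟨u₁ ++ [c'] ++ u₂, l⟩ := by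
  rw [isAdmissible_iff] at h ⊢
  obtain ⟨⟨hu, hl, hu_range, hl_range, hlen⟩, hadm⟩ := h
  refine ⟨⟨pairwise_replace hlt hgt hc' hu, hl, bounds_replace hr hrn hc' hu_range, hl_range,
    by simpa using hlen⟩, fun j => ?_⟩
  by_cases hj : j = r
  · subst hj
    exact hcnt
  · simpa only [cnt_replace hc hc' hj] using hadm j

theorem isAdmissible_replace_iff {n r : ℕ} {u₁ u₂ l l₁ ml l₂ : List ℕ} {k : Kind}
    (hlt : ∀ x ∈ u₁, x < r) (hgt : ∀ x ∈ u₂, r + 1 < x) (hl : Split r l l₁ ml l₂ k)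
    (hk : k ≠ .plus) (hr : 1 ≤ r) (hrn : r < n) :
    IsAdmissible n ⟨u₁ ++ [r] ++ u₂, l⟩ ↔ IsAdmissible n ⟨u₁ ++ [r + 1] ++ u₂, l⟩ := by
  have hu : ∀ {c k'}, MidKind r [c] k' → Split r (u₁ ++ [c] ++ u₂) u₁ [c] u₂ k' :=
    fun h => ⟨rfl, hlt, hgt, h⟩
  constructor <;> intro h
  · refine h.replace_u hlt hgt (.inl rfl) (.inr rfl) hr hrn ?_
    have hcnt := (isAdmissible_iff.1 h).2 r
    rw [(hu .left).cnt (by omega) (by omega)] at hcnt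
    rw [(hu .right).cnt (by omega) (by omega)]
    simp only [cnt_cons, cnt_nil, le_refl, if_true] at hcnt
    rw [cnt_cons, if_neg (by omega), cnt_nil]
    omega
  · refine h.replace_u hlt hgt (.inr rfl) (.inl rfl) hr hrn ?_
    have hcnt := (isAdmissible_iff.1 h).2 (r - 1)
    have hcnt' := (isAdmissible_iff.1 h).2 (r + 1)
    rw [(hu .right).cnt (by omega) (by omega), hl.cnt (by omega) (by omega)] at hcnt hcnt'
    rw [(hu .left).cnt (by omega) (by omega), hl.cnt (by omega) (by omega)]
    have hml := hl.midKind
    cases hml <;> simp [cnt_cons, cnt_nil] at hk hcnt hcnt' ⊢ <;> omega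

theorem isAdmissible_append_last_iff {n : ℕ} {u l : List ℕ} (hn : 1 ≤ n) (hu : ∀ x ∈ u, x < n)
    (hl : ∀ x ∈ l, x < n) : IsAdmissible n ⟨u ++ [n], l⟩ ↔ IsAdmissible n ⟨u, l ++ [n]⟩ := by
  suffices h : ∀ {u l : List ℕ}, (∀ x ∈ l, x < n) → IsAdmissible n ⟨u ++ [n], l⟩ →
      IsAdmissible n ⟨u, l ++ [n]⟩ from
    ⟨h hl, fun hv => (h hu hv.swap).swap⟩
  intro u l hl h
  rw [isAdmissible_iff] at h ⊢
  obtain ⟨⟨hu_lt, hl_lt, hu_range, hl_range, hlen⟩, hadm⟩ := h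
  refine ⟨⟨(List.pairwise_append.1 hu_lt).1, List.pairwise_append.2
      ⟨hl_lt, List.pairwise_singleton _ _, by simpa using hl⟩,
    fun x hx => hu_range x (List.mem_append_left _ hx),
    List.forall_mem_append.2 ⟨hl_range, by simpa using hn⟩, ?_⟩, fun j => ?_⟩
  · simp only [List.length_append, List.length_singleton] at hlen ⊢
    omega
  · have := hadm j
    simp only [cnt_append] at this ⊢
    omega

theorem monoA_eq_varA {n : ℕ} (m : ℤ) {i : Fin n} (hi : i.val + 1 < n) :
    monoA n m i = varA n m (i.val + 1) := by
  rw [monoA_eq, if_neg hi.ne, one_smul, varA, Nat.add_sub_cancel]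

theorem colMono_replace_u {n : ℕ} {i : Fin n} (hi : i.val + 1 < n) (u₁ u₂ l : List ℕ) :
    colMono n ⟨u₁ ++ [i.val + 1 + 1] ++ u₂, l⟩ =
      colMono n ⟨u₁ ++ [i.val + 1] ++ u₂, l⟩ - monoA n (n - u₁.length - 1) i := by
  simp only [colMono, posSum_append, posSum, boxPos_succ, monoA_eq_varA _ hi, List.length_append,
    List.length_cons, List.length_nil]
  rw [show (n : ℤ) - u₁.length - 1 = n - (1 + u₁.length) by ring]
  abel

theorem colMono_replace_l {n : ℕ} {i : Fin n} (hi : i.val + 1 < n) (u l₁ l₂ : List ℕ) :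
    colMono n ⟨u, l₁ ++ [i.val + 1] ++ l₂⟩ =
      colMono n ⟨u, l₁ ++ [i.val + 1 + 1] ++ l₂⟩ - monoA n (n - i.val + l₁.length - 1) i := by
  simp only [colMono, posSum_append, posSum, boxNeg_succ, monoA_eq_varA _ hi, List.length_append,
    List.length_cons, List.length_nil]
  rw [show (n : ℤ) - (i.val + 1 : ℕ) + (1 + l₁.length) - 1 = n - i.val + l₁.length - 1 by
    push_cast
    ring]
  abel

/-! ### The arrows of the crystal of columns -/

/-- The sum of the ranks of the letters with respect to the order
`1 < ⋯ < n < \bar n < ⋯ < \bar 1`. -/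
def Column.rank (n : ℕ) (v : Column) : ℕ := v.u.sum + (v.l.map fun x => 2 * n + 1 - x).sum

/-- An arrow `v → v' = f̃_i v` of the crystal of columns, where `A_{m,i}⁻¹` is the quotient of the
monomials. -/
structure IsArrow (n : ℕ) (i : Fin n) (v v' : Column) (m : ℤ) : Prop where
  admissible_iff : IsAdmissible n v ↔ IsAdmissible n v'
  wordF_eq : wordF n (i.val + 1) v.word = some v'.word
  wordE_eq : wordE n (i.val + 1) v'.word = some v.word
  colMono_eq : colMono n v' = colMono n v - monoA n m i
  rank_lt : v.rank n < v'.rank n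

theorem MidKind.le_succ {r : ℕ} {mid : List ℕ} {k : Kind} (h : MidKind r mid k) :
    ∀ x ∈ mid, x ≤ r + 1 := by
  cases h <;> simp

theorem Kind.eps_dual {k : Kind} (hk : k ≠ .plus) : k.dual.eps = 0 := by
  cases k <;> first | rfl | exact absurd rfl hk

theorem Kind.phi_eq_zero {k : Kind} (hk : k ≠ .plus) : k.phi = 0 := by
  cases k <;> first | rfl | exact absurd rfl hk

section InnerColor

variable {n : ℕ} {i : Fin n} {u₁ mu u₂ l₁ ml l₂ : List ℕ} {k k' : Kind}

theorem isArrow_left (hi : i.val + 1 < n) {l : List ℕ} (hlt : ∀ x ∈ u₁, x < i.val + 1)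
    (hgt : ∀ x ∈ u₂, i.val + 1 + 1 < x) (hl : Split (i.val + 1) l l₁ ml l₂ k')
    (hk' : k' ≠ .plus) :
    IsArrow n i ⟨u₁ ++ [i.val + 1] ++ u₂, l⟩ ⟨u₁ ++ [i.val + 1 + 1] ++ u₂, l⟩
      (n - u₁.length - 1) := by
  have hml : ∀ x ∈ ml, x ≤ n := fun x hx => (hl.midKind.le_succ x hx).trans hi
  have hu : Split (i.val + 1) _ u₁ [i.val + 1] u₂ _ := ⟨rfl, hlt, hgt, .left⟩
  have hu' : Split (i.val + 1) _ u₁ [i.val + 1 + 1] u₂ _ := ⟨rfl, hlt, hgt, .right⟩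
  refine ⟨isAdmissible_replace_iff hlt hgt hl hk' (by omega) hi, ?_, ?_,
    colMono_replace_u hi u₁ u₂ l, ?_⟩
  · rw [wordF_word (v := ⟨_, l⟩) hu hl (by simp) hml,
      Column.word_eq_splitWord (v := ⟨_, l⟩) hu' hl, if_pos (by simp [Kind.eps_dual hk', Kind.phi])]
    simp [wordF, wordEps, letterPhi, letterF, hi]
  · rw [wordE_word (v := ⟨_, l⟩) hu' hl (by simpa using hi) hml,
      Column.word_eq_splitWord (v := ⟨_, l⟩) hu hl, if_pos (by simp [Kind.eps_dual hk'])]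
    simp [wordE, wordEps, letterE, hi]
  · simp only [Column.rank, List.sum_append, List.sum_singleton]
    omega

theorem isArrow_right (hi : i.val + 1 < n) {u : List ℕ} (hu : Split (i.val + 1) u u₁ mu u₂ k)
    (hk : k ≠ .plus) (hlt : ∀ x ∈ l₁, x < i.val + 1) (hgt : ∀ x ∈ l₂, i.val + 1 + 1 < x) :
    IsArrow n i ⟨u, l₁ ++ [i.val + 1 + 1] ++ l₂⟩ ⟨u, l₁ ++ [i.val + 1] ++ l₂⟩
      (n - i.val + l₁.length - 1) := by
  have hmu : ∀ x ∈ mu, x ≤ n := fun x hx => (hu.midKind.le_succ x hx).trans hi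
  have hl : Split (i.val + 1) _ l₁ [i.val + 1] l₂ _ := ⟨rfl, hlt, hgt, .left⟩
  have hl' : Split (i.val + 1) _ l₁ [i.val + 1 + 1] l₂ _ := ⟨rfl, hlt, hgt, .right⟩
  refine ⟨?_, ?_, ?_, colMono_replace_l hi u l₁ l₂, ?_⟩
  · rw [← isAdmissible_swap, ← isAdmissible_swap (v := ⟨u, _⟩)]
    exact (isAdmissible_replace_iff hlt hgt hu hk (by omega) hi).symm
  · rw [wordF_word (v := ⟨u, _⟩) hu hl' hmu (by simpa using hi),
      Column.word_eq_splitWord (v := ⟨u, _⟩) hu hl, if_neg (by simp [Kind.phi_eq_zero hk])]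
    simp [wordF, wordEps, letterPhi, letterF, hi]
  · rw [wordE_word (v := ⟨u, _⟩) hu hl hmu (by simp),
      Column.word_eq_splitWord (v := ⟨u, _⟩) hu hl',
      if_neg (by simp [Kind.phi_eq_zero hk, Kind.dual, Kind.eps])]
    simp [wordE, wordEps, letterE, hi]
  · simp only [Column.rank, List.map_append, List.sum_append, List.map_cons, List.map_nil,
      List.sum_singleton]
    omega

end InnerColor

theorem colMono_move_last {n : ℕ} {i : Fin n} (hi : i.val + 1 = n) {u l : List ℕ}
    (hlen : u.length + l.length = i.val) :
    colMono n ⟨u, l ++ [n]⟩ = colMono n ⟨u ++ [n], l⟩ - monoA n l.length i := by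
  have hrow : (n : ℤ) - (1 + u.length) = l.length := by omega
  have hrow_succ : (n : ℤ) + 1 - (1 + u.length) = l.length + 1 := by omega
  have hrow_bar : (n : ℤ) - n + (1 + l.length) = l.length + 1 := by omega
  have hpred : n - 1 = i.val := by omega
  have hvarY : varY n l.length (i.val + 2) = 0 := by rw [varY, dif_neg (by omega)]
  rw [monoA_eq, if_pos hi, two_smul]
  simp only [colMono, posSum_append, posSum, boxPos, boxNeg, hrow, hrow_succ, hrow_bar, hpred,
    hvarY, hi]
  abel

theorem isArrow_last {n : ℕ} {i : Fin n} (hi : i.val + 1 = n) {u l : List ℕ}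
    (hu : ∀ x ∈ u, x < n) (hl : ∀ x ∈ l, x < n) (hlen : u.length + l.length = i.val) :
    IsArrow n i ⟨u ++ [n], l⟩ ⟨u, l ++ [n]⟩ l.length := by
  have split_append {s : List ℕ} (hs : ∀ x ∈ s, x < n) : Split n (s ++ [n]) s [n] [] .plus :=
    ⟨by simp, hs, by simp, .left⟩
  have split_self {s : List ℕ} (hs : ∀ x ∈ s, x < n) : Split n s s [] [] .zero :=
    ⟨by simp, hs, by simp, .nil⟩
  refine ⟨isAdmissible_append_last_iff (by omega) hu hl, ?_, ?_, colMono_move_last hi hlen, ?_⟩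
  · rw [hi, wordF_word (v := ⟨_, l⟩) (split_append hu) (split_self hl) (by simp) (by simp),
      if_pos (by simp [Kind.dual, Kind.eps, Kind.phi])]
    simp [wordF, wordEps, letterPhi, letterF, splitWord, pairWord, Column.word]
  · rw [hi, wordE_word (v := ⟨u, _⟩) (split_self hu) (split_append hl) (by simp) (by simp),
      if_neg (by simp [Kind.dual, Kind.eps, Kind.phi])]
    simp [wordE, wordEps, letterE, splitWord, pairWord, Column.word]
  · simp only [Column.rank, List.map_append, List.sum_append, List.map_cons, List.map_nil,
      List.sum_singleton]
    omega

theorem Split.last {n : ℕ} {s s₁ mid s₂ : List ℕ} {k : Kind} (h : Split n s s₁ mid s₂ k)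
    (hs : ∀ x ∈ s, x ≤ n) : s₂ = [] ∧ (mid = [] ∧ k = .zero ∨ mid = [n] ∧ k = .plus) := by
  obtain ⟨rfl, -, hgt, hmid⟩ := h
  refine ⟨List.eq_nil_iff_forall_not_mem.2 fun x hx => ?_, ?_⟩
  · have := hgt x hx
    have := hs x (by simp [hx])
    omega
  · cases hmid with
    | nil => exact .inl ⟨rfl, rfl⟩
    | left => exact .inr ⟨rfl, rfl⟩
    | both | right => exact absurd (hs (n + 1) (by simp)) (by omega)

section Exists

variable {n : ℕ} {i : Fin n} {v : Column} {u₁ mu u₂ l₁ ml l₂ : List ℕ} {k k' : Kind}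
  (hu : Split (i.val + 1) v.u u₁ mu u₂ k) (hl : Split (i.val + 1) v.l l₁ ml l₂ k')

include hu hl

theorem exists_arrow_f_of_lt (hi : i.val + 1 < n) (hne : Kind.pairPhi k k'.dual ≠ 0) :
    ∃ v', IsArrow n i v v'
      (if k = .plus then n - u₁.length - 1 else n - i.val + l₁.length - 1) := by
  obtain ⟨u, l⟩ := v
  by_cases hk : k = .plus
  · have hk' : k' ≠ .plus := by
      rintro rfl
      simp [hk, Kind.pairPhi, Kind.phi, Kind.eps, Kind.dual] at hne
    obtain ⟨rfl, hlt, hgt, hmu⟩ := hu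
    subst hk
    cases hmu
    rw [if_pos rfl]
    exact ⟨_, isArrow_left hi hlt hgt hl hk'⟩
  · have hk' : k' = .minus := by
      rw [Kind.pairPhi, Kind.phi_eq_zero hk] at hne
      cases k' <;> simp [Kind.phi, Kind.dual] at hne ⊢
    obtain ⟨rfl, hlt, hgt, hml⟩ := hl
    subst hk'
    cases hml
    rw [if_neg hk]
    exact ⟨_, isArrow_right hi hu hk hlt hgt⟩

theorem exists_arrow_e_of_lt (hi : i.val + 1 < n) (hne : Kind.pairEps k k'.dual ≠ 0) :
    ∃ v', IsArrow n i v' v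
      (if k'.dual = .minus then n - i.val + l₁.length - 1 else n - u₁.length - 1) := by
  obtain ⟨u, l⟩ := v
  by_cases hk' : k' = .plus
  · have hk : k ≠ .plus := by
      rintro rfl
      simp [hk', Kind.pairEps, Kind.phi, Kind.eps, Kind.dual] at hne
    obtain ⟨rfl, hlt, hgt, hml⟩ := hl
    subst hk'
    cases hml
    simp only [Kind.dual, if_true]
    exact ⟨_, isArrow_right hi hu hk hlt hgt⟩
  · have hk : k = .minus := by
      rw [Kind.pairEps, Kind.eps_dual hk'] at hne
      cases k <;> simp [Kind.eps] at hne ⊢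
    obtain ⟨rfl, hlt, hgt, hmu⟩ := hu
    subst hk
    cases hmu
    rw [if_neg (by cases k' <;> simp [Kind.dual] at hk' ⊢)]
    exact ⟨_, isArrow_left hi hlt hgt hl hk'⟩

theorem exists_arrow_f_last (hv : IsColumn n v) (hi : i.val + 1 = n)
    (hne : Kind.pairPhi k k'.dual ≠ 0) : ∃ v', IsArrow n i v v'
      (if k = .plus then n - u₁.length - 1 else n - i.val + l₁.length - 1) := by
  obtain ⟨u, l⟩ := v
  rw [hi] at hu hl
  obtain ⟨rfl, hmu⟩ := hu.last fun x hx => (hv.2.2.1 x hx).2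
  obtain ⟨rfl, hml⟩ := hl.last fun x hx => (hv.2.2.2.1 x hx).2
  obtain ⟨rfl, hlt, -, -⟩ := hu
  obtain ⟨rfl, hlt', -, -⟩ := hl
  have hlen := hv.2.2.2.2
  obtain ⟨rfl, rfl⟩ | ⟨rfl, rfl⟩ := hmu <;> obtain ⟨rfl, rfl⟩ | ⟨rfl, rfl⟩ := hml <;>
    simp only [Kind.pairPhi, Kind.phi, Kind.eps, Kind.dual, ne_eq, not_true_eq_false,
      add_zero, Nat.sub_self, Nat.sub_zero] at hne
  simp only [List.append_nil, List.length_append, List.length_singleton] at hlen ⊢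
  rw [if_true, show (n : ℤ) - u₁.length - 1 = l₁.length by omega]
  exact ⟨_, isArrow_last hi hlt hlt' (by omega)⟩

theorem exists_arrow_e_last (hv : IsColumn n v) (hi : i.val + 1 = n)
    (hne : Kind.pairEps k k'.dual ≠ 0) : ∃ v', IsArrow n i v' v
      (if k'.dual = .minus then n - i.val + l₁.length - 1 else n - u₁.length - 1) := by
  obtain ⟨u, l⟩ := v
  rw [hi] at hu hl
  obtain ⟨rfl, hmu⟩ := hu.last fun x hx => (hv.2.2.1 x hx).2
  obtain ⟨rfl, hml⟩ := hl.last fun x hx => (hv.2.2.2.1 x hx).2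
  obtain ⟨rfl, hlt, -, -⟩ := hu
  obtain ⟨rfl, hlt', -, -⟩ := hl
  have hlen := hv.2.2.2.2
  obtain ⟨rfl, rfl⟩ | ⟨rfl, rfl⟩ := hmu <;> obtain ⟨rfl, rfl⟩ | ⟨rfl, rfl⟩ := hml <;>
    simp only [Kind.pairEps, Kind.phi, Kind.eps, Kind.dual, ne_eq, not_true_eq_false,
      add_zero, Nat.sub_self, Nat.sub_zero] at hne
  simp only [List.append_nil, List.length_append, List.length_singleton] at hlen ⊢
  rw [Kind.dual, if_pos rfl, show (n : ℤ) - i.val + l₁.length - 1 = l₁.length by omega]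
  exact ⟨_, isArrow_last hi hlt hlt' (by omega)⟩

variable (hv : IsColumn n v)

include hv

theorem IsColumn.exists_arrow_f (hne : Kind.pairPhi k k'.dual ≠ 0) : ∃ v', IsArrow n i v v'
    (if k = .plus then n - u₁.length - 1 else n - i.val + l₁.length - 1) :=
  (Nat.lt_or_eq_of_le (Nat.succ_le_of_lt i.isLt)).elim (exists_arrow_f_of_lt hu hl · hne)
    (exists_arrow_f_last hu hl hv · hne)

theorem IsColumn.exists_arrow_e (hne : Kind.pairEps k k'.dual ≠ 0) : ∃ v', IsArrow n i v' v
    (if k'.dual = .minus then n - i.val + l₁.length - 1 else n - u₁.length - 1) :=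
  (Nat.lt_or_eq_of_le (Nat.succ_le_of_lt i.isLt)).elim (exists_arrow_e_of_lt hu hl · hne)
    (exists_arrow_e_last hu hl hv · hne)

end Exists

/-! ### The crystal of columns in terms of monomials -/

theorem Split.mem_iff {r : ℕ} {s s₁ mid s₂ : List ℕ} {k : Kind} (h : Split r s s₁ mid s₂ k)
    {x : ℕ} (hx : x = r ∨ x = r + 1) : x ∈ s ↔ x ∈ mid := by
  have hx₁ : x ∉ s₁ := fun hmem => by
    have := h.lt x hmem
    omega
  have hx₂ : x ∉ s₂ := fun hmem => by
    have := h.gt x hmem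
    omega
  simp [h.eq, hx₁, hx₂]

theorem Split.eq_plus_iff {r : ℕ} {s s₁ mid s₂ : List ℕ} {k : Kind}
    (h : Split r s s₁ mid s₂ k) : k = .plus ↔ r ∈ s ∧ r + 1 ∉ s := by
  rw [h.mem_iff (.inl rfl), h.mem_iff (.inr rfl)]
  cases h.midKind <;> simp

theorem Split.eq_minus_iff {r : ℕ} {s s₁ mid s₂ : List ℕ} {k : Kind}
    (h : Split r s s₁ mid s₂ k) : k = .minus ↔ r + 1 ∈ s ∧ r ∉ s := by
  rw [h.mem_iff (.inl rfl), h.mem_iff (.inr rfl)]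
  cases h.midKind <;> simp

theorem IsColumn.exists_split {n : ℕ} {v : Column} (hv : IsColumn n v) (r : ℕ) :
    ∃ u₁ mu u₂ k l₁ ml l₂ k', Split r v.u u₁ mu u₂ k ∧ Split r v.l l₁ ml l₂ k' ∧
      (∀ x ∈ mu, x ≤ n) ∧ ∀ x ∈ ml, x ≤ n := by
  obtain ⟨hu_lt, hl_lt, hu_range, hl_range, -⟩ := hv
  obtain ⟨u₁, mu, u₂, k, hu⟩ := TypeC.exists_split r hu_lt
  obtain ⟨l₁, ml, l₂, k', hl⟩ := TypeC.exists_split r hl_lt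
  refine ⟨u₁, mu, u₂, k, l₁, ml, l₂, k', hu, hl, fun x hx => (hu_range x ?_).2,
    fun x hx => (hl_range x ?_).2⟩
  · simp [hu.eq, hx]
  · simp [hl.eq, hx]

namespace IsAdmissible

variable {n : ℕ} {v : Column} (hv : IsAdmissible n v) (i : Fin n)

include hv

theorem monoWt_colMono : monoWt (colMono n v) i = wordWt (i.val + 1) v.word := by
  obtain ⟨_, _, _, _, _, _, _, _, hu, hl, hmu, hml⟩ := hv.1.exists_split (i.val + 1)
  rw [wordWt_word hu hl hmu hml, (hv.hasProfile hu hl).monoWt_eq]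

theorem monoEps_colMono : monoEps i (colMono n v) = wordEps n (i.val + 1) v.word := by
  obtain ⟨_, _, _, _, _, _, _, _, hu, hl, hmu, hml⟩ := hv.1.exists_split (i.val + 1)
  rw [wordEps_word hu hl hmu hml, (hv.hasProfile hu hl).monoEps_eq]

theorem monoPhi_colMono : monoPhi i (colMono n v) = wordPhi n (i.val + 1) v.word := by
  obtain ⟨_, _, _, _, _, _, _, _, hu, hl, hmu, hml⟩ := hv.1.exists_split (i.val + 1)
  rw [wordPhi_word hu hl hmu hml, (hv.hasProfile hu hl).monoPhi_eq]

variable {i}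

theorem exists_arrow_e (hne : wordEps n (i.val + 1) v.word ≠ 0) :
    ∃ v', IsArrow n i v' v (monoNe i (colMono n v)) := by
  obtain ⟨_, _, _, _, _, _, _, _, hu, hl, hmu, hml⟩ := hv.1.exists_split (i.val + 1)
  rw [wordEps_word hu hl hmu hml] at hne
  rw [(hv.hasProfile hu hl).monoNe_eq hne]
  exact hv.1.exists_arrow_e hu hl hne

theorem exists_arrow_f (hne : wordPhi n (i.val + 1) v.word ≠ 0) :
    ∃ v', IsArrow n i v v' (monoNf i (colMono n v)) := by
  obtain ⟨_, _, _, _, _, _, _, _, hu, hl, hmu, hml⟩ := hv.1.exists_split (i.val + 1)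
  rw [wordPhi_word hu hl hmu hml] at hne
  rw [(hv.hasProfile hu hl).monoNf_eq hne]
  exact hv.1.exists_arrow_f hu hl hne

end IsAdmissible

theorem Column.ofWord_word (v : Column) : Column.ofWord v.word = v := by
  obtain ⟨u, l⟩ := v
  simp [Column.ofWord, Column.word, List.filterMap_append, List.filterMap_reverse]

theorem toAdmissible_word {n : ℕ} (b : AdmissibleColumn n) :
    toAdmissible n b.val.word = some b := by
  simp [toAdmissible, Column.ofWord_word, b.2]

theorem IsArrow.columnCrystal_e {n : ℕ} {i : Fin n} {b b' : AdmissibleColumn n} {m : ℤ}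
    (h : IsArrow n i b.val b'.val m) : (columnCrystal n).e i b' = some b := by
  simp only [columnCrystal, h.wordE_eq, Option.bind_some, toAdmissible_word]

theorem IsArrow.columnCrystal_f {n : ℕ} {i : Fin n} {b b' : AdmissibleColumn n} {m : ℤ}
    (h : IsArrow n i b.val b'.val m) : (columnCrystal n).f i b = some b' := by
  simp only [columnCrystal, h.wordF_eq, Option.bind_some, toAdmissible_word]

theorem columnCrystal_e_eq_none {n : ℕ} {i : Fin n} {b : AdmissibleColumn n}
    (h : wordEps n (i.val + 1) b.val.word = 0) : (columnCrystal n).e i b = none := by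
  simp only [columnCrystal, wordE_eq_none h, Option.bind_none]

theorem columnCrystal_f_eq_none {n : ℕ} {i : Fin n} {b : AdmissibleColumn n}
    (h : wordPhi n (i.val + 1) b.val.word = 0) : (columnCrystal n).f i b = none := by
  simp only [columnCrystal, wordF_eq_none h, Option.bind_none]

theorem monomialCrystal_e_colMono {n : ℕ} (i : Fin n) (b : AdmissibleColumn n) :
    (monomialCrystal n).e i (colMono n b.val) =
      ((columnCrystal n).e i b).map fun b => colMono n b.val := by
  by_cases h : wordEps n (i.val + 1) b.val.word = 0
  · rw [columnCrystal_e_eq_none h, Option.map_none]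
    exact if_neg (by simp [b.2.monoEps_colMono, h])
  · obtain ⟨v, hv⟩ := b.2.exists_arrow_e h
    rw [hv.columnCrystal_e (b := ⟨v, hv.admissible_iff.2 b.2⟩), Option.map_some]
    refine (if_pos (by simpa [b.2.monoEps_colMono] using Nat.pos_of_ne_zero h)).trans ?_
    exact congrArg some (eq_sub_iff_add_eq.1 hv.colMono_eq)

theorem monomialCrystal_f_colMono {n : ℕ} (i : Fin n) (b : AdmissibleColumn n) :
    (monomialCrystal n).f i (colMono n b.val) =
      ((columnCrystal n).f i b).map fun b => colMono n b.val := by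
  by_cases h : wordPhi n (i.val + 1) b.val.word = 0
  · rw [columnCrystal_f_eq_none h, Option.map_none]
    exact if_neg (by simp [b.2.monoPhi_colMono, h])
  · obtain ⟨v, hv⟩ := b.2.exists_arrow_f h
    rw [hv.columnCrystal_f (b' := ⟨v, hv.admissible_iff.1 b.2⟩), Option.map_some, hv.colMono_eq]
    exact if_pos (by simpa [b.2.monoPhi_colMono] using Nat.pos_of_ne_zero h)

/-! ### Highest weight crystals -/

/-- A crystal that is generated by the operators `f̃_i` from the vector `b₀`, which all `ẽ_i`
annihilate. -/
structure CrystalData.IsHighestWeight {I B : Type*} (C : CrystalData I B) (b₀ : B) : Prop where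
  e_eq_none : ∀ i, C.e i b₀ = none
  f_of_e : ∀ {i b b'}, C.e i b = some b' → C.f i b' = some b
  path : ∀ b, Relation.ReflTransGen (fun b b' => ∃ i, C.e i b = some b') b b₀

namespace CrystalData.IsHighestWeight

variable {I B B' : Type*} {C : CrystalData I B} {b₀ : B} (hC : C.IsHighestWeight b₀)
  {C' : CrystalData I B'}

include hC

theorem injective {m : B → B'} (hm : ∀ i b, C'.e i (m b) = (C.e i b).map m) :
    Function.Injective m := by
  intro b
  induction hC.path b using Relation.ReflTransGen.head_induction_on with
  | refl =>
    intro b' h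
    rcases (hC.path b').cases_head with rfl | ⟨c, ⟨i, hc⟩, -⟩
    · rfl
    · have := hm i b'
      rw [← h, hm, hC.e_eq_none, hc] at this
      simp at this
  | @head b c hbc _ ih =>
    intro b' h
    obtain ⟨i, hc⟩ := hbc
    have he : (C.e i b').map m = some (m c) := by rw [← hm, ← h, hm, hc, Option.map_some]
    obtain ⟨c', hc', hcc'⟩ := Option.map_eq_some_iff.1 he
    obtain rfl := ih hcc'.symm
    exact Option.some.inj ((hC.f_of_e hc).symm.trans (hC.f_of_e hc'))

theorem map_unique {m m' : B → B'} (hm : ∀ i b, C'.f i (m b) = (C.f i b).map m)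
    (hm' : ∀ i b, C'.f i (m' b) = (C.f i b).map m') (h₀ : m b₀ = m' b₀) : m = m' := by
  funext b
  induction hC.path b using Relation.ReflTransGen.head_induction_on with
  | refl => exact h₀
  | @head b c hbc _ ih =>
    obtain ⟨i, hc⟩ := hbc
    have hf := hm i c
    rw [ih, hm', hC.f_of_e hc] at hf
    exact (Option.some.inj hf).symm

end CrystalData.IsHighestWeight

theorem le_length_of_last_mem {n : ℕ} {u : List ℕ} (hn : n ∈ u)
    (hgap : ∀ r, 1 ≤ r → r + 1 ∈ u → r ∈ u) : n ≤ u.length := by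
  have hmem : ∀ r, 1 ≤ r → r ≤ n → r ∈ u := fun r hr hrn =>
    Nat.decreasingInduction' (P := (· ∈ u)) (fun k _ hrk hk => hgap k (hr.trans hrk) hk) hrn hn
  have hsub : Finset.Icc 1 n ⊆ u.toFinset := fun r hr =>
    List.mem_toFinset.2 (hmem r (Finset.mem_Icc.1 hr).1 (Finset.mem_Icc.1 hr).2)
  simpa using (Finset.card_le_card hsub).trans u.toFinset_card_le

theorem IsAdmissible.mem_last {n : ℕ} {v : Column} (hv : IsAdmissible n v) (hn : 0 < n) :
    n ∈ v.u ∨ n ∈ v.l := by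
  by_contra! h
  have hcnt := (isAdmissible_iff.1 hv).2 (n - 1)
  obtain ⟨-, -, hu_range, hl_range, hlen⟩ := hv.1
  rw [cnt_of_le fun x hx => Nat.le_sub_one_of_lt ((hu_range x hx).2.lt_of_ne
      (ne_of_mem_of_not_mem hx h.1)),
    cnt_of_le fun x hx => Nat.le_sub_one_of_lt ((hl_range x hx).2.lt_of_ne
      (ne_of_mem_of_not_mem hx h.2))] at hcnt
  omega

theorem IsColumn.wordEps_ne_zero_of_gap {n r : ℕ} {v : Column} (hv : IsColumn n v)
    (hr : r + 1 ∈ v.u) (hr' : r ∉ v.u) : wordEps n r v.word ≠ 0 := by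
  obtain ⟨_, _, _, _, _, _, _, _, hu, hl, hmu, hml⟩ := hv.exists_split r
  rw [wordEps_word hu hl hmu hml, hu.eq_minus_iff.2 ⟨hr, hr'⟩]
  simp [Kind.pairEps, Kind.eps]

theorem IsColumn.wordEps_ne_zero_of_last {n : ℕ} {v : Column} (hv : IsColumn n v)
    (hu_last : n ∉ v.u) (hl_last : n ∈ v.l) : wordEps n n v.word ≠ 0 := by
  obtain ⟨_, _, _, _, _, _, _, _, hu, hl, hmu, hml⟩ := hv.exists_split n
  have hsucc : n + 1 ∉ v.l := fun h => absurd (hv.2.2.2.1 _ h).2 (by omega)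
  rw [wordEps_word hu hl hmu hml, hl.eq_plus_iff.2 ⟨hl_last, hsucc⟩, Kind.pairEps,
    Kind.phi_eq_zero fun h => hu_last (hu.eq_plus_iff.1 h).1]
  simp [Kind.dual, Kind.eps]

theorem IsAdmissible.exists_wordEps_ne_zero {n : ℕ} {v : Column} (hv : IsAdmissible n v)
    (hl : v.l ≠ []) : ∃ i : Fin n, wordEps n (i.val + 1) v.word ≠ 0 := by
  obtain ⟨-, -, hu_range, -, hlen⟩ := hv.1
  have hlen_pos : 0 < v.l.length := List.length_pos_of_ne_nil hl
  by_cases hgap : ∃ r, 1 ≤ r ∧ r + 1 ∈ v.u ∧ r ∉ v.u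
  · obtain ⟨r, hr, hmem, hnmem⟩ := hgap
    have hrn := (hu_range _ hmem).2
    refine ⟨⟨r - 1, by omega⟩, ?_⟩
    simpa only [Nat.sub_add_cancel hr] using hv.1.wordEps_ne_zero_of_gap hmem hnmem
  · push Not at hgap
    have hu_last : n ∉ v.u := fun h => by
      have := le_length_of_last_mem h hgap
      omega
    refine ⟨⟨n - 1, by omega⟩, ?_⟩
    simpa only [Nat.sub_add_cancel (show 1 ≤ n by omega)] using
      hv.1.wordEps_ne_zero_of_last hu_last ((hv.mem_last (by omega)).resolve_left hu_last)

theorem wordEps_highestColumn {n : ℕ} (i : Fin n) :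
    wordEps n (i.val + 1) (highestColumn n).val.word = 0 := by
  obtain ⟨_, _, _, k, _, _, _, k', hu, hl, hmu, hml⟩ :=
    (highestColumn n).2.1.exists_split (i.val + 1)
  have hk : k ≠ .minus := fun h =>
    (hu.eq_minus_iff.1 h).2 (List.mem_range'_1.2 ⟨by omega, by omega⟩)
  have hk' : k' ≠ .plus := fun h => List.not_mem_nil (hl.eq_plus_iff.1 h).1
  rw [wordEps_word hu hl hmu hml, Kind.pairEps, Kind.eps_dual hk', Nat.zero_sub, add_zero]
  cases k <;> first | rfl | exact absurd rfl hk

theorem columnCrystal_isHighestWeight (n : ℕ) :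
    (columnCrystal n).IsHighestWeight (highestColumn n) where
  e_eq_none i := columnCrystal_e_eq_none (wordEps_highestColumn i)
  f_of_e {i b b'} h := by
    have hne : wordEps n (i.val + 1) b.val.word ≠ 0 := fun h₀ => by
      rw [columnCrystal_e_eq_none h₀] at h
      cases h
    obtain ⟨v, hv⟩ := b.2.exists_arrow_e hne
    rw [hv.columnCrystal_e (b := ⟨v, hv.admissible_iff.2 b.2⟩), Option.some.injEq] at h
    subst h
    exact hv.columnCrystal_f
  path b := by
    induction hrank : b.val.rank n using Nat.strong_induction_on generalizing b with
    | _ N ih =>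
      by_cases hb : b = highestColumn n
      · rw [hb]
      · rw [eq_highestColumn_iff] at hb
        obtain ⟨i, hi⟩ := b.2.exists_wordEps_ne_zero hb
        obtain ⟨v, hv⟩ := b.2.exists_arrow_e hi
        let b' : AdmissibleColumn n := ⟨v, hv.admissible_iff.2 b.2⟩
        exact (ih _ (hrank ▸ hv.rank_lt) b' rfl).head ⟨i, hv.columnCrystal_e (b := b')⟩

theorem isCrystalEmbedding_colMono (n : ℕ) :
    IsCrystalEmbedding (columnCrystal n) (monomialCrystal n) fun b => colMono n b.val where
  injective := (columnCrystal_isHighestWeight n).injective monomialCrystal_e_colMono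
  wt_eq b := funext b.2.monoWt_colMono
  eps_eq i b := b.2.monoEps_colMono i
  phi_eq i b := b.2.monoPhi_colMono i
  e_eq := monomialCrystal_e_colMono
  f_eq := monomialCrystal_f_colMono

theorem colMono_highestColumn {n : ℕ} (hn : 0 < n) :
    colMono n (highestColumn n).val = monoVar n 0 (lastIdx n hn) := by
  have hbox : ∀ t ∈ Finset.range n, boxPos n (1 + t) (1 + t) =
      varY n (n - (t + 1 : ℕ)) (t + 1) - varY n (n - t) t := by
    intro t _
    rw [boxPos, show (n : ℤ) - (1 + t) = n - (t + 1 : ℕ) by push_cast; ring,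
      show (n : ℤ) + 1 - (1 + t) = n - t by ring, Nat.add_sub_cancel_left, add_comm 1 t]
  calc colMono n (highestColumn n).val = ∑ t ∈ Finset.range n, boxPos n (1 + t) (1 + t) := by
        simp [colMono, highestColumn, posSum, posSum_range']
    _ = varY n (n - n) n - varY n (n - (0 : ℕ)) 0 := by
        rw [Finset.sum_congr rfl hbox,
          Finset.sum_range_sub (fun t : ℕ => varY n ((n : ℤ) - (t : ℤ)) t)]
    _ = monoVar n 0 (lastIdx n hn) := by
        rw [sub_self, varY, dif_pos ⟨hn, le_rfl⟩, varY, dif_neg (by omega), sub_zero]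
        rfl

theorem IsCrystalEmbedding.eq_colMono {n : ℕ} {hn : 0 < n}
    {m : AdmissibleColumn n → LaurentMonomial n}
    (h : IsCrystalEmbedding (columnCrystal n) (monomialCrystal n) m)
    (h₀ : m (highestColumn n) = monoVar n 0 (lastIdx n hn)) : m = fun b => colMono n b.val :=
  (columnCrystal_isHighestWeight n).map_unique h.f_eq monomialCrystal_f_colMono
    (h₀.trans (colMono_highestColumn hn).symm)

/-! ### The Weyl group as a group of signed permutations -/

section SignedPermutations

variable {n : ℕ}

/-- The action of the simple reflection `s_i` on the coordinates of a weight with respect to the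
basis `ε_1, …, ε_n`, where `ε_k = Λ_k - Λ_{k-1}`. The coordinate of `ε_{k+1}` is `x k`; only the
values `x k` with `k < n` matter. -/
def signedAct (i : Fin n) (x : ℕ → ℤ) : ℕ → ℤ :=
  if i.val + 1 < n then x ∘ Equiv.swap i.val (i.val + 1) else Function.update x i (-x i)

theorem signedAct_of_lt {i : Fin n} (h : i.val + 1 < n) (x : ℕ → ℤ) :
    signedAct i x = x ∘ Equiv.swap i.val (i.val + 1) :=
  if_pos h

theorem signedAct_last {i : Fin n} (h : i.val + 1 = n) (x : ℕ → ℤ) :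
    signedAct i x = Function.update x i (-x i) :=
  if_neg h.not_lt

/-- The action of the Weyl group element with word `w` on coordinates. -/
def wordAct (w : List (Fin n)) (x : ℕ → ℤ) : ℕ → ℤ := w.foldr signedAct x

theorem wordAct_cons (i : Fin n) (w : List (Fin n)) (x : ℕ → ℤ) :
    wordAct (i :: w) x = signedAct i (wordAct w x) := rfl

theorem wordAct_append (v w : List (Fin n)) (x : ℕ → ℤ) :
    wordAct (v ++ w) x = wordAct v (wordAct w x) :=
  List.foldr_append

/-- The weight with coordinates `x`, in the basis of fundamental weights. -/
def toWeight (n : ℕ) (x : ℕ → ℤ) : Fin n → ℤ := fun j =>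
  x j.val - if j.val + 1 < n then x (j.val + 1) else 0

theorem simpleReflection_toWeight (i : Fin n) (x : ℕ → ℤ) :
    simpleReflection n i (toWeight n x) = toWeight n (signedAct i x) := by
  funext j
  have hi := i.2
  have hj := j.2
  have hij : j = i ↔ j.val = i.val := Fin.ext_iff
  by_cases h : i.val + 1 < n
  · simp only [simpleReflection, toWeight, cartan, signedAct_of_lt h, hij, Function.comp_apply,
      Equiv.swap_apply_def]
    grind
  · have hlast : i.val + 1 = n := by omega
    simp only [simpleReflection, toWeight, cartan, signedAct_last hlast, hij,
      Function.update_apply]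
    grind

theorem weylOf_toWeight (w : List (Fin n)) (x : ℕ → ℤ) :
    weylOf n w (toWeight n x) = toWeight n (wordAct w x) := by
  induction w with
  | nil => rfl
  | cons i w ih => exact (congrArg _ ih).trans (simpleReflection_toWeight i _)

theorem toWeight_injOn {x y : ℕ → ℤ} (h : toWeight n x = toWeight n y) {k : ℕ} (hk : k < n) :
    x k = y k := by
  induction Nat.le_sub_one_of_lt hk using Nat.decreasingInduction with
  | self =>
    have hlast := congrFun h ⟨n - 1, by omega⟩
    simpa [toWeight, show ¬ n - 1 + 1 < n by omega] using hlast
  | of_succ k hk' ih =>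
    have hcoord := congrFun h ⟨k, by omega⟩
    simp only [toWeight, show k + 1 < n by omega, if_true] at hcoord
    linarith [ih (by omega)]

theorem simpleReflection_involutive (i : Fin n) : Function.Involutive (simpleReflection n i) := by
  intro lam
  funext j
  have hii : cartan n i i = 2 := if_pos rfl
  simp only [simpleReflection, hii]
  ring

theorem drop_finRange {k : ℕ} (hk : k < n) :
    (List.finRange n).drop k = ⟨k, hk⟩ :: (List.finRange n).drop (k + 1) := by
  rw [List.drop_eq_getElem_cons (by simpa using hk)]
  simp

theorem exists_finRange_eq_append (hn : 0 < n) :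
    ∃ w : List (Fin n), List.finRange n = w ++ [lastIdx n hn] ∧ ∀ i ∈ w, i.val + 1 < n := by
  obtain ⟨n, rfl⟩ := Nat.exists_eq_succ_of_ne_zero hn.ne'
  refine ⟨_, List.finRange_succ_last, ?_⟩
  simp

theorem wordAct_drop_finRange {k : ℕ} (hk : k ≤ n) (x : ℕ → ℤ) :
    wordAct ((List.finRange n).drop k) x = fun j =>
      if j < k ∨ n ≤ j then x j else if j = k then -x (n - 1) else x (j - 1) := by
  induction hk using Nat.decreasingInduction with
  | self =>
    funext j
    rw [List.drop_eq_nil_of_le (by simp), if_pos (lt_or_ge j n)]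
    rfl
  | of_succ k hk ih =>
    rw [drop_finRange hk, wordAct_cons, ih]
    funext j
    by_cases h : k + 1 < n
    · simp only [signedAct_of_lt (i := ⟨k, hk⟩) h, Function.comp_apply, Equiv.swap_apply_def]
      grind
    · simp only [signedAct_last (i := ⟨k, hk⟩) (by simp only; omega), Function.update_apply]
      grind

/-- The action of the Coxeter element `s_1 ⋯ s_n` on coordinates. -/
def coxeterAct (n : ℕ) (x : ℕ → ℤ) : ℕ → ℤ := fun k =>
  if n ≤ k then x k else if k = 0 then -x (n - 1) else x (k - 1)

theorem wordAct_finRange (x : ℕ → ℤ) : wordAct (List.finRange n) x = coxeterAct n x := by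
  have hdrop := wordAct_drop_finRange n.zero_le x
  simp only [List.drop_zero, Nat.not_lt_zero, false_or] at hdrop
  exact hdrop

theorem coxeterAct_iterate (x : ℕ → ℤ) {p : ℕ} (hp : p ≤ n) :
    (coxeterAct n)^[p] x = fun k =>
      if n ≤ k then x k else if k < p then -x (k + n - p) else x (k - p) := by
  induction p with
  | zero =>
    funext k
    simp
  | succ p ih =>
    rw [Function.iterate_succ_apply', ih (by omega)]
    funext k
    simp only [coxeterAct]
    grind

theorem wordAct_longestWord (x : ℕ → ℤ) :
    wordAct (longestWord n) x = fun k => if n ≤ k then x k else -x k := by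
  have hflatMap (l : List (Fin n)) :
      wordAct (l.flatMap fun _ => List.finRange n) x = (coxeterAct n)^[l.length] x := by
    induction l with
    | nil => rfl
    | cons _ l ih =>
      rw [List.flatMap_cons, wordAct_append, ih, wordAct_finRange, List.length_cons,
        Function.iterate_succ_apply']
  rw [longestWord, hflatMap, List.length_finRange, coxeterAct_iterate x le_rfl]
  funext k
  grind

theorem exists_longestWord_eq_append (hn : 0 < n) :
    ∃ w : List (Fin n), longestWord n = w ++ [lastIdx n hn] ∧ w.length + 1 = n * n := by
  obtain ⟨v, hv, -⟩ := exists_finRange_eq_append hn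
  obtain ⟨w, hw⟩ : ∃ w, longestWord n = w ++ [lastIdx n hn] := by
    refine ⟨(v.flatMap fun _ => List.finRange n) ++ v, ?_⟩
    rw [longestWord]
    conv_lhs => rw [hv, List.flatMap_append, List.flatMap_singleton, ← hv]
    rw [List.append_assoc, ← hv]
  refine ⟨w, hw, ?_⟩
  have hlength := congrArg List.length hw
  simpa [longestWord, eq_comm] using hlength

/-! ### Inversions and signs -/

/-- The inversions for the short roots `ε_p - e ε_q`, `e = ±1`: the triples `(p, q, e)` for which
the root is negative on `x`. -/
def shortInv (n : ℕ) (x : ℕ → ℤ) : Finset (ℕ × ℕ × ℤ) :=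
  {t ∈ Finset.range n ×ˢ Finset.range n ×ˢ {1, -1} | t.1 < t.2.1 ∧ x t.1 < t.2.2 * x t.2.1}

theorem mem_shortInv {x : ℕ → ℤ} {p q : ℕ} {e : ℤ} :
    (p, q, e) ∈ shortInv n x ↔ p < q ∧ q < n ∧ (e = 1 ∨ e = -1) ∧ x p < e * x q := by
  simp only [shortInv, Finset.mem_filter, Finset.mem_product, Finset.mem_range,
    Finset.mem_insert, Finset.mem_singleton]
  grind

theorem card_shortInv_signedAct_of_lt {i : Fin n} (hi : i.val + 1 < n) (x : ℕ → ℤ) :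
    (shortInv n (signedAct i x)).card ≤ (shortInv n x).card + 1 := by
  let f : ℕ × ℕ × ℤ → ℕ × ℕ × ℤ := fun t =>
    if t.1 = i ∧ t.2.1 = i + 1 then t
    else (Equiv.swap i.val (i + 1) t.1, Equiv.swap i.val (i + 1) t.2.1, t.2.2)
  suffices ((shortInv n (signedAct i x)).erase (i, i + 1, 1)).card ≤ (shortInv n x).card from
    (Nat.sub_le_iff_le_add.1 Finset.pred_card_le_card_erase).trans (Nat.add_le_add_right this 1)
  refine Finset.card_le_card_of_injOn f ?_ ?_
  · rintro ⟨p, q, e⟩ ht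
    simp only [Finset.coe_erase, Set.mem_sdiff, Finset.mem_coe, Set.mem_singleton_iff,
      Prod.mk.injEq, mem_shortInv, signedAct_of_lt hi, Function.comp_apply] at ht
    obtain ⟨⟨hpq, hq, he, hlt⟩, hne⟩ := ht
    rw [Finset.mem_coe]
    by_cases hc : p = i ∧ q = i + 1
    · obtain ⟨rfl, rfl⟩ := hc
      obtain rfl : e = -1 := he.resolve_left fun h => hne ⟨rfl, rfl, h⟩
      simp only [f, and_self, if_true, mem_shortInv]
      rw [Equiv.swap_apply_left, Equiv.swap_apply_right] at hlt
      exact ⟨hpq, hq, Or.inr trivial, by linarith⟩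
    · simp only [f, hc, if_false, mem_shortInv]
      refine ⟨?_, ?_, he, hlt⟩ <;> simp only [Equiv.swap_apply_def] <;> grind
  · rintro ⟨p, q, e⟩ ht ⟨p', q', e'⟩ ht' h
    rw [Finset.mem_coe, Finset.mem_erase, mem_shortInv] at ht ht'
    simp only [f, Equiv.swap_apply_def] at h
    split_ifs at h <;> simp only [Prod.mk.injEq] at h ⊢ <;> omega

theorem card_shortInv_signedAct_last {i : Fin n} (hi : i.val + 1 = n) (x : ℕ → ℤ) :
    (shortInv n (signedAct i x)).card ≤ (shortInv n x).card := by
  refine Finset.card_le_card_of_injOn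
    (fun t => (t.1, t.2.1, if t.2.1 = i then -t.2.2 else t.2.2)) ?_ ?_
  · rintro ⟨p, q, e⟩ ht
    simp only [Finset.mem_coe, mem_shortInv, signedAct_last hi, Function.update_apply] at ht ⊢
    grind
  · rintro ⟨p, q, e⟩ - ⟨p', q', e'⟩ - h
    grind

theorem card_shortInv_wordAct (w : List (Fin n)) (x : ℕ → ℤ) :
    (shortInv n (wordAct w x)).card ≤
      (shortInv n x).card + w.countP fun i => i.val + 1 < n := by
  induction w with
  | nil => simp [wordAct]
  | cons i w ih =>
    rw [wordAct_cons, List.countP_cons]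
    by_cases hi : i.val + 1 < n
    · have := card_shortInv_signedAct_of_lt hi (wordAct w x)
      simp only [hi, decide_true, if_true]
      omega
    · have := card_shortInv_signedAct_last (i := i) (by omega) (wordAct w x)
      omega

/-- The number of negative coordinates. -/
def negCount (n : ℕ) (x : ℕ → ℤ) : ℕ := {k ∈ Finset.range n | x k < 0}.card

theorem negCount_signedAct_of_lt {i : Fin n} (hi : i.val + 1 < n) (x : ℕ → ℤ) :
    negCount n (signedAct i x) = negCount n x := by
  let σ := Equiv.swap i.val (i.val + 1)
  refine Finset.card_nbij' σ σ ?_ ?_ (fun k _ => Equiv.swap_apply_self _ _ k)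
    fun k _ => Equiv.swap_apply_self _ _ k <;>
  · intro k
    simp only [σ, Finset.coe_filter, Finset.mem_range, Set.mem_ofPred_eq, signedAct_of_lt hi,
      Function.comp_apply, Equiv.swap_apply_def]
    grind

theorem negCount_signedAct_last {i : Fin n} (hi : i.val + 1 = n) {x : ℕ → ℤ} (hx : x i ≠ 0) :
    negCount n (signedAct i x) + 2 * (if x i < 0 then 1 else 0) = negCount n x + 1 := by
  have hsplit (y : ℕ → ℤ) : negCount n y =
      {k ∈ Finset.range i | y k < 0}.card + if y i < 0 then 1 else 0 := by
    have hrange : Finset.range n = insert i.val (Finset.range i) := by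
      rw [← Finset.range_add_one, hi]
    rw [negCount, hrange, Finset.filter_insert]
    split_ifs
    · rw [Finset.card_insert_of_notMem (by simp)]
    · rfl
  have hfilter : {k ∈ Finset.range i | signedAct i x k < 0} = {k ∈ Finset.range i | x k < 0} :=
    Finset.filter_congr fun k hk => by
      rw [signedAct_last hi, Function.update_of_ne (Finset.mem_range.1 hk).ne]
  rw [hsplit, hsplit x, hfilter, signedAct_last hi, Function.update_self]
  grind

/-- The number of letters `s_n` of a word that are applied to a vector with negative last
coordinate. -/
def negFlipCount (x : ℕ → ℤ) : List (Fin n) → ℕ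
  | [] => 0
  | i :: w => negFlipCount x w + if i.val + 1 = n ∧ wordAct w x i < 0 then 1 else 0

theorem wordAct_ne_zero {x : ℕ → ℤ} (hx : ∀ k < n, x k ≠ 0) (w : List (Fin n)) :
    ∀ k < n, wordAct w x k ≠ 0 := by
  induction w with
  | nil => exact hx
  | cons i w ih =>
    intro k hk
    rw [wordAct_cons]
    by_cases hi : i.val + 1 < n
    · rw [signedAct_of_lt hi, Function.comp_apply, Equiv.swap_apply_def]
      grind
    · rw [signedAct_last (by omega), Function.update_apply]
      grind

theorem negCount_wordAct {x : ℕ → ℤ} (hx : ∀ k < n, x k ≠ 0) (w : List (Fin n)) :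
    negCount n (wordAct w x) + 2 * negFlipCount x w =
      negCount n x + w.countP fun i => ¬ i.val + 1 < n := by
  induction w with
  | nil => simp [wordAct, negFlipCount]
  | cons i w ih =>
    rw [wordAct_cons, List.countP_cons, negFlipCount]
    by_cases hi : i.val + 1 < n
    · rw [negCount_signedAct_of_lt hi, if_neg (by omega), if_neg (by simpa using hi)]
      omega
    · have hlast : i.val + 1 = n := by omega
      have := negCount_signedAct_last hlast (wordAct_ne_zero hx w i i.2)
      simp only [hlast, true_and, lt_self_iff_false, not_false_eq_true, decide_true, if_true]
      omega

/-- The coordinates of the half sum of the positive roots, a regular dominant weight. -/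
def rhoVec (n : ℕ) : ℕ → ℤ := fun k => n - k

/-- The image of `rhoVec n` under `w_0 s_n`. -/
def lowVec (n : ℕ) : ℕ → ℤ := fun k => if k + 1 < n then k - n else n - k

theorem rhoVec_pos {k : ℕ} (hk : k < n) : 0 < rhoVec n k := by
  rw [rhoVec]
  omega

theorem lowVec_neg_iff {k : ℕ} (hk : k < n) : lowVec n k < 0 ↔ k + 1 < n := by
  rw [lowVec]
  split_ifs <;> omega

theorem shortInv_rhoVec : shortInv n (rhoVec n) = ∅ := by
  rw [Finset.eq_empty_iff_forall_notMem]
  rintro ⟨p, q, e⟩ h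
  rw [mem_shortInv, rhoVec, rhoVec] at h
  obtain ⟨hpq, hq, rfl | rfl, hlt⟩ := h <;> omega

theorem le_card_shortInv_lowVec : n * n - n ≤ (shortInv n (lowVec n)).card := by
  have hoffDiag := Finset.offDiag_card (Finset.range n)
  rw [Finset.card_range] at hoffDiag
  rw [← hoffDiag]
  refine Finset.card_le_card_of_injOn
    (fun t => if t.1 < t.2 then (t.1, t.2, 1) else (t.2, t.1, -1)) ?_ ?_
  · rintro ⟨p, q⟩ ht
    simp only [Finset.coe_offDiag, Set.mem_offDiag, Finset.coe_range, Set.mem_Iio] at ht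
    simp only [Finset.mem_coe]
    split_ifs with hpq <;> rw [mem_shortInv, lowVec, lowVec] <;> grind
  · rintro ⟨p, q⟩ - ⟨p', q'⟩ - h
    grind

theorem negCount_rhoVec : negCount n (rhoVec n) = 0 := by
  rw [negCount, Finset.card_eq_zero, Finset.filter_eq_empty_iff]
  exact fun k hk => (rhoVec_pos (Finset.mem_range.1 hk)).not_gt

theorem negCount_lowVec : negCount n (lowVec n) = n - 1 := by
  have hfilter : {k ∈ Finset.range n | lowVec n k < 0} = Finset.range (n - 1) := by
    ext k
    rw [Finset.mem_filter, Finset.mem_range, Finset.mem_range]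
    refine ⟨fun h => ?_, fun h => ⟨by omega, (lowVec_neg_iff (by omega)).2 (by omega)⟩⟩
    have := (lowVec_neg_iff h.1).1 h.2
    omega
  rw [negCount, hfilter, Finset.card_range]

theorem shortInv_congr {x y : ℕ → ℤ} (h : ∀ k < n, x k = y k) : shortInv n x = shortInv n y :=
  Finset.filter_congr fun t ht => by
    simp only [Finset.mem_product, Finset.mem_range] at ht
    rw [h _ ht.1, h _ ht.2.1]

theorem negCount_congr {x y : ℕ → ℤ} (h : ∀ k < n, x k = y k) : negCount n x = negCount n y :=
  congrArg Finset.card <| Finset.filter_congr fun k hk => by rw [h k (Finset.mem_range.1 hk)]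

variable {hn : 0 < n} {u : List (Fin n)}

theorem wordAct_rhoVec (hu : weylOf n u = weylOf n (longestWord n ++ [lastIdx n hn])) {k : ℕ}
    (hk : k < n) : wordAct u (rhoVec n) k = lowVec n k := by
  have hweight := congrFun hu (toWeight n (rhoVec n))
  rw [weylOf_toWeight, weylOf_toWeight, wordAct_append, wordAct_longestWord] at hweight
  rw [toWeight_injOn hweight hk, wordAct_cons, signedAct_last (by simp only [lastIdx]; omega)]
  simp only [wordAct, List.foldr_nil, Function.update_apply, lastIdx, rhoVec, lowVec]
  grind

/-- The element `w_0 s_n` has `n(n - 1)` short inversions and makes `n - 1` coordinates of `ρ`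
negative, so a word of length `n² - 1` has no letter to spare for making a coordinate positive
again. -/
theorem negFlipCount_eq_zero (hred : IsReducedWord n u)
    (hu : weylOf n u = weylOf n (longestWord n ++ [lastIdx n hn])) :
    negFlipCount (rhoVec n) u = 0 := by
  obtain ⟨w, hw, hw_length⟩ := exists_longestWord_eq_append hn
  have hlength : u.length ≤ w.length := hred w <| by
    rw [hu, hw]
    funext lam
    simp [weylOf, simpleReflection_involutive _ _]
  have hshort := card_shortInv_wordAct u (rhoVec n)
  have hneg := negCount_wordAct (fun k hk => (rhoVec_pos hk).ne') u
  rw [shortInv_congr fun _ => wordAct_rhoVec hu, shortInv_rhoVec, Finset.card_empty] at hshort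
  rw [negCount_congr fun _ => wordAct_rhoVec hu, negCount_rhoVec, negCount_lowVec] at hneg
  have hcount := List.length_eq_countP_add_countP (l := u) fun i => i.val + 1 < n
  have hinv := le_card_shortInv_lowVec (n := n)
  have hsq := Nat.le_mul_self n
  simp only [decide_eq_true_eq] at hcount
  omega

end SignedPermutations

section SimpleReflectionLifts

variable {n : ℕ} {i : Fin n}

/-! ### Rows of products with representatives of simple reflections -/

theorem fMat_mul_inl (i : Fin n) (g : Matrix (BasisIdx n) (Fin n) ℂ) (a c : Fin n) :
    (fMat n i * g) (.inl a) c = if a.val = i.val + 1 then g (.inl i) c else 0 := by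
  simp [Matrix.mul_apply, fMat, ite_and]

theorem fMat_mul_inr_of_lt (hi : i.val + 1 < n) (g : Matrix (BasisIdx n) (Fin n) ℂ)
    (a c : Fin n) :
    (fMat n i * g) (.inr a) c = if a = i then g (.inr ⟨i.val + 1, hi⟩) c else 0 := by
  have hsucc (b : Fin n) : b.val = i.val + 1 ↔ b = ⟨i.val + 1, hi⟩ := by simp [Fin.ext_iff]
  by_cases ha : a = i <;> simp [Matrix.mul_apply, fMat, hsucc, hi.ne, ha]

theorem fMat_mul_inr_last (hi : i.val + 1 = n) (g : Matrix (BasisIdx n) (Fin n) ℂ)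
    (a c : Fin n) :
    (fMat n i * g) (.inr a) c = if a = i then g (.inl i) c else 0 := by
  have hne (b : Fin n) : b.val ≠ n := b.2.ne
  by_cases ha : a = i <;> simp [Matrix.mul_apply, fMat, hi, hne, ha]

theorem eMat_mul_inl_of_lt (hi : i.val + 1 < n) (g : Matrix (BasisIdx n) (Fin n) ℂ)
    (a c : Fin n) :
    (eMat n i * g) (.inl a) c = if a = i then g (.inl ⟨i.val + 1, hi⟩) c else 0 := by
  have hsucc (b : Fin n) : b.val = i.val + 1 ↔ b = ⟨i.val + 1, hi⟩ := by simp [Fin.ext_iff]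
  by_cases ha : a = i <;> simp [Matrix.mul_apply, eMat, fMat, hsucc, hi.ne, ha]

theorem eMat_mul_inl_last (hi : i.val + 1 = n) (g : Matrix (BasisIdx n) (Fin n) ℂ)
    (a c : Fin n) :
    (eMat n i * g) (.inl a) c = if a = i then g (.inr i) c else 0 := by
  have hne (b : Fin n) : b.val ≠ n := b.2.ne
  by_cases ha : a = i <;> simp [Matrix.mul_apply, eMat, fMat, hi, hne, ha]

theorem eMat_mul_inr (i : Fin n) (g : Matrix (BasisIdx n) (Fin n) ℂ) (a c : Fin n) :
    (eMat n i * g) (.inr a) c = if a.val = i.val + 1 then g (.inr i) c else 0 := by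
  simp [Matrix.mul_apply, eMat, fMat, ite_and]

theorem xMat_mul_xMat (i : Fin n) (s t : ℂ) : xMat n i s * xMat n i t = xMat n i (s + t) := by
  have hsq : eMat n i * eMat n i = 0 := by
    rw [eMat, ← Matrix.transpose_mul, fMat_mul_self, Matrix.transpose_zero]
  simp only [xMat, add_mul, mul_add, one_mul, mul_one, Matrix.smul_mul, Matrix.mul_smul, hsq,
    smul_zero, add_zero, add_smul]
  abel

theorem yMat_mul_yMat (i : Fin n) (s t : ℂ) : yMat n i s * yMat n i t = yMat n i (s + t) := by
  simp only [yMat, add_mul, mul_add, one_mul, mul_one, Matrix.smul_mul, Matrix.mul_smul,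
    fMat_mul_self, smul_zero, add_zero, add_smul]
  abel

theorem inv_sBar (i : Fin n) : (sBar n i)⁻¹ = xMat n i 1 * yMat n i (-1) * xMat n i 1 := by
  refine Matrix.inv_eq_left_inv ?_
  have hx : xMat n i 1 * xMat n i (-1) = 1 := by
    rw [xMat_mul_xMat, add_neg_cancel, xMat, zero_smul, add_zero]
  have hy : yMat n i (-1) * yMat n i 1 = 1 := by
    rw [yMat_mul_yMat, neg_add_cancel, yMat, zero_smul, add_zero]
  calc xMat n i 1 * yMat n i (-1) * xMat n i 1 * sBar n i
      = xMat n i 1 * yMat n i (-1) * (xMat n i 1 * xMat n i (-1)) * yMat n i 1 *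
          xMat n i (-1) := by simp only [sBar, Matrix.mul_assoc]
    _ = xMat n i 1 * (yMat n i (-1) * yMat n i 1) * xMat n i (-1) := by
        rw [hx, Matrix.mul_one, Matrix.mul_assoc (xMat n i 1)]
    _ = 1 := by rw [hy, Matrix.mul_one, hx]

theorem inv_sBar_mul (i : Fin n) (g : Matrix (BasisIdx n) (Fin n) ℂ) :
    (sBar n i)⁻¹ * g = xMat n i 1 * (yMat n i (-1) * (xMat n i 1 * g)) := by
  rw [inv_sBar, Matrix.mul_assoc, Matrix.mul_assoc]

theorem xMat_one_mul (i : Fin n) (g : Matrix (BasisIdx n) (Fin n) ℂ) (r : BasisIdx n)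
    (c : Fin n) : (xMat n i 1 * g) r c = g r c + (eMat n i * g) r c := by
  simp [xMat, Matrix.add_mul]

theorem yMat_neg_one_mul (i : Fin n) (g : Matrix (BasisIdx n) (Fin n) ℂ) (r : BasisIdx n)
    (c : Fin n) : (yMat n i (-1) * g) r c = g r c - (fMat n i * g) r c := by
  simp [yMat, Matrix.add_mul, sub_eq_add_neg]

theorem inv_sBar_mul_inl_of_lt (hi : i.val + 1 < n) (g : Matrix (BasisIdx n) (Fin n) ℂ)
    (a c : Fin n) :
    ((sBar n i)⁻¹ * g) (.inl a) c =
      (if a = ⟨i.val + 1, hi⟩ then -1 else 1) *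
        g (.inl (Equiv.swap i ⟨i.val + 1, hi⟩ a)) c := by
  have hsucc (b : Fin n) : b.val = i.val + 1 ↔ b = ⟨i.val + 1, hi⟩ := by simp [Fin.ext_iff]
  have hne : (⟨i.val + 1, hi⟩ : Fin n) ≠ i := by simp [Fin.ext_iff]
  simp only [inv_sBar_mul, xMat_one_mul, yMat_neg_one_mul, eMat_mul_inl_of_lt hi,
    fMat_mul_inl, hsucc, Equiv.swap_apply_def]
  rcases eq_or_ne a i with rfl | hai
  · simp [hne, hne.symm]
  · rcases eq_or_ne a ⟨i.val + 1, hi⟩ with rfl | hai'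
    · simp [hne]
    · simp [hai, hai']

theorem inv_sBar_mul_inr_of_lt (hi : i.val + 1 < n) (g : Matrix (BasisIdx n) (Fin n) ℂ)
    (a c : Fin n) :
    ((sBar n i)⁻¹ * g) (.inr a) c =
      (if a = i then -1 else 1) * g (.inr (Equiv.swap i ⟨i.val + 1, hi⟩ a)) c := by
  have hsucc (b : Fin n) : b.val = i.val + 1 ↔ b = ⟨i.val + 1, hi⟩ := by simp [Fin.ext_iff]
  have hne : (⟨i.val + 1, hi⟩ : Fin n) ≠ i := by simp [Fin.ext_iff]
  simp only [inv_sBar_mul, xMat_one_mul, yMat_neg_one_mul, eMat_mul_inr,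
    fMat_mul_inr_of_lt hi, hsucc, Equiv.swap_apply_def]
  rcases eq_or_ne a i with rfl | hai
  · simp [hne.symm]
  · rcases eq_or_ne a ⟨i.val + 1, hi⟩ with rfl | hai'
    · simp [hne, hne.symm]
    · simp [hai, hai']

theorem inv_sBar_mul_inl_last (hi : i.val + 1 = n) (g : Matrix (BasisIdx n) (Fin n) ℂ)
    (a c : Fin n) :
    ((sBar n i)⁻¹ * g) (.inl a) c = if a = i then g (.inr i) c else g (.inl a) c := by
  have hne (b : Fin n) : b.val ≠ i.val + 1 := by omega
  simp only [inv_sBar_mul, xMat_one_mul, yMat_neg_one_mul, eMat_mul_inl_last hi,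
    fMat_mul_inr_last hi, fMat_mul_inl, eMat_mul_inr, hne, if_false, if_true]
  split_ifs with hai
  · subst hai
    ring
  · ring

theorem inv_sBar_mul_inr_last (hi : i.val + 1 = n) (g : Matrix (BasisIdx n) (Fin n) ℂ)
    (a c : Fin n) :
    ((sBar n i)⁻¹ * g) (.inr a) c = if a = i then -g (.inl i) c else g (.inr a) c := by
  have hne (b : Fin n) : b.val ≠ i.val + 1 := by omega
  simp only [inv_sBar_mul, xMat_one_mul, yMat_neg_one_mul, eMat_mul_inl_last hi,
    fMat_mul_inr_last hi, eMat_mul_inr, hne, if_false, if_true]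
  split_ifs with hai
  · subst hai
    ring
  · ring

/-! ### Extremal minors -/

/-- The row of the extremal weight vector with coordinate signs `x`. -/
def rowIdx (n : ℕ) (x : ℕ → ℤ) (a : Fin n) : BasisIdx n := if x a < 0 then .inr a else .inl a

/-- The sign which relates the minor with rows `rowIdx n x` to a generalized minor: a
negative coordinate contributes `-1` for each step from its position to the last one, the only
position at which a coordinate changes sign. -/
def flipSign (n : ℕ) (x : ℕ → ℤ) : ℂ :=
  ∏ a : Fin n, if x a < 0 then (-1) ^ (n - 1 - a.val) else 1

/-- The signed minor with rows `rowIdx n x`. -/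
def signedMinor (n : ℕ) (x : ℕ → ℤ) (g : Matrix (BasisIdx n) (Fin n) ℂ) : ℂ :=
  flipSign n x * (g.submatrix (rowIdx n x) id).det

theorem signedAct_apply_of_lt (hi : i.val + 1 < n) (x : ℕ → ℤ) (a : Fin n) :
    signedAct i x a = x (Equiv.swap i ⟨i.val + 1, hi⟩ a) := by
  simp only [signedAct_of_lt hi, Function.comp_apply, Equiv.swap_apply_def, Fin.ext_iff]
  split_ifs <;> rfl

theorem signedAct_apply_last (hi : i.val + 1 = n) (x : ℕ → ℤ) (a : Fin n) :
    signedAct i x a = if a = i then -x i else x a := by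
  simp only [signedAct_last hi, Function.update_apply, Fin.ext_iff]

/-- The product of `-1` for each of the coordinates `x i` and `x (i + 1)` that is negative. -/
def pairSign (i : Fin n) (x : ℕ → ℤ) : ℂ :=
  (if x i < 0 then -1 else 1) * if x (i.val + 1) < 0 then -1 else 1

theorem det_inv_sBar_mul_of_lt (hi : i.val + 1 < n) (x : ℕ → ℤ)
    (g : Matrix (BasisIdx n) (Fin n) ℂ) :
    (((sBar n i)⁻¹ * g).submatrix (rowIdx n x) id).det =
      pairSign i x * (g.submatrix (rowIdx n (signedAct i x)) id).det := by
  let j : Fin n := ⟨i.val + 1, hi⟩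
  have hij : i ≠ j := by simp [Fin.ext_iff, j]
  let rowSign (a : Fin n) : ℂ :=
    (if a = i then if x i < 0 then -1 else 1 else 1) *
      if a = j then if x j < 0 then 1 else -1 else 1
  have hrows : ((sBar n i)⁻¹ * g).submatrix (rowIdx n x) id = Matrix.of fun a b =>
      rowSign a *
        ((g.submatrix (rowIdx n (signedAct i x)) id).submatrix (Equiv.swap i j) id) a b := by
    ext a b
    simp only [Matrix.submatrix_apply, Matrix.of_apply, id, rowIdx, signedAct_apply_of_lt hi]
    rw [show Equiv.swap i ⟨i.val + 1, hi⟩ (Equiv.swap i j a) = a from Equiv.swap_apply_self ..]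
    by_cases hxa : x a < 0
    · simp only [hxa, if_true, inv_sBar_mul_inr_of_lt hi]
      congr 1
      simp only [rowSign]
      rcases eq_or_ne a i with rfl | hai
      · simp [hij, hxa]
      · rcases eq_or_ne a j with rfl | haj
        · simp [hij.symm, hxa]
        · simp [hai, haj]
    · simp only [hxa, if_false, inv_sBar_mul_inl_of_lt hi]
      congr 1
      simp only [rowSign]
      rcases eq_or_ne a i with rfl | hai
      · simp [hij, hxa, j]
      · rcases eq_or_ne a j with rfl | haj
        · simp [hij.symm, hxa, j]
        · simp [hai, haj, show a ≠ ⟨i.val + 1, hi⟩ from haj]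
  rw [hrows, Matrix.det_mul_column, Matrix.det_permute, Equiv.Perm.sign_swap hij,
    Finset.prod_mul_distrib, Finset.prod_ite_eq' Finset.univ i, Finset.prod_ite_eq' Finset.univ j,
    if_pos (Finset.mem_univ i), if_pos (Finset.mem_univ j), pairSign]
  simp only [j, Units.val_neg, Units.val_one, Int.cast_neg, Int.cast_one]
  split_ifs <;> ring

theorem flipSign_signedAct_of_lt (hi : i.val + 1 < n) (x : ℕ → ℤ) :
    flipSign n (signedAct i x) = flipSign n x * pairSign i x := by
  let j : Fin n := ⟨i.val + 1, hi⟩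
  have hij : i ≠ j := by simp [Fin.ext_iff, j]
  have hsucc : n - 1 - i.val = n - 1 - (i.val + 1) + 1 := by omega
  have hpair : pairSign i x = ∏ a : Fin n,
      (if a = i then if x i < 0 then -1 else 1 else 1) *
        if a = j then if x j < 0 then -1 else 1 else 1 := by
    rw [Finset.prod_mul_distrib, Finset.prod_ite_eq' Finset.univ i,
      Finset.prod_ite_eq' Finset.univ j, if_pos (Finset.mem_univ i), if_pos (Finset.mem_univ j)]
    rfl
  rw [hpair, flipSign, ← Equiv.prod_comp (Equiv.swap i j), flipSign, ← Finset.prod_mul_distrib]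
  refine Finset.prod_congr rfl fun a _ => ?_
  rw [signedAct_apply_of_lt hi,
    show Equiv.swap i ⟨i.val + 1, hi⟩ (Equiv.swap i j a) = a from Equiv.swap_apply_self ..]
  rcases eq_or_ne a i with rfl | hai
  · rw [Equiv.swap_apply_left, if_pos rfl, if_neg hij, hsucc, pow_succ]
    split_ifs <;> ring
  · rcases eq_or_ne a j with rfl | haj
    · rw [Equiv.swap_apply_right, if_neg hij.symm, if_pos rfl, hsucc, pow_succ]
      simp only [j]
      split_ifs <;> ring
    · simp [Equiv.swap_apply_of_ne_of_ne hai haj, hai, haj]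

theorem signedMinor_inv_sBar_of_lt (hi : i.val + 1 < n) (x : ℕ → ℤ)
    (g : Matrix (BasisIdx n) (Fin n) ℂ) :
    signedMinor n x ((sBar n i)⁻¹ * g) = signedMinor n (signedAct i x) g := by
  rw [signedMinor, signedMinor, det_inv_sBar_mul_of_lt hi, flipSign_signedAct_of_lt hi, mul_assoc]

theorem det_inv_sBar_mul_last (hi : i.val + 1 = n) {x : ℕ → ℤ} (hx : x i ≠ 0)
    (g : Matrix (BasisIdx n) (Fin n) ℂ) :
    (((sBar n i)⁻¹ * g).submatrix (rowIdx n x) id).det =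
      (if x i < 0 then -1 else 1) * (g.submatrix (rowIdx n (signedAct i x)) id).det := by
  have hrows : ((sBar n i)⁻¹ * g).submatrix (rowIdx n x) id = Matrix.of fun a b =>
      (if a = i then (if x i < 0 then -1 else 1) else 1) *
        (g.submatrix (rowIdx n (signedAct i x)) id) a b := by
    ext a b
    simp only [Matrix.submatrix_apply, Matrix.of_apply, id, rowIdx, signedAct_apply_last hi]
    rcases eq_or_ne a i with rfl | hai
    · rcases hx.lt_or_gt with hneg | hpos
      · simp [hneg, hneg.not_gt, inv_sBar_mul_inr_last hi]
      · simp [hpos, hpos.not_gt, inv_sBar_mul_inl_last hi]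
    · by_cases hxa : x a < 0
      · simp [hxa, inv_sBar_mul_inr_last hi, hai]
      · simp [hxa, inv_sBar_mul_inl_last hi, hai]
  rw [hrows, Matrix.det_mul_column, Finset.prod_ite_eq' Finset.univ i, if_pos (Finset.mem_univ i)]

theorem flipSign_signedAct_last (hi : i.val + 1 = n) (x : ℕ → ℤ) :
    flipSign n (signedAct i x) = flipSign n x := by
  rw [flipSign, flipSign]
  refine Finset.prod_congr rfl fun a _ => ?_
  rw [signedAct_apply_last hi]
  rcases eq_or_ne a i with rfl | hai
  · simp [show n - 1 - a.val = 0 by omega]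
  · simp [hai]

theorem signedMinor_inv_sBar_last (hi : i.val + 1 = n) {x : ℕ → ℤ} (hx : x i ≠ 0)
    (g : Matrix (BasisIdx n) (Fin n) ℂ) :
    signedMinor n x ((sBar n i)⁻¹ * g) =
      (if x i < 0 then -1 else 1) * signedMinor n (signedAct i x) g := by
  rw [signedMinor, signedMinor, det_inv_sBar_mul_last hi hx, flipSign_signedAct_last hi,
    mul_left_comm]

theorem signedMinor_inv_weylLift {x : ℕ → ℤ} (hx : ∀ k < n, x k ≠ 0) (w : List (Fin n))
    (g : Matrix (BasisIdx n) (Fin n) ℂ) :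
    signedMinor n x ((weylLift n w)⁻¹ * g) =
      (-1) ^ negFlipCount x w * signedMinor n (wordAct w x) g := by
  induction w generalizing g with
  | nil => simp [weylLift, negFlipCount, wordAct]
  | cons i w ih =>
    have hinv : (weylLift n (i :: w))⁻¹ = (weylLift n w)⁻¹ * (sBar n i)⁻¹ := by
      rw [weylLift, List.map_cons, List.prod_cons, Matrix.mul_inv_rev]
      rfl
    rw [hinv, Matrix.mul_assoc, ih, wordAct_cons, negFlipCount]
    by_cases hi : i.val + 1 < n
    · rw [signedMinor_inv_sBar_of_lt hi, if_neg (by omega), add_zero]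
    · have hlast : i.val + 1 = n := by omega
      rw [signedMinor_inv_sBar_last hlast (wordAct_ne_zero hx w i i.2)]
      simp only [hlast, true_and]
      split_ifs <;> ring

theorem principalMinor_lastIdx (hn : 0 < n) (g : Matrix (BasisIdx n) (BasisIdx n) ℂ) :
    principalMinor n (lastIdx n hn) g = (g.submatrix Sum.inl Sum.inl).det := by
  have hle (a : Fin n) : a ≤ lastIdx n hn := Nat.le_sub_one_of_lt a.2
  rw [principalMinor, ← Matrix.det_submatrix_equiv_self (Equiv.subtypeUnivEquiv hle)]
  rfl

theorem generalizedMinor_eq_signedMinor (hn : 0 < n) (u : List (Fin n))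
    (g : Matrix (BasisIdx n) (BasisIdx n) ℂ) :
    generalizedMinor n (lastIdx n hn) u [] g =
      signedMinor n (rhoVec n) ((weylLift n u)⁻¹ * g.submatrix id Sum.inl) := by
  have hpos (a : Fin n) : ¬ rhoVec n a < 0 := (rhoVec_pos a.2).not_gt
  rw [generalizedMinor, principalMinor_lastIdx, signedMinor, flipSign]
  simp only [hpos, if_false, Finset.prod_const_one, one_mul]
  congr 1
  ext a b
  simp [weylLift, rowIdx, hpos, Matrix.mul_apply]

theorem generalizedMinor_eq_det {hn : 0 < n} {u : List (Fin n)} (hred : IsReducedWord n u)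
    (hu : weylOf n u = weylOf n (longestWord n ++ [lastIdx n hn]))
    (g : Matrix (BasisIdx n) (BasisIdx n) ℂ) :
    generalizedMinor n (lastIdx n hn) u [] g =
      (∏ a : Fin n, (-1 : ℂ) ^ (n - 1 - a.val)) *
        (Matrix.of fun a b : Fin n =>
          g (if a.val + 1 < n then .inr a else .inl a) (.inl b)).det := by
  have hneg (a : Fin n) : wordAct u (rhoVec n) a < 0 ↔ a.val + 1 < n := by
    rw [wordAct_rhoVec hu a.2, lowVec_neg_iff a.2]
  rw [generalizedMinor_eq_signedMinor, signedMinor_inv_weylLift fun k hk => (rhoVec_pos hk).ne',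
    negFlipCount_eq_zero hred hu, pow_zero, one_mul, signedMinor]
  congr 1
  · refine Finset.prod_congr rfl fun a _ => ?_
    simp only [hneg]
    split_ifs with hlt
    · rfl
    · rw [show n - 1 - a.val = 0 by omega, pow_zero]
  · congr 1
    ext a b
    simp [rowIdx, hneg]

end SimpleReflectionLifts

section ThetaMinus

open Finset.HasAntidiagonal (antidiagonal mem_antidiagonal)

variable {n : ℕ} {i : Fin n} {t : ℂ}

/-! ### The factors of `Θ^-` -/

theorem corootMat_mul (i : Fin n) (t : ℂ) (g : Matrix (BasisIdx n) (Fin n) ℂ) (r : BasisIdx n)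
    (b : Fin n) :
    (corootMat n i t * g) r b = (match r with
      | .inl a => if a = i then t else if a.val = i.val + 1 then t⁻¹ else 1
      | .inr a => if a = i then t⁻¹ else if a.val = i.val + 1 then t else 1) * g r b := by
  rcases r with a | a <;> simp only [corootMat, Matrix.diagonal_mul]

theorem boldY_mul (i : Fin n) (t : ℂ) (g : Matrix (BasisIdx n) (Fin n) ℂ) (r : BasisIdx n)
    (b : Fin n) :
    (boldY n i t * g) r b = (corootMat n i t⁻¹ * g) r b +
      t * (fMat n i * (corootMat n i t⁻¹ * g)) r b := by
  simp [boldY, yMat, Matrix.mul_assoc, Matrix.add_mul]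

theorem boldY_mul_inl (ht : t ≠ 0) (i : Fin n) (g : Matrix (BasisIdx n) (Fin n) ℂ)
    (a b : Fin n) :
    (boldY n i t * g) (.inl a) b =
      if a = i then t⁻¹ * g (.inl a) b
      else if a.val = i.val + 1 then t * g (.inl a) b + g (.inl i) b else g (.inl a) b := by
  rw [boldY_mul, fMat_mul_inl, corootMat_mul, corootMat_mul]
  rcases eq_or_ne a i with rfl | hai
  · simp
  · simp only [hai, if_false, if_true, inv_inv]
    split_ifs
    · field_simp
    · ring

theorem boldY_mul_inr_of_lt (hi : i.val + 1 < n) (ht : t ≠ 0)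
    (g : Matrix (BasisIdx n) (Fin n) ℂ) (a b : Fin n) :
    (boldY n i t * g) (.inr a) b =
      if a = i then t * g (.inr a) b + g (.inr ⟨i.val + 1, hi⟩) b
      else if a.val = i.val + 1 then t⁻¹ * g (.inr a) b else g (.inr a) b := by
  rw [boldY_mul, fMat_mul_inr_of_lt hi, corootMat_mul, corootMat_mul]
  rcases eq_or_ne a i with rfl | hai
  · simp [Fin.ext_iff, ht]
  · simp only [hai, if_false, inv_inv]
    split_ifs <;> ring

theorem boldY_mul_inr_last (hi : i.val + 1 = n) (ht : t ≠ 0)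
    (g : Matrix (BasisIdx n) (Fin n) ℂ) (a b : Fin n) :
    (boldY n i t * g) (.inr a) b =
      if a = i then t * g (.inr a) b + g (.inl a) b else g (.inr a) b := by
  rw [boldY_mul, fMat_mul_inr_last hi, corootMat_mul, corootMat_mul]
  rcases eq_or_ne a i with rfl | hai
  · simp [ht]
  · simp only [hai, if_false, inv_inv, show ¬ a.val = i.val + 1 by omega]
    ring

/-- The matrix `Aᵀ D C` of pairings of the columns of the upper half `A` of a matrix with the
columns of its lower half `C`; the signs `D` are those of the symplectic form that is preserved by
the `f_i`. -/
def halfPairing (g : Matrix (BasisIdx n) (Fin n) ℂ) : Matrix (Fin n) (Fin n) ℂ :=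
  g.toRows₁.transpose * Matrix.diagonal (fun k => (-1) ^ (n - 1 - k.val)) * g.toRows₂

theorem halfPairing_apply (g : Matrix (BasisIdx n) (Fin n) ℂ) (a b : Fin n) :
    halfPairing g a b =
      ∑ k : Fin n, (-1) ^ (n - 1 - k.val) * (g (.inl k) a * g (.inr k) b) := by
  simp only [halfPairing, Matrix.mul_apply (N := g.toRows₂), Matrix.mul_diagonal,
    Matrix.transpose_apply, Matrix.toRows₁_apply, Matrix.toRows₂_apply]
  exact Finset.sum_congr rfl fun k _ => by ring

theorem halfPairing_boldY_of_lt (hi : i.val + 1 < n) (ht : t ≠ 0)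
    (g : Matrix (BasisIdx n) (Fin n) ℂ) : halfPairing (boldY n i t * g) = halfPairing g := by
  let j : Fin n := ⟨i.val + 1, hi⟩
  have hne : j ≠ i := by simp [Fin.ext_iff, j]
  have hj (a : Fin n) : a.val = i.val + 1 ↔ a = j := by simp [Fin.ext_iff, j]
  ext a b
  rw [halfPairing_apply, halfPairing_apply, ← sub_eq_zero, ← Finset.sum_sub_distrib,
    ← Finset.sum_subset (Finset.subset_univ {i, j}), Finset.sum_pair hne.symm]
  · have hsign : n - 1 - i.val = n - 1 - j.val + 1 := by simp only [j]; omega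
    simp only [boldY_mul_inl ht, boldY_mul_inr_of_lt hi ht, if_true, hj, hne, if_false, hsign,
      pow_succ, show (⟨i.val + 1, hi⟩ : Fin n) = j from rfl]
    field_simp
    ring
  · intro k _ hk
    simp only [Finset.mem_insert, Finset.mem_singleton, not_or] at hk
    simp only [boldY_mul_inl ht, boldY_mul_inr_of_lt hi ht, hj, hk, if_false, sub_self]

theorem halfPairing_boldY_last (hi : i.val + 1 = n) (ht : t ≠ 0)
    (g : Matrix (BasisIdx n) (Fin n) ℂ) :
    halfPairing (boldY n i t * g) =
      halfPairing g + t⁻¹ • Matrix.vecMulVec (g (.inl i)) (g (.inl i)) := by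
  ext a b
  rw [Matrix.add_apply, Matrix.smul_apply, Matrix.vecMulVec_apply, smul_eq_mul, halfPairing_apply,
    halfPairing_apply, ← sub_eq_iff_eq_add', ← Finset.sum_sub_distrib, Finset.sum_eq_single i]
  · simp only [boldY_mul_inl ht, boldY_mul_inr_last hi ht, if_true,
      show n - 1 - i.val = 0 by omega]
    field_simp
    ring
  · intro k _ hk
    have hsucc : ¬ k.val = i.val + 1 := by omega
    simp only [boldY_mul_inl ht, boldY_mul_inr_last hi ht, hk, hsucc, if_false, sub_self]
  · simp

/-- The `j`-th row of the upper half of a matrix, with `j` counted from `1`; the row is zero for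
`j` outside `1, …, n`. -/
def upperRow (g : Matrix (BasisIdx n) (Fin n) ℂ) (j : ℕ) : Fin n → ℂ :=
  if h : 1 ≤ j ∧ j ≤ n then g (.inl ⟨j - 1, by omega⟩) else 0

theorem upperRow_zero (g : Matrix (BasisIdx n) (Fin n) ℂ) : upperRow g 0 = 0 := by simp [upperRow]

theorem upperRow_succ (g : Matrix (BasisIdx n) (Fin n) ℂ) (i : Fin n) :
    upperRow g (i.val + 1) = g (.inl i) := by
  simp [upperRow, Nat.succ_le_of_lt i.2]

theorem upperRow_boldY (ht : t ≠ 0) (i : Fin n) (g : Matrix (BasisIdx n) (Fin n) ℂ) {j : ℕ}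
    (hj : j ≤ n) :
    upperRow (boldY n i t * g) j =
      if j = i.val + 1 then t⁻¹ • upperRow g j
      else if j = i.val + 2 then t • upperRow g j + upperRow g (i.val + 1)
      else upperRow g j := by
  rcases j with _ | j
  · simp [upperRow_zero]
  · obtain ⟨a, rfl⟩ : ∃ a : Fin n, a.val = j := ⟨⟨j, hj⟩, rfl⟩
    funext b
    simp only [upperRow_succ, boldY_mul_inl ht, Fin.ext_iff, Nat.add_right_cancel_iff,
      show a.val + 1 = i.val + 2 ↔ a.val = i.val + 1 by omega]
    split_ifs <;> rfl

/-! ### Values of variables and Coxeter factors -/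

variable {c : Fin n → ℤ → ℂ}

/-- The value of the variable `Y_{m,x}`, with the convention `Y_{m,0} = 1`. -/
def varValue (c : Fin n → ℤ → ℂ) (m : ℤ) (x : ℕ) : ℂ :=
  if h : 1 ≤ x ∧ x ≤ n then c ⟨x - 1, by omega⟩ m else 1

theorem varValue_zero (c : Fin n → ℤ → ℂ) (m : ℤ) : varValue c m 0 = 1 := by simp [varValue]

theorem varValue_succ (c : Fin n → ℤ → ℂ) (m : ℤ) (i : Fin n) :
    varValue c m (i.val + 1) = c i m := by
  simp [varValue, Nat.succ_le_of_lt i.2]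

theorem varValue_ne_zero (hc : ∀ i p, c i p ≠ 0) (m : ℤ) (x : ℕ) : varValue c m x ≠ 0 := by
  rw [varValue]
  split_ifs
  · exact hc _ _
  · exact one_ne_zero

/-- The quotient `c_{x-1}^{(m)} / c_x^{(m)}`, the value of a letter box `boxNeg`. -/
noncomputable def varRatio (c : Fin n → ℤ → ℂ) (m : ℤ) (x : ℕ) : ℂ :=
  varValue c m (x - 1) / varValue c m x

theorem prod_varRatio (hc : ∀ i p, c i p ≠ 0) (m : ℤ) (j : ℕ) :
    ∏ x ∈ Finset.range j, varRatio c m (x + 1) = (varValue c m j)⁻¹ := by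
  induction j with
  | zero => simp [varValue_zero]
  | succ j ih =>
    have hne := varValue_ne_zero hc m j
    rw [Finset.prod_range_succ, ih, varRatio, Nat.add_sub_cancel]
    field_simp

/-- The factor `∏_i y_i(c_i^{(p)}) α_i^∨((c_i^{(p)})⁻¹)` of `Θ^-`. -/
noncomputable def coxeterFactor (n : ℕ) (c : Fin n → ℤ → ℂ) (p : ℤ) :
    Matrix (BasisIdx n) (BasisIdx n) ℂ :=
  ((List.finRange n).map fun i => boldY n i (c i p)).prod

theorem halfPairing_prod_boldY (hc : ∀ i p, c i p ≠ 0) (p : ℤ)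
    (g : Matrix (BasisIdx n) (Fin n) ℂ) {w : List (Fin n)} (hw : ∀ i ∈ w, i.val + 1 < n) :
    halfPairing ((w.map fun i => boldY n i (c i p)).prod * g) = halfPairing g := by
  induction w with
  | nil => simp
  | cons i w ih =>
    rw [List.forall_mem_cons] at hw
    rw [List.map_cons, List.prod_cons, Matrix.mul_assoc, halfPairing_boldY_of_lt hw.1 (hc i p),
      ih hw.2]

theorem halfPairing_coxeterFactor (hc : ∀ i p, c i p ≠ 0) (p : ℤ)
    (g : Matrix (BasisIdx n) (Fin n) ℂ) :
    halfPairing (coxeterFactor n c p * g) =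
      halfPairing g +
        (varValue c p n)⁻¹ • Matrix.vecMulVec (upperRow g n) (upperRow g n) := by
  obtain rfl | hn := n.eq_zero_or_pos
  · exact Subsingleton.elim _ _
  obtain ⟨w, hw, hlt⟩ := exists_finRange_eq_append hn
  have hlast : (lastIdx n hn).val + 1 = n := Nat.sub_add_cancel hn
  have hrow := upperRow_succ g (lastIdx n hn)
  have hvalue := varValue_succ c p (lastIdx n hn)
  rw [hlast] at hrow hvalue
  rw [coxeterFactor, hw, List.map_append, List.prod_append, Matrix.mul_assoc,
    halfPairing_prod_boldY hc p _ hlt, List.map_singleton, List.prod_singleton,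
    halfPairing_boldY_last hlast (hc _ p), hrow, hvalue]

theorem upperRow_prod_drop_boldY (hc : ∀ i p, c i p ≠ 0) (p : ℤ)
    (g : Matrix (BasisIdx n) (Fin n) ℂ) {j k : ℕ} (hj : j ≤ n) (hk : k ≤ n) :
    upperRow ((((List.finRange n).drop k).map fun i => boldY n i (c i p)).prod * g) j =
      if j ≤ k then upperRow g j
      else if j = k + 1 then (varValue c p j)⁻¹ • upperRow g j
      else varRatio c p j • upperRow g j + upperRow g (j - 1) := by
  induction hk using Nat.decreasingInduction generalizing j with
  | self =>
    rw [List.drop_eq_nil_of_le (by simp), if_pos hj]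
    simp
  | of_succ k hk ih =>
    have hvalue : varValue c p (k + 1) = c ⟨k, hk⟩ p := varValue_succ c p ⟨k, hk⟩
    rw [drop_finRange hk, List.map_cons, List.prod_cons, Matrix.mul_assoc,
      upperRow_boldY (hc _ p) _ _ hj, ih hj, ih (Nat.succ_le_of_lt hk)]
    rcases lt_trichotomy j (k + 1) with hlt | rfl | hgt
    · simp [hlt.ne, hlt.le, show j ≠ k + 2 by omega, show j ≤ k by omega]
    · simp [hvalue]
    · rcases (Nat.succ_le_of_lt hgt).eq_or_lt with rfl | hgt'
      · simp [varRatio, hvalue, div_eq_mul_inv, mul_smul]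
      · simp [hgt.ne', hgt.not_ge, hgt'.ne', show ¬ j ≤ k by omega]

theorem upperRow_coxeterFactor (hc : ∀ i p, c i p ≠ 0) (p : ℤ)
    (g : Matrix (BasisIdx n) (Fin n) ℂ) {j : ℕ} (hj : j + 1 ≤ n) :
    upperRow (coxeterFactor n c p * g) (j + 1) =
      varRatio c p (j + 1) • upperRow g (j + 1) + upperRow g j := by
  have hrow := upperRow_prod_drop_boldY hc p g hj n.zero_le
  rw [List.drop_zero] at hrow
  rw [coxeterFactor, hrow]
  rcases j with _ | j
  · simp [varRatio, varValue_zero, upperRow_zero]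
  · simp

/-- The first `n` columns of the product of the last `q` Coxeter factors of `Θ^-`. -/
noncomputable def partialTheta (n : ℕ) (c : Fin n → ℤ → ℂ) : ℕ → Matrix (BasisIdx n) (Fin n) ℂ
  | 0 => (1 : Matrix (BasisIdx n) (BasisIdx n) ℂ).submatrix id Sum.inl
  | q + 1 => coxeterFactor n c (n - q) * partialTheta n c q

theorem partialTheta_eq_prod_drop (c : Fin n → ℤ → ℂ) {k : ℕ} (hk : k ≤ n) :
    partialTheta n c (n - k) =
      (((List.finRange n).drop k).map fun p => coxeterFactor n c (p.val + 1)).prod *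
        (1 : Matrix (BasisIdx n) (BasisIdx n) ℂ).submatrix id Sum.inl := by
  induction hk using Nat.decreasingInduction with
  | self =>
    rw [List.drop_eq_nil_of_le (by simp), Nat.sub_self]
    simp [partialTheta]
  | of_succ k hk ih =>
    rw [show n - k = n - (k + 1) + 1 by omega, partialTheta, ih, drop_finRange hk, List.map_cons,
      List.prod_cons, Matrix.mul_assoc, show (n : ℤ) - (n - (k + 1) : ℕ) = k + 1 by omega]

theorem thetaMinus_eq_prod_coxeterFactor (c : Fin n → ℤ → ℂ) :
    thetaMinus n c =
      ((List.finRange n).map fun p => coxeterFactor n c (p.val + 1)).prod := by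
  rw [thetaMinus, List.flatMap_def, List.prod_flatten, List.map_map]
  rfl

theorem partialTheta_self (c : Fin n → ℤ → ℂ) :
    partialTheta n c n = (thetaMinus n c).submatrix id Sum.inl := by
  have hprod := partialTheta_eq_prod_drop c n.zero_le
  rw [Nat.sub_zero, List.drop_zero, ← thetaMinus_eq_prod_coxeterFactor] at hprod
  rw [hprod]
  ext a b
  simp [Matrix.mul_apply, Matrix.one_apply]

/-! ### The upper rows of partial products -/

theorem upperRow_partialTheta_zero (j : ℕ) (b : Fin n) :
    upperRow (partialTheta n c 0) j b = if j = b.val + 1 then 1 else 0 := by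
  simp only [upperRow, partialTheta]
  split_ifs with hj hjb hjb
  · simp [Matrix.one_apply, hjb]
  · simp only [Matrix.submatrix_apply, id, Matrix.one_apply, Sum.inl.injEq, Fin.ext_iff]
    rw [if_neg (by omega)]
  · omega
  · rfl

variable (hc : ∀ i p, c i p ≠ 0)

include hc

theorem upperRow_partialTheta_succ {j : ℕ} (hj : j + 1 ≤ n) (q : ℕ) :
    upperRow (partialTheta n c (q + 1)) (j + 1) =
      varRatio c (n - q) (j + 1) • upperRow (partialTheta n c q) (j + 1) +
        upperRow (partialTheta n c q) j :=
  upperRow_coxeterFactor hc _ _ hj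

theorem upperRow_partialTheta_eq_zero {j q : ℕ} {b : Fin n} (hj : j ≤ n)
    (hband : j < b.val + 1 ∨ b.val + 1 + q < j) : upperRow (partialTheta n c q) j b = 0 := by
  induction q generalizing j with
  | zero => rw [upperRow_partialTheta_zero, if_neg (by omega)]
  | succ q ih =>
    rcases j with _ | j
    · rw [upperRow_zero, Pi.zero_apply]
    · rw [upperRow_partialTheta_succ hc hj, Pi.add_apply, Pi.smul_apply, ih hj (by omega),
        ih (by omega) (by omega), smul_zero, add_zero]

theorem upperRow_partialTheta_eq_one {q : ℕ} {b : Fin n} (hq : b.val + 1 + q ≤ n) :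
    upperRow (partialTheta n c q) (b.val + 1 + q) b = 1 := by
  induction q with
  | zero => rw [upperRow_partialTheta_zero, if_pos rfl]
  | succ q ih =>
    have hq' : b.val + 1 + q + 1 ≤ n := hq
    rw [← Nat.add_assoc, upperRow_partialTheta_succ hc hq', Pi.add_apply, Pi.smul_apply,
      upperRow_partialTheta_eq_zero hc hq' (.inr (Nat.lt_succ_self _)), ih (by omega), smul_zero,
      zero_add]

theorem upperRow_partialTheta_diag (q : ℕ) (b : Fin n) :
    upperRow (partialTheta n c q) (b.val + 1) b =
      ∏ s ∈ Finset.range q, varRatio c (n - s) (b.val + 1) := by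
  induction q with
  | zero => rw [upperRow_partialTheta_zero, if_pos rfl, Finset.prod_range_zero]
  | succ q ih =>
    rw [upperRow_partialTheta_succ hc b.2, Pi.add_apply, Pi.smul_apply, ih,
      upperRow_partialTheta_eq_zero hc b.2.le (.inl (Nat.lt_succ_self _)), add_zero,
      Finset.prod_range_succ, smul_eq_mul, mul_comm]

theorem det_toRows₁_partialTheta :
    (partialTheta n c n).toRows₁.det = ∏ r : Fin n, (varValue c (r.val + 1) n)⁻¹ := by
  have hentry (a b : Fin n) :
      (partialTheta n c n).toRows₁ a b = upperRow (partialTheta n c n) (a.val + 1) b := by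
    rw [upperRow_succ, Matrix.toRows₁_apply]
  rw [Matrix.det_of_isLowerTriangular]
  · simp only [hentry, upperRow_partialTheta_diag hc]
    rw [Finset.prod_comm, ← Finset.prod_range_reflect,
      ← Fin.prod_univ_eq_prod_range
        fun s => ∏ a : Fin n, varRatio c (n - (n - 1 - s : ℕ)) (a.val + 1)]
    refine Finset.prod_congr rfl fun s _ => ?_
    rw [show (n : ℤ) - (n - 1 - s.val : ℕ) = s.val + 1 by omega,
      Fin.prod_univ_eq_prod_range fun x => varRatio c (s.val + 1) (x + 1), prod_varRatio hc]
  · intro a b hab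
    have hlt : a < b := hab
    rw [hentry, upperRow_partialTheta_eq_zero hc a.2 (.inl (by omega))]

theorem halfPairing_partialTheta (q : ℕ) :
    halfPairing (partialTheta n c q) = ∑ s ∈ Finset.range q, (varValue c (n - s) n)⁻¹ •
      Matrix.vecMulVec (upperRow (partialTheta n c s) n) (upperRow (partialTheta n c s) n) := by
  induction q with
  | zero =>
    ext a b
    simp [halfPairing_apply, partialTheta]
  | succ q ih => rw [partialTheta, halfPairing_coxeterFactor hc, ih, Finset.sum_range_succ]

omit hc in
/-- The `n`-th rows of the partial products of `Θ^-`, from the longest proper one to the empty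
one. -/
noncomputable def bottomRows (n : ℕ) (c : Fin n → ℤ → ℂ) : Matrix (Fin n) (Fin n) ℂ :=
  Matrix.of fun r => upperRow (partialTheta n c (n - 1 - r.val)) n

theorem det_bottomRows : (bottomRows n c).det = 1 := by
  rw [Matrix.det_of_isUpperTriangular]
  · refine Finset.prod_eq_one fun r _ => ?_
    have hone := upperRow_partialTheta_eq_one hc (b := r) (q := n - 1 - r.val) (by omega)
    rwa [show r.val + 1 + (n - 1 - r.val) = n by omega] at hone
  · intro a b hab
    have hlt : b < a := hab
    exact upperRow_partialTheta_eq_zero hc le_rfl (.inr (by omega))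

theorem halfPairing_partialTheta_self :
    halfPairing (partialTheta n c n) = (bottomRows n c).transpose *
      Matrix.diagonal (fun r => (varValue c (r.val + 1) n)⁻¹) * bottomRows n c := by
  let term (s : ℕ) : Matrix (Fin n) (Fin n) ℂ := (varValue c (n - s) n)⁻¹ •
    Matrix.vecMulVec (upperRow (partialTheta n c s) n) (upperRow (partialTheta n c s) n)
  rw [halfPairing_partialTheta hc]
  change ∑ s ∈ Finset.range n, term s = _
  rw [← Finset.sum_range_reflect, ← Fin.sum_univ_eq_sum_range fun s => term (n - 1 - s)]
  ext a b
  rw [Matrix.sum_apply, Matrix.mul_apply]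
  refine Finset.sum_congr rfl fun r _ => ?_
  simp only [term]
  rw [Matrix.mul_diagonal, Matrix.smul_apply, Matrix.vecMulVec_apply, smul_eq_mul,
    show (n : ℤ) - (n - 1 - r.val : ℕ) = r.val + 1 by omega]
  simp only [bottomRows, Matrix.transpose_apply, Matrix.of_apply]
  ring

theorem prod_sign_mul_det_toRows₂_partialTheta :
    (∏ a : Fin n, (-1 : ℂ) ^ (n - 1 - a.val)) * (partialTheta n c n).toRows₂.det = 1 := by
  have hdet := congrArg Matrix.det (halfPairing_partialTheta_self hc)
  rw [halfPairing, Matrix.det_mul, Matrix.det_mul, Matrix.det_mul, Matrix.det_mul,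
    Matrix.det_transpose, Matrix.det_transpose, det_bottomRows hc, Matrix.det_diagonal,
    Matrix.det_diagonal, one_mul, mul_one, det_toRows₁_partialTheta hc, mul_assoc] at hdet
  refine mul_left_cancel₀ (Finset.prod_ne_zero_iff.2 fun r _ => ?_) (hdet.trans (mul_one _).symm)
  exact inv_ne_zero (varValue_ne_zero hc _ _)

/-! ### The minor of `Θ^-` as a sum of squares -/

omit hc in
/-- The sums `E_r = elemSum c n r` for which the minor of `Θ^-` is `∑ c_n^{(r)} E_r ^ 2`. They
satisfy a recursion of the same kind as elementary symmetric functions. -/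
noncomputable def elemSum (c : Fin n → ℤ → ℂ) : ℕ → ℕ → ℂ
  | _, 0 => 1
  | 0, _ + 1 => 0
  | j + 1, r + 1 => elemSum c j (r + 1) + varRatio c (n - j + r) (j + 1) * elemSum c j r

omit hc in
theorem elemSum_zero_right (j : ℕ) : elemSum c j 0 = 1 := by
  cases j <;> rw [elemSum]

omit hc in
theorem elemSum_eq_zero {j r : ℕ} (h : j < r) : elemSum c j r = 0 := by
  obtain ⟨r, rfl⟩ := Nat.exists_eq_succ_of_ne_zero h.ne_bot
  induction j generalizing r with
  | zero => rw [elemSum]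
  | succ j ih =>
    obtain ⟨r, rfl⟩ := Nat.exists_eq_succ_of_ne_zero (Nat.lt_of_succ_lt_succ h).ne_bot
    rw [elemSum, ih _ (by omega), ih _ (by omega), mul_zero, add_zero]

theorem sum_elemSum_smul_upperRow {j : ℕ} (hj : j ≤ n) :
    ∑ p ∈ antidiagonal j,
      ((-1) ^ p.1 * elemSum c j p.1) • upperRow (partialTheta n c p.2) j = 0 := by
  induction j with
  | zero => simp [upperRow_zero]
  | succ j ih =>
    let R (q : ℕ) : Fin n → ℂ := upperRow (partialTheta n c q) (j + 1)
    have hshift : R (j + 1) + ∑ p ∈ antidiagonal j,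
          ((-1) ^ (p.1 + 1) * elemSum c j (p.1 + 1)) • R p.2 =
        ∑ p ∈ antidiagonal j, ((-1) ^ p.1 * elemSum c j p.1) • R (p.2 + 1) := by
      have hfirst := Finset.Nat.sum_antidiagonal_succ (n := j)
        (f := fun p => ((-1) ^ p.1 * elemSum c j p.1) • R p.2)
      have hlast := Finset.Nat.sum_antidiagonal_succ' (n := j)
        (f := fun p => ((-1) ^ p.1 * elemSum c j p.1) • R p.2)
      simpa [elemSum_zero_right, elemSum_eq_zero] using hfirst.symm.trans hlast
    calc ∑ p ∈ antidiagonal (j + 1), ((-1) ^ p.1 * elemSum c (j + 1) p.1) • R p.2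
        = R (j + 1) + ∑ p ∈ antidiagonal j,
            ((-1) ^ (p.1 + 1) * elemSum c (j + 1) (p.1 + 1)) • R p.2 := by
          simp [Finset.Nat.sum_antidiagonal_succ, elemSum_zero_right]
      _ = ∑ p ∈ antidiagonal j, ((-1) ^ p.1 * elemSum c j p.1) •
            (R (p.2 + 1) - varRatio c (n - j + p.1) (j + 1) • R p.2) := by
          simp only [smul_sub, Finset.sum_sub_distrib]
          rw [← hshift, add_sub_assoc, ← Finset.sum_sub_distrib]
          refine congrArg (R (j + 1) + ·) (Finset.sum_congr rfl fun p _ => ?_)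
          rw [elemSum, pow_succ]
          module
      _ = 0 := by
          rw [← ih (by omega)]
          refine Finset.sum_congr rfl fun p hp => ?_
          rw [mem_antidiagonal] at hp
          rw [show (n : ℤ) - j + p.1 = n - p.2 by omega]
          simp only [R, upperRow_partialTheta_succ hc hj, add_sub_cancel_left]

theorem upperRow_partialTheta_self :
    upperRow (partialTheta n c n) n =
      Matrix.vecMul (fun r => (-1) ^ r.val * elemSum c n (r.val + 1)) (bottomRows n c) := by
  have hsum := sum_elemSum_smul_upperRow hc le_rfl
  rw [Finset.Nat.sum_antidiagonal_eq_sum_range_succ_mk, Finset.sum_range_succ', pow_zero,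
    elemSum_zero_right, one_mul, one_smul, Nat.sub_zero] at hsum
  rw [eq_neg_of_add_eq_zero_right hsum, Matrix.vecMul_eq_sum, ← Finset.sum_neg_distrib,
    ← Fin.sum_univ_eq_sum_range
      fun r => -(((-1) ^ (r + 1) * elemSum c n (r + 1)) •
        upperRow (partialTheta n c (n - (r + 1))) n)]
  refine Finset.sum_congr rfl fun r _ => ?_
  rw [show n - (r.val + 1) = n - 1 - r.val by omega, pow_succ,
    show bottomRows n c r = upperRow (partialTheta n c (n - 1 - r.val)) n from rfl]
  module

omit hc in
/-- When `y` is expanded in the rows of `C`, the coefficient of the row `l` is the value at `y` of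
the inverse of the quadratic form `Tᵀ W T`, `W` the diagonal matrix of `w`. -/
theorem det_updateRow_of_gram {m K : Type*} [Fintype m] [DecidableEq m] [Field K]
    {B C T : Matrix m m K} {w x y : m → K} {l : m}
    (hBC : B * C = T.transpose * Matrix.diagonal w * T) (hT : IsUnit T.det) (hw : ∀ q, w q ≠ 0)
    (hB : ∀ b, B b l = y b) (hy : y = Matrix.vecMul x T) :
    (C.updateRow l y).det = (∑ q, (w q)⁻¹ * x q ^ 2) * C.det := by
  let z := Matrix.vecMul (fun q => (w q)⁻¹ * x q) T.transpose⁻¹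
  have hz : Matrix.vecMul z T.transpose = fun q => (w q)⁻¹ * x q := by
    rw [Matrix.vecMul_vecMul, Matrix.nonsing_inv_mul _ (by rwa [Matrix.det_transpose]),
      Matrix.vecMul_one]
  have hrows : y = ∑ k, Matrix.vecMul z B k • C k := by
    rw [← Matrix.vecMul_eq_sum, Matrix.vecMul_vecMul, hBC, ← Matrix.vecMul_vecMul,
      ← Matrix.vecMul_vecMul, hz, hy]
    congr 1
    funext q
    rw [Matrix.vecMul_diagonal]
    field_simp [hw q]
  have hcoeff : Matrix.vecMul z B l = ∑ q, (w q)⁻¹ * x q ^ 2 := calc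
    Matrix.vecMul z B l = z ⬝ᵥ y := by simp only [Matrix.vecMul, dotProduct, hB]
    _ = ∑ q, (w q)⁻¹ * x q ^ 2 := by
      rw [hy, ← Matrix.mulVec_transpose, Matrix.dotProduct_mulVec, hz, dotProduct]
      exact Finset.sum_congr rfl fun q _ => by ring
  rw [hrows, Matrix.det_updateRow_sum, hcoeff, smul_eq_mul]

omit hc in
theorem thetaMinus_minor_eq_updateRow (hn : 0 < n) (c : Fin n → ℤ → ℂ) :
    (Matrix.of fun a b : Fin n =>
      thetaMinus n c (if a.val + 1 < n then .inr a else .inl a) (.inl b)) =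
      (partialTheta n c n).toRows₂.updateRow (lastIdx n hn) (upperRow (partialTheta n c n) n) := by
  have hrow := upperRow_succ (partialTheta n c n) (lastIdx n hn)
  rw [show (lastIdx n hn).val + 1 = n from Nat.sub_add_cancel hn] at hrow
  ext a b
  rw [hrow, Matrix.of_apply, Matrix.updateRow_apply, partialTheta_self]
  by_cases ha : a = lastIdx n hn
  · subst ha
    rw [if_pos rfl, if_neg (by simp only [lastIdx]; omega)]
    rfl
  · have hlt : a.val + 1 < n := by
      have hne : a.val ≠ n - 1 := fun h => ha (Fin.ext h)
      omega
    rw [if_neg ha, if_pos hlt]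
    rfl

theorem prod_sign_mul_det_thetaMinus (hn : 0 < n) :
    (∏ a : Fin n, (-1 : ℂ) ^ (n - 1 - a.val)) *
        (Matrix.of fun a b : Fin n =>
          thetaMinus n c (if a.val + 1 < n then .inr a else .inl a) (.inl b)).det =
      ∑ r : Fin n, varValue c (r.val + 1) n * elemSum c n (r.val + 1) ^ 2 := by
  let g := partialTheta n c n
  have hcolumn (b : Fin n) :
      (g.toRows₁.transpose * Matrix.diagonal fun k : Fin n => (-1 : ℂ) ^ (n - 1 - k.val)) b
        (lastIdx n hn) = upperRow g n b := by
    have hrow := upperRow_succ g (lastIdx n hn)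
    rw [show (lastIdx n hn).val + 1 = n from Nat.sub_add_cancel hn] at hrow
    rw [hrow, Matrix.mul_diagonal, show n - 1 - (lastIdx n hn).val = 0 from Nat.sub_self _,
      pow_zero, mul_one]
    rfl
  rw [thetaMinus_minor_eq_updateRow hn, det_updateRow_of_gram (halfPairing_partialTheta_self hc)
      (det_bottomRows hc ▸ isUnit_one) (fun r => inv_ne_zero (varValue_ne_zero hc _ _)) hcolumn
      (upperRow_partialTheta_self hc), mul_left_comm, prod_sign_mul_det_toRows₂_partialTheta hc,
    mul_one]
  refine Finset.sum_congr rfl fun r _ => ?_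
  rw [inv_inv, mul_pow, ← pow_mul, mul_comm r.val, pow_mul, neg_one_sq, one_pow, one_mul]

end ThetaMinus

/-! ### Evaluation of monomials -/

section SumOverColumns

variable {n : ℕ} {c : Fin n → ℤ → ℂ}

theorem evalMono_add (hc : ∀ i p, c i p ≠ 0) (Y Z : LaurentMonomial n) :
    evalMono c (Y + Z) = evalMono c Y * evalMono c Z :=
  Finsupp.prod_add_index' (fun _ => zpow_zero _) fun q _ _ => zpow_add₀ (hc q.2 q.1) _ _

theorem evalMono_zero (c : Fin n → ℤ → ℂ) : evalMono c 0 = 1 := Finsupp.prod_zero_index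

theorem evalMono_sub (hc : ∀ i p, c i p ≠ 0) (Y Z : LaurentMonomial n) :
    evalMono c (Y - Z) = evalMono c Y / evalMono c Z := by
  have hne : evalMono c Z ≠ 0 := Finset.prod_ne_zero_iff.2 fun q _ => zpow_ne_zero _ (hc q.2 q.1)
  rw [eq_div_iff hne, ← evalMono_add hc, sub_add_cancel]

theorem evalMono_varY (c : Fin n → ℤ → ℂ) (m : ℤ) (x : ℕ) :
    evalMono c (varY n m x) = varValue c m x := by
  rw [varY, varValue]
  split_ifs
  · rw [evalMono, monoVar, Finsupp.prod_single_index (zpow_zero _), zpow_one]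
  · exact evalMono_zero c

theorem evalMono_boxNeg (hc : ∀ i p, c i p ≠ 0) (b : ℤ) (x : ℕ) :
    evalMono c (boxNeg n b x) = varRatio c (n - x + b) x := by
  rw [boxNeg, evalMono_sub hc, evalMono_varY, evalMono_varY, varRatio]

/-! ### Increasing lists and finite sets -/

theorem card_toFinset_of_pairwise_lt {l : List ℕ} (hl : l.Pairwise (· < ·)) :
    l.toFinset.card = l.length :=
  List.toFinset_card_of_nodup (hl.imp fun h => h.ne)

theorem toFinset_subset_Icc {l : List ℕ} (hl : ∀ x ∈ l, 1 ≤ x ∧ x ≤ n) :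
    l.toFinset ⊆ Finset.Icc 1 n :=
  fun x hx => Finset.mem_Icc.2 (hl x (List.mem_toFinset.1 hx))

/-- The increasing list of the elements of `S` in `{1, …, j}`; this is the form in which the letters
of one kind enter a column. -/
def subsetList (j : ℕ) (S : Finset ℕ) : List ℕ := (List.range' 1 j).filter (· ∈ S)

theorem mem_subsetList {j x : ℕ} {S : Finset ℕ} :
    x ∈ subsetList j S ↔ (1 ≤ x ∧ x ≤ j) ∧ x ∈ S := by
  simp only [subsetList, List.mem_filter, List.mem_range'_1, decide_eq_true_eq]
  exact and_congr_left fun _ => by omega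

theorem pairwise_subsetList (j : ℕ) (S : Finset ℕ) : (subsetList j S).Pairwise (· < ·) :=
  List.Pairwise.filter _ List.pairwise_lt_range'

theorem subsetList_succ (j : ℕ) (S : Finset ℕ) :
    subsetList (j + 1) S = subsetList j S ++ if j + 1 ∈ S then [j + 1] else [] := by
  rw [subsetList, List.range'_1_concat, List.filter_append, add_comm 1 j]
  congr 1
  by_cases h : j + 1 ∈ S <;> simp [h]

theorem subsetList_insert_succ (j : ℕ) (S : Finset ℕ) :
    subsetList j (insert (j + 1) S) = subsetList j S := by
  refine List.filter_congr fun x hx => ?_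
  rw [List.mem_range'_1] at hx
  simp [show x ≠ j + 1 by omega]

theorem toFinset_subsetList {j : ℕ} {S : Finset ℕ} (hS : S ⊆ Finset.Icc 1 j) :
    (subsetList j S).toFinset = S := by
  ext x
  rw [List.mem_toFinset, mem_subsetList, ← Finset.mem_Icc]
  exact ⟨fun h => h.2, fun h => ⟨hS h, h⟩⟩

theorem length_subsetList {j : ℕ} {S : Finset ℕ} (hS : S ⊆ Finset.Icc 1 j) :
    (subsetList j S).length = S.card := by
  rw [← card_toFinset_of_pairwise_lt (pairwise_subsetList j S), toFinset_subsetList hS]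

theorem subsetList_toFinset {j : ℕ} {l : List ℕ} (hl : l.Pairwise (· < ·))
    (hrange : ∀ x ∈ l, 1 ≤ x ∧ x ≤ j) : subsetList j l.toFinset = l := by
  have sort_toFinset (s : List ℕ) (hs : s.Pairwise (· < ·)) : s.toFinset.sort (· ≤ ·) = s :=
    (List.toFinset_sort (· ≤ ·) (hs.imp fun h => h.ne)).2 (hs.imp fun h => h.le)
  rw [← sort_toFinset _ (pairwise_subsetList j _),
    toFinset_subsetList (toFinset_subset_Icc hrange), sort_toFinset _ hl]

/-! ### Sums over subsets -/

theorem sum_powersetCard_succ_insert {α M : Type*} [DecidableEq α] [AddCommMonoid M] {a : α}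
    {s : Finset α} (ha : a ∉ s) (r : ℕ) (f : Finset α → M) :
    ∑ S ∈ Finset.powersetCard (r + 1) (insert a s), f S =
      ∑ S ∈ Finset.powersetCard (r + 1) s, f S +
        ∑ S ∈ Finset.powersetCard r s, f (insert a S) := by
  have not_mem {k : ℕ} {S : Finset α} (hS : S ∈ Finset.powersetCard k s) : a ∉ S :=
    fun h => ha ((Finset.mem_powersetCard.1 hS).1 h)
  rw [Finset.powersetCard_succ_insert ha, Finset.sum_union, Finset.sum_image]
  · exact Finset.insert_erase_invOn.2.injOn.mono fun S hS => not_mem hS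
  · rw [Finset.disjoint_left]
    intro S hS hS'
    obtain ⟨R, -, rfl⟩ := Finset.mem_image.1 hS'
    exact not_mem hS (Finset.mem_insert_self _ _)

theorem elemSum_eq_sum (hc : ∀ i p, c i p ≠ 0) (j r : ℕ) :
    elemSum c j r = ∑ S ∈ Finset.powersetCard r (Finset.Icc 1 j),
      evalMono c (posSum (boxNeg n) 1 (subsetList j S)) := by
  induction j generalizing r with
  | zero =>
    rcases r with _ | r
    · simp [elemSum, subsetList, posSum, evalMono_zero]
    · rw [elemSum, Finset.powersetCard_eq_empty.2 (by simp), Finset.sum_empty]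
  | succ j ih =>
    rcases r with _ | r
    · simp [elemSum, subsetList, posSum, evalMono_zero]
    have hj : j + 1 ∉ Finset.Icc 1 j := by simp
    rw [elemSum, ih, ih, ← Finset.insert_Icc_right_eq_Icc_add_one (by omega),
      sum_powersetCard_succ_insert hj, Finset.mul_sum]
    congr 1 <;> refine Finset.sum_congr rfl fun S hS => ?_ <;>
      obtain ⟨hsub, hcard⟩ := Finset.mem_powersetCard.1 hS
    · rw [subsetList_succ, if_neg fun h => hj (hsub h), List.append_nil]
    · rw [subsetList_succ, if_pos (Finset.mem_insert_self _ _), subsetList_insert_succ,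
        posSum_append, evalMono_add hc, length_subsetList hsub, hcard, posSum, posSum, add_zero,
        evalMono_boxNeg hc, mul_comm,
        show (n : ℤ) - (j + 1 : ℕ) + (1 + r) = n - j + r by push_cast; ring]

/-! ### Columns as pairs of sets -/

theorem length_filter_notMem_add (j : ℕ) (U : Finset ℕ) :
    ((List.range' 1 j).filter (· ∉ U)).length + (subsetList j U).length = j := by
  have hlength := List.length_eq_length_filter_add (l := List.range' 1 j) (· ∈ U)
  rw [List.length_range'] at hlength
  simp only [subsetList, decide_not]
  omega

theorem posSum_boxPos_compl (n j : ℕ) (U : Finset ℕ) :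
    posSum (boxPos n) 1 ((List.range' 1 j).filter (· ∉ U)) =
      varY n (n - j + (subsetList j U).length) j + posSum (boxNeg n) 1 (subsetList j U) := by
  induction j with
  | zero => simp [posSum, subsetList, varY]
  | succ j ih =>
    have hlength := length_filter_notMem_add j U
    rw [List.range'_1_concat, List.filter_append, posSum_append, ih, subsetList_succ, add_comm 1 j]
    by_cases hU : j + 1 ∈ U
    · rw [if_pos hU, List.filter_cons_of_neg (by simpa using hU), List.filter_nil, posSum_append]
      simp only [posSum, boxNeg, List.length_append, List.length_singleton, Nat.add_sub_cancel]
      push_cast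
      rw [show (n : ℤ) - (j + 1) + (1 + (subsetList j U).length) =
          n - j + (subsetList j U).length by ring,
        show (n : ℤ) - (j + 1) + ((subsetList j U).length + 1) =
          n - j + (subsetList j U).length by ring]
      abel
    · rw [if_neg hU, List.filter_cons_of_pos (by simpa using hU), List.filter_nil, List.append_nil]
      simp only [posSum, boxPos, Nat.add_sub_cancel]
      push_cast
      rw [show (n : ℤ) - (1 + (List.filter (· ∉ U) (List.range' 1 j)).length) =
          n - (j + 1) + (subsetList j U).length by omega,
        show (n : ℤ) + 1 - (1 + (List.filter (· ∉ U) (List.range' 1 j)).length) =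
          n - j + (subsetList j U).length by omega]
      abel

/-- The column whose unbarred letters are those outside `U` and whose barred letters are those in
`L`. Taking the complement for the unbarred letters makes the two sets play symmetric roles in the
monomial of the column. -/
def columnOfSets (n : ℕ) (U L : Finset ℕ) : Column :=
  ⟨subsetList n (Finset.Icc 1 n \ U), subsetList n L⟩

variable {r : ℕ} {U L : Finset ℕ} {v : Column}

theorem colMono_columnOfSets (hU : U ∈ Finset.powersetCard r (Finset.Icc 1 n)) (L : Finset ℕ) :
    colMono n (columnOfSets n U L) = varY n r n + posSum (boxNeg n) 1 (subsetList n U) +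
      posSum (boxNeg n) 1 (subsetList n L) := by
  obtain ⟨hsub, hcard⟩ := Finset.mem_powersetCard.1 hU
  have hcompl : subsetList n (Finset.Icc 1 n \ U) = (List.range' 1 n).filter (· ∉ U) := by
    refine List.filter_congr fun x hx => ?_
    rw [List.mem_range'_1] at hx
    simp only [Finset.mem_sdiff, Finset.mem_Icc.2 (show 1 ≤ x ∧ x ≤ n by omega), true_and]
  rw [colMono, columnOfSets, hcompl, posSum_boxPos_compl, length_subsetList hsub, hcard, sub_self,
    zero_add]

theorem isColumn_columnOfSets (hU : U ∈ Finset.powersetCard r (Finset.Icc 1 n))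
    (hL : L ∈ Finset.powersetCard r (Finset.Icc 1 n)) : IsColumn n (columnOfSets n U L) := by
  rw [Finset.mem_powersetCard] at hU hL
  refine ⟨pairwise_subsetList _ _, pairwise_subsetList _ _,
    fun x hx => (mem_subsetList.1 hx).1, fun x hx => (mem_subsetList.1 hx).1, ?_⟩
  have hle := Finset.card_le_card hU.1
  rw [Nat.card_Icc] at hle
  simp only [columnOfSets]
  rw [length_subsetList Finset.sdiff_subset, length_subsetList hL.1,
    Finset.card_sdiff_of_subset hU.1, Nat.card_Icc]
  omega

theorem length_columnOfSets (U : Finset ℕ) (hL : L ∈ Finset.powersetCard r (Finset.Icc 1 n)) :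
    (columnOfSets n U L).l.length = r := by
  rw [Finset.mem_powersetCard] at hL
  exact (length_subsetList hL.1).trans hL.2

theorem IsColumn.compl_mem_powersetCard (hv : IsColumn n v) :
    Finset.Icc 1 n \ v.u.toFinset ∈ Finset.powersetCard v.l.length (Finset.Icc 1 n) := by
  obtain ⟨hu, -, hu_range, -, hlength⟩ := hv
  rw [Finset.mem_powersetCard, Finset.card_sdiff_of_subset (toFinset_subset_Icc hu_range),
    card_toFinset_of_pairwise_lt hu, Nat.card_Icc]
  exact ⟨Finset.sdiff_subset, by omega⟩

theorem IsColumn.toFinset_mem_powersetCard (hv : IsColumn n v) :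
    v.l.toFinset ∈ Finset.powersetCard v.l.length (Finset.Icc 1 n) :=
  Finset.mem_powersetCard.2
    ⟨toFinset_subset_Icc hv.2.2.2.1, card_toFinset_of_pairwise_lt hv.2.1⟩

theorem IsColumn.columnOfSets_eq (hv : IsColumn n v) :
    columnOfSets n (Finset.Icc 1 n \ v.u.toFinset) v.l.toFinset = v := by
  obtain ⟨hu, hl, hu_range, hl_range, -⟩ := hv
  rw [columnOfSets, Finset.sdiff_sdiff_eq_self (toFinset_subset_Icc hu_range),
    subsetList_toFinset hu hu_range, subsetList_toFinset hl hl_range]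

theorem sum_columns_length_eq {M : Type*} [AddCommMonoid M] (r : ℕ) (F : Column → M) :
    ∑ v ∈ columns n with v.l.length = r, F v =
      ∑ U ∈ Finset.powersetCard r (Finset.Icc 1 n), ∑ L ∈ Finset.powersetCard r (Finset.Icc 1 n),
        F (columnOfSets n U L) := by
  rw [← Finset.sum_product']
  refine Finset.sum_nbij' (fun v => (Finset.Icc 1 n \ v.u.toFinset, v.l.toFinset))
    (fun p => columnOfSets n p.1 p.2) ?_ ?_ ?_ ?_ ?_
  · intro v hv
    rw [Finset.mem_filter, mem_columns] at hv
    obtain ⟨hv, rfl⟩ := hv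
    exact Finset.mem_product.2 ⟨hv.compl_mem_powersetCard, hv.toFinset_mem_powersetCard⟩
  · rintro ⟨U, L⟩ hp
    obtain ⟨hU, hL⟩ := Finset.mem_product.1 hp
    exact Finset.mem_filter.2
      ⟨mem_columns.2 (isColumn_columnOfSets hU hL), length_columnOfSets U hL⟩
  · exact fun v hv => (mem_columns.1 (Finset.mem_filter.1 hv).1).columnOfSets_eq
  · rintro ⟨U, L⟩ hp
    simp only [Finset.mem_product, Finset.mem_powersetCard] at hp
    simp only [columnOfSets, toFinset_subsetList hp.2.1, toFinset_subsetList Finset.sdiff_subset,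
      Finset.sdiff_sdiff_eq_self hp.1.1]
  · exact fun v hv => by rw [(mem_columns.1 (Finset.mem_filter.1 hv).1).columnOfSets_eq]

theorem sum_evalMono_colMono_length_eq (hc : ∀ i p, c i p ≠ 0) (r : ℕ) :
    ∑ v ∈ columns n with v.l.length = r, evalMono c (colMono n v) =
      varValue c r n * elemSum c n r ^ 2 := by
  rw [sum_columns_length_eq, sq, elemSum_eq_sum hc, Finset.sum_mul_sum, Finset.mul_sum]
  refine Finset.sum_congr rfl fun U hU => ?_
  rw [Finset.mul_sum]
  refine Finset.sum_congr rfl fun L _ => ?_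
  rw [colMono_columnOfSets hU, evalMono_add hc, evalMono_add hc, evalMono_varY, mul_assoc]

theorem sum_evalMono_colMono (hc : ∀ i p, c i p ≠ 0) :
    ∑ v ∈ columns n with v.l ≠ [], evalMono c (colMono n v) =
      ∑ r : Fin n, varValue c (r.val + 1) n * elemSum c n (r.val + 1) ^ 2 := by
  have hfiber (r : ℕ) : {v ∈ {v ∈ columns n | v.l ≠ []} | v.l.length - 1 = r} =
      {v ∈ columns n | v.l.length = r + 1} := by
    rw [Finset.filter_filter]
    refine Finset.filter_congr fun v _ => ?_
    rw [← List.length_pos_iff]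
    omega
  rw [Fin.sum_univ_eq_sum_range fun r => varValue c (r + 1) n * elemSum c n (r + 1) ^ 2,
    ← Finset.sum_fiberwise_of_maps_to (t := Finset.range n) (g := fun v => v.l.length - 1)]
  · refine Finset.sum_congr rfl fun r _ => ?_
    rw [hfiber, sum_evalMono_colMono_length_eq hc, Nat.cast_succ]
  · intro v hv
    rw [Finset.mem_filter, mem_columns, ← List.length_pos_iff] at hv
    have hlength := hv.1.2.2.2.2
    rw [Finset.mem_range]
    omega

/-! ### Parameters outside `1, …, n` -/

/-- The parameters `c`, set to `1` for superscripts outside `1, …, n`. -/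
def truncParam (c : Fin n → ℤ → ℂ) : Fin n → ℤ → ℂ :=
  fun i p => if 1 ≤ p ∧ p ≤ n then c i p else 1

theorem truncParam_ne_zero (hc : ∀ (i : Fin n) (p : ℤ), 1 ≤ p → p ≤ n → c i p ≠ 0) (i : Fin n)
    (p : ℤ) : truncParam c i p ≠ 0 := by
  rw [truncParam]
  split_ifs with hp
  · exact hc i p hp.1 hp.2
  · exact one_ne_zero

theorem thetaMinus_truncParam (c : Fin n → ℤ → ℂ) :
    thetaMinus n (truncParam c) = thetaMinus n c := by
  have heq (i p : Fin n) : truncParam c i (p.val + 1) = c i (p.val + 1) := by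
    rw [truncParam, if_pos (by omega)]
  simp only [thetaMinus, heq]

/-- The group of monomials in the variables `Y_{m,i}` with `1 ≤ m ≤ n`. -/
def mainRange (n : ℕ) : Submodule ℤ (LaurentMonomial n) :=
  Finsupp.supported ℤ ℤ {q | 1 ≤ q.1 ∧ q.1 ≤ n}

theorem evalMono_truncParam (c : Fin n → ℤ → ℂ) {Y : LaurentMonomial n} (hY : Y ∈ mainRange n) :
    evalMono (truncParam c) Y = evalMono c Y := by
  refine Finset.prod_congr rfl fun q hq => ?_
  have hrange : 1 ≤ q.1 ∧ q.1 ≤ n := (Finsupp.mem_supported _ _).1 hY (Finset.mem_coe.2 hq)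
  simp only [truncParam, if_pos hrange]

theorem varY_mem_mainRange {m : ℤ} (hm : 1 ≤ m) (hmn : m ≤ n) (x : ℕ) :
    varY n m x ∈ mainRange n := by
  rw [varY]
  split_ifs
  · exact Finsupp.single_mem_supported ℤ _ ⟨hm, hmn⟩
  · exact Submodule.zero_mem _

theorem posSum_boxNeg_mem_mainRange {l : List ℕ} (hl : l.Pairwise (· < ·)) (hle : ∀ x ∈ l, x ≤ n)
    {b : ℤ} (hb : 1 ≤ b) (hb_le : ∀ x ∈ l, b ≤ x) : posSum (boxNeg n) b l ∈ mainRange n := by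
  induction l generalizing b with
  | nil => exact Submodule.zero_mem _
  | cons x l ih =>
    rw [List.pairwise_cons] at hl
    rw [List.forall_mem_cons] at hle hb_le
    refine Submodule.add_mem _ (Submodule.sub_mem _ ?_ ?_) (ih hl.2 hle.2 (by omega) ?_)
    · exact varY_mem_mainRange (by omega) (by omega) _
    · exact varY_mem_mainRange (by omega) (by omega) _
    · intro y hy
      have hlt := hl.1 y hy
      omega

theorem posSum_boxNeg_subsetList_mem_mainRange (S : Finset ℕ) :
    posSum (boxNeg n) 1 (subsetList n S) ∈ mainRange n :=
  posSum_boxNeg_mem_mainRange (pairwise_subsetList _ _) (fun _ hx => (mem_subsetList.1 hx).1.2)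
    le_rfl fun _ hx => Nat.one_le_cast.2 (mem_subsetList.1 hx).1.1

theorem IsColumn.colMono_mem_mainRange (hv : IsColumn n v) (hl : v.l ≠ []) :
    colMono n v ∈ mainRange n := by
  have hpos := List.length_pos_iff.2 hl
  have hlength := hv.2.2.2.2
  rw [← hv.columnOfSets_eq, colMono_columnOfSets hv.compl_mem_powersetCard]
  refine Submodule.add_mem _ (Submodule.add_mem _ ?_ ?_) ?_
  · exact varY_mem_mainRange (by omega) (by omega) _
  · exact posSum_boxNeg_subsetList_mem_mainRange _
  · exact posSum_boxNeg_subsetList_mem_mainRange _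

theorem generalizedMinor_thetaMinus {hn : 0 < n} {u : List (Fin n)} (hred : IsReducedWord n u)
    (hu : weylOf n u = weylOf n (longestWord n ++ [lastIdx n hn]))
    (hc : ∀ (i : Fin n) (p : ℤ), 1 ≤ p → p ≤ n → c i p ≠ 0) :
    generalizedMinor n (lastIdx n hn) u [] (thetaMinus n c) =
      ∑ b ∈ Finset.univ.erase (highestColumn n),
        (rectMultiplicity b : ℂ) * evalMono c (colMono n b.val) := by
  have hc' := truncParam_ne_zero hc
  calc generalizedMinor n (lastIdx n hn) u [] (thetaMinus n c)
      = ∑ v ∈ columns n with v.l ≠ [], evalMono (truncParam c) (colMono n v) := by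
        rw [generalizedMinor_eq_det hred hu, ← thetaMinus_truncParam c,
          prod_sign_mul_det_thetaMinus hc' hn, sum_evalMono_colMono hc']
    _ = ∑ b ∈ Finset.univ.erase (highestColumn n),
          (rectMultiplicity b : ℂ) * evalMono (truncParam c) (colMono n b.val) :=
        (sum_rectMultiplicity_mul n (evalMono (truncParam c))).symm
    _ = _ := by
        refine Finset.sum_congr rfl fun b hb => ?_
        rw [Finset.mem_erase, Ne, eq_highestColumn_iff] at hb
        rw [evalMono_truncParam c (b.2.1.colMono_mem_mainRange hb.1)]

end SumOverColumns

end TypeC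

open TypeC in
theorem mainTheorem3 (n : ℕ) (hn : 0 < n) :
    -- every column in `𝓑` has a well-defined rectification in `B(Λ_n)`
    (∀ v : Column, IsColumn n v → ∃! b : AdmissibleColumn n, IsRect v b) ∧
    -- there is a unique embedding of crystals `B(Λ_n) → 𝒴(p)` with `u_{Λ_n} ↦ c_n^{(0)}`
    (∃! m : AdmissibleColumn n → LaurentMonomial n,
      IsCrystalEmbedding (columnCrystal n) (monomialCrystal n) m ∧
        m (highestColumn n) = monoVar n 0 (lastIdx n hn)) ∧
    ∀ m : AdmissibleColumn n → LaurentMonomial n,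
      IsCrystalEmbedding (columnCrystal n) (monomialCrystal n) m →
      m (highestColumn n) = monoVar n 0 (lastIdx n hn) →
      -- any reduced word `u` of the Weyl group element `w_0 s_n`
      ∀ u : List (Fin n), IsReducedWord n u →
        weylOf n u = weylOf n (longestWord n ++ [lastIdx n hn]) →
      -- parameters `c_i^{(p)} ∈ ℂ^×`, `1 ≤ i, p ≤ n`
      ∀ c : Fin n → ℤ → ℂ, (∀ (i : Fin n) (p : ℤ), 1 ≤ p → p ≤ n → c i p ≠ 0) →
        generalizedMinor n (lastIdx n hn) u [] (thetaMinus n c) =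
          ∑ b ∈ Finset.univ.erase (highestColumn n),
            (rectMultiplicity b : ℂ) * evalMono c (m b) := by
  refine ⟨fun v hv => hv.existsUnique_isRect,
    ⟨fun b => colMono n b.val, ⟨isCrystalEmbedding_colMono n, colMono_highestColumn hn⟩,
      fun m hm => hm.1.eq_colMono hm.2⟩, ?_⟩
  intro m hm h0 u hred hu c hc
  rw [hm.eq_colMono h0]
  exact generalizedMinor_thetaMinus hred hu hc
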